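/- Conventions. Let $A$ be a unital C*-algebra. Projections (self-adjoint idempotents) $p\in M_n(A)$ and $q\in M_m(A)$ are Murray–von Neumann equivalent if $p=v^*v$ and $q=vv^*$ for some rectangular matrix $v\in M_{m,n}(A)$. The equivalence classes of projections in $\bigcup_{n} M_n(A)$ form an abelian semigroup $V(A)$ under $p\oplus q=\mathrm{diag}(p,q)$, and $K_0(A)$ is its Grothendieck group. Write $[p]$ for the class of $p$ in $K_0(A)$, and put $$K_0(A)_+=\{[p]: p \text{ a projection in some } M_n(A)\},\qquad \Sigma(A)=\{[p]: p\text{ a projection in } A\}.$$ A scaled ordered group is an abelian group $G$ with a subset $G_+$ satisfying $G_++G_+\subseteq G_+$, $G_+\cap(-G_+)=\{0\}$, $G_+-G_+=G$ (and the order $x\le y\iff y-x\in G_+$), together with a subset $\Gamma\subseteq G_+$ such that every element of $G_+$ is a finite sum of elements of $\Gamma$; $0\le a\le b\in\Gamma$ implies $a\in\Gamma$; and any $a,b\in\Gamma$ satisfy $a,b\le c$ for some $c\in\Gamma$. An isomorphism of scaled ordered groups is a group isomorphism that maps the positive cone onto the positive cone and the scale onto the scale. Let $\mathcal F_1$ be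 the class of all simple, unital, separable C*-algebras $A$ of real rank zero (the invertible self-adjoint elements are dense in the self-adjoint elements) with cancellation (in $V(A)$, $a+c=b+c$ implies $a=b$) such that the group $K_0(A)$ is not cyclic and $(K_0(A),K_0(A)_+)$ is weakly unperforated ($nx>0$ for some integer $n\ge 1$ implies $x>0$). Theorem. Let $A$ and $B$ be C*-algebras in $\mathcal F_1$. If the groups $GL(A)$ and $GL(B)$ of invertible elements are isomorphic as abstract groups, then $K_0(A)$ and $K_0(B)$ are isomorphic as scaled ordered groups; that is, $(K_0(A),K_0(A)_+,\Sigma(A))$ and $(K_0(B),K_0(B)_+,\Sigma(B))$ are scaled ordered groups, and there is a group isomorphism $\alpha:K_0(A)\to K_0(B)$ with $\alpha(K_0(A)_+)=K_0(B)_+$ and $\alpha(\Sigma(A))=\Sigma(B)$. -/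

import Mathlib

namespace CStarK

open Matrix

section Equivalence

variable {A : Type*} [Ring A] [StarRing A]

/-- Murray-von Neumann equivalence of square matrices over `A`, possibly of different sizes:
`p = v* v` and `q = v v*` for some rectangular matrix `v` over `A`. -/
def MvN {m n : Type*} [Fintype m] [Fintype n] (p : Matrix m m A) (q : Matrix n n A) : Prop :=
  ∃ v : Matrix n m A, vᴴ * v = p ∧ v * vᴴ = q

variable {l m n m' n' : Type*} [Fintype l] [Fintype m] [Fintype n] [Fintype m'] [Fintype n']

theorem MvN.refl {p : Matrix m m A} (hp : IsStarProjection p) : MvN p p := by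
  have h1 : pᴴ = p := hp.isSelfAdjoint
  have h2 : p * p = p := hp.isIdempotentElem
  exact ⟨p, by rw [h1, h2], by rw [h1, h2]⟩

theorem MvN.symm {p : Matrix m m A} {q : Matrix n n A} (h : MvN p q) : MvN q p := by
  obtain ⟨v, h1, h2⟩ := h
  exact ⟨vᴴ, by rw [conjTranspose_conjTranspose, h2], by rw [conjTranspose_conjTranspose, h1]⟩

theorem MvN.trans {p : Matrix l l A} {q : Matrix m m A} {r : Matrix n n A}
    (hp : IsStarProjection p) (hr : IsStarProjection r) (h : MvN p q) (h' : MvN q r) :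
    MvN p r := by
  obtain ⟨v, h1, h2⟩ := h
  obtain ⟨w, h3, h4⟩ := h'
  have hpp : p * p = p := hp.isIdempotentElem
  have hrr : r * r = r := hr.isIdempotentElem
  refine ⟨w * v, ?_, ?_⟩
  · calc (w * v)ᴴ * (w * v) = vᴴ * (wᴴ * w) * v := by
          rw [conjTranspose_mul]; simp only [Matrix.mul_assoc]
      _ = (vᴴ * v) * (vᴴ * v) := by rw [h3, ← h2]; simp only [Matrix.mul_assoc]
      _ = p := by rw [h1, hpp]
  · calc (w * v) * (w * v)ᴴ = w * (v * vᴴ) * wᴴ := by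
          rw [conjTranspose_mul]; simp only [Matrix.mul_assoc]
      _ = (w * wᴴ) * (w * wᴴ) := by rw [h2, ← h3]; simp only [Matrix.mul_assoc]
      _ = r := by rw [h4, hrr]

/-- Re-indexing a projection does not change its class. -/
theorem MvN.reindex {p : Matrix m m A} (hp : IsStarProjection p) (e : n ≃ m) :
    MvN p (p.submatrix e e) := by
  have h1 : pᴴ = p := hp.isSelfAdjoint
  have h2 : p * p = p := hp.isIdempotentElem
  refine ⟨p.submatrix e id, ?_, ?_⟩
  · rw [conjTranspose_submatrix, h1, submatrix_mul_equiv, h2, submatrix_id_id]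
  · rw [conjTranspose_submatrix, h1, ← submatrix_mul p p e id e Function.bijective_id, h2]

theorem MvN.fromBlocks {p : Matrix m m A} {q : Matrix n n A} {p' : Matrix m' m' A}
    {q' : Matrix n' n' A} (h : MvN p p') (h' : MvN q q') :
    MvN (fromBlocks p 0 0 q) (fromBlocks p' 0 0 q') := by
  obtain ⟨v, h1, h2⟩ := h
  obtain ⟨w, h3, h4⟩ := h'
  exact ⟨Matrix.fromBlocks v 0 0 w,
    by simp [fromBlocks_conjTranspose, fromBlocks_multiply, h1, h3],
    by simp [fromBlocks_conjTranspose, fromBlocks_multiply, h2, h4]⟩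

theorem isStarProjection_submatrix {p : Matrix m m A} (hp : IsStarProjection p) (e : n ≃ m) :
    IsStarProjection (p.submatrix e e) := by
  have h1 : pᴴ = p := hp.isSelfAdjoint
  have h2 : p * p = p := hp.isIdempotentElem
  refine ⟨?_, ?_⟩
  · change p.submatrix e e * p.submatrix e e = _
    rw [submatrix_mul_equiv, h2]
  · change (p.submatrix e e)ᴴ = _
    rw [conjTranspose_submatrix, h1]

theorem isStarProjection_fromBlocks {p : Matrix m m A} {q : Matrix n n A}
    (hp : IsStarProjection p) (hq : IsStarProjection q) :
    IsStarProjection (fromBlocks p 0 0 q) := by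
  have h1 : pᴴ = p := hp.isSelfAdjoint
  have h2 : p * p = p := hp.isIdempotentElem
  have h3 : qᴴ = q := hq.isSelfAdjoint
  have h4 : q * q = q := hq.isIdempotentElem
  refine ⟨?_, ?_⟩
  · change Matrix.fromBlocks p 0 0 q * Matrix.fromBlocks p 0 0 q = _
    simp [fromBlocks_multiply, h2, h4]
  · change (Matrix.fromBlocks p 0 0 q)ᴴ = _
    simp [fromBlocks_conjTranspose, h1, h3]

end Equivalence

section Semigroup

variable (A : Type*) [Ring A] [StarRing A]

/-- Projections (self-adjoint idempotents) in the matrix algebras `M_n(A)`, for all `n`. -/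
structure MatProj where
  size : ℕ
  mat : Matrix (Fin size) (Fin size) A
  isProj : IsStarProjection mat

instance MatProj.setoid : Setoid (MatProj A) where
  r p q := MvN p.mat q.mat
  iseqv :=
    { refl := fun p => MvN.refl p.isProj
      symm := MvN.symm
      trans := fun {p _ r} h h' => MvN.trans p.isProj r.isProj h h' }

variable {A}

/-- The diagonal sum `p ⊕ q = diag(p, q)`. -/
def MatProj.sum (p q : MatProj A) : MatProj A where
  size := p.size + q.size
  mat := (fromBlocks p.mat 0 0 q.mat).submatrix finSumFinEquiv.symm finSumFinEquiv.symm
  isProj := isStarProjection_submatrix (isStarProjection_fromBlocks p.isProj q.isProj) _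

theorem MatProj.sum_mvN (p q : MatProj A) :
    MvN (fromBlocks p.mat 0 0 q.mat) (p.sum q).mat :=
  MvN.reindex (isStarProjection_fromBlocks p.isProj q.isProj) _

/-- The zero projection (of size `0`). -/
def MatProj.zero : MatProj A where
  size := 0
  mat := 0
  isProj := IsStarProjection.zero _

/-- A projection of `A`, as a projection in `M_1(A)`. -/
def MatProj.ofProj (p : A) (hp : IsStarProjection p) : MatProj A where
  size := 1
  mat := Matrix.of fun _ _ => p
  isProj := by
    have h1 : star p = p := hp.isSelfAdjoint
    have h2 : p * p = p := hp.isIdempotentElem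
    refine ⟨?_, ?_⟩
    · ext i j
      simp [Matrix.mul_apply, h2]
    · change (Matrix.of fun _ _ => p)ᴴ = _
      ext i j
      simp [h1]

variable (A)

/-- The Murray-von Neumann semigroup `V(A)` of classes of projections in matrix algebras
over `A`. -/
def V : Type _ := Quotient (MatProj.setoid A)

variable {A}

/-- The class of a matrix projection in `V(A)`. -/
def V.mk (p : MatProj A) : V A := Quotient.mk _ p

theorem MatProj.sum_congr {p q p' q' : MatProj A} (h : MvN p.mat p'.mat)
    (h' : MvN q.mat q'.mat) : MvN (p.sum q).mat (p'.sum q').mat := by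
  have hb := isStarProjection_fromBlocks p'.isProj q'.isProj
  exact MvN.trans (p.sum q).isProj (p'.sum q').isProj
    (MvN.trans (p.sum q).isProj hb (p.sum_mvN q).symm (MvN.fromBlocks h h')) (p'.sum_mvN q')

theorem MatProj.sum_comm (p q : MatProj A) : MvN (p.sum q).mat (q.sum p).mat := by
  have hb := isStarProjection_fromBlocks p.isProj q.isProj
  have hb' := isStarProjection_fromBlocks q.isProj p.isProj
  have h : MvN (Matrix.fromBlocks p.mat 0 0 q.mat) (Matrix.fromBlocks q.mat 0 0 p.mat) := by
    have := MvN.reindex hb (Equiv.sumComm (Fin q.size) (Fin p.size))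
    simpa using this
  exact MvN.trans (p.sum q).isProj (q.sum p).isProj
    (MvN.trans (p.sum q).isProj hb' (p.sum_mvN q).symm h) (q.sum_mvN p)

theorem MatProj.sum_zero (p : MatProj A) : MvN (p.sum MatProj.zero).mat p.mat := by
  have hb := isStarProjection_fromBlocks p.isProj (MatProj.zero (A := A)).isProj
  have h : MvN (Matrix.fromBlocks p.mat 0 0 (MatProj.zero (A := A)).mat) p.mat := by
    have := MvN.reindex hb (Equiv.sumEmpty (Fin p.size) (Fin 0)).symm
    have e : (Matrix.fromBlocks p.mat 0 0 (MatProj.zero (A := A)).mat).submatrix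
        (Equiv.sumEmpty (Fin p.size) (Fin 0)).symm (Equiv.sumEmpty (Fin p.size) (Fin 0)).symm
        = p.mat := by
      ext i j
      rfl
    exact e ▸ this
  exact MvN.trans (p.sum MatProj.zero).isProj p.isProj (p.sum_mvN _).symm h

theorem MatProj.sum_assoc (p q r : MatProj A) :
    MvN ((p.sum q).sum r).mat (p.sum (q.sum r)).mat := by
  have hpq := isStarProjection_fromBlocks p.isProj q.isProj
  have hqr := isStarProjection_fromBlocks q.isProj r.isProj
  have hl := isStarProjection_fromBlocks hpq r.isProj
  have hr := isStarProjection_fromBlocks p.isProj hqr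
  have h1 : MvN ((p.sum q).sum r).mat
      (Matrix.fromBlocks (Matrix.fromBlocks p.mat 0 0 q.mat) 0 0 r.mat) :=
    MvN.trans ((p.sum q).sum r).isProj hl ((p.sum q).sum_mvN r).symm
      (MvN.fromBlocks (p.sum_mvN q).symm (MvN.refl r.isProj))
  have h2 : MvN (Matrix.fromBlocks (Matrix.fromBlocks p.mat 0 0 q.mat) 0 0 r.mat)
      (Matrix.fromBlocks p.mat 0 0 (Matrix.fromBlocks q.mat 0 0 r.mat)) := by
    have := MvN.reindex hl
      (Equiv.sumAssoc (Fin p.size) (Fin q.size) (Fin r.size)).symm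
    have e : (Matrix.fromBlocks (Matrix.fromBlocks p.mat 0 0 q.mat) 0 0 r.mat).submatrix
        (Equiv.sumAssoc (Fin p.size) (Fin q.size) (Fin r.size)).symm
        (Equiv.sumAssoc (Fin p.size) (Fin q.size) (Fin r.size)).symm
        = Matrix.fromBlocks p.mat 0 0 (Matrix.fromBlocks q.mat 0 0 r.mat) := by
      ext i j
      rcases i with i | i | i <;> rcases j with j | j | j <;> rfl
    exact e ▸ this
  have h3 : MvN (Matrix.fromBlocks p.mat 0 0 (Matrix.fromBlocks q.mat 0 0 r.mat))
      (p.sum (q.sum r)).mat :=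
    MvN.trans hr (p.sum (q.sum r)).isProj
      (MvN.fromBlocks (MvN.refl p.isProj) (q.sum_mvN r)) (p.sum_mvN (q.sum r))
  exact MvN.trans ((p.sum q).sum r).isProj (p.sum (q.sum r)).isProj
    (MvN.trans ((p.sum q).sum r).isProj hr h1 h2) h3

instance : Zero (V A) := ⟨V.mk MatProj.zero⟩

instance : Add (V A) :=
  ⟨Quotient.map₂ MatProj.sum (fun _ _ h _ _ h' => MatProj.sum_congr h h')⟩

theorem V.mk_add_mk (p q : MatProj A) : V.mk p + V.mk q = V.mk (p.sum q) := rfl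

theorem V.mk_eq_mk {p q : MatProj A} : V.mk p = V.mk q ↔ MvN p.mat q.mat := Quotient.eq

theorem V.add_comm' (a b : V A) : a + b = b + a :=
  Quotient.inductionOn₂ a b fun p q => Quotient.sound (MatProj.sum_comm p q)

theorem V.add_zero' (a : V A) : a + 0 = a :=
  Quotient.inductionOn a fun p => Quotient.sound (MatProj.sum_zero p)

theorem V.add_assoc' (a b c : V A) : a + b + c = a + (b + c) :=
  Quotient.inductionOn₃ a b c fun p q r => Quotient.sound (MatProj.sum_assoc p q r)

instance : AddCommMonoid (V A) where
  add_assoc := V.add_assoc'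
  zero_add a := by rw [V.add_comm', V.add_zero']
  add_zero := V.add_zero'
  add_comm := V.add_comm'
  nsmul := nsmulRec

end Semigroup

section KZero

variable (A : Type*) [Ring A] [StarRing A]

/-- `K₀(A)` for unital `A`: the Grothendieck group of `V(A)`. -/
abbrev K0 : Type _ := Algebra.GrothendieckAddGroup (V A)

variable {A} in
/-- The class `[p]` in `K₀(A)` of a projection `p` in a matrix algebra over `A`. -/
noncomputable def K0.cls (p : MatProj A) : K0 A := Algebra.GrothendieckAddGroup.of (V.mk p)

/-- The positive cone `K₀(A)₊`: all classes `[p]` of projections `p` in matrix algebras. -/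
def K0.cone : Set (K0 A) := Set.range K0.cls

/-- The scale `Σ(A)`: all classes `[p]` of projections `p` in `A` itself. -/
def K0.scale : Set (K0 A) :=
  {x | ∃ (p : A) (hp : IsStarProjection p), x = K0.cls (MatProj.ofProj p hp)}

end KZero

section OrderedGroups

/-- `P` is the positive cone of an ordered abelian group structure on `G`. -/
structure IsOrderedGroup {G : Type*} [AddCommGroup G] (P : Set G) : Prop where
  add_mem : ∀ a ∈ P, ∀ b ∈ P, a + b ∈ P
  inter_neg : {a | a ∈ P ∧ -a ∈ P} = {0}
  sub_eq : ∀ x : G, ∃ a ∈ P, ∃ b ∈ P, x = a - b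

/-- `(G, P, Γ)` is a scaled ordered group: an ordered group with positive cone `P`
(so `x ≤ y` means `y - x ∈ P`) and a generating, hereditary and directed subset `Γ` of `P`. -/
structure IsScaledOrderedGroup {G : Type*} [AddCommGroup G] (P Γ : Set G) : Prop
    extends IsOrderedGroup P where
  scale_subset : Γ ⊆ P
  generating : ∀ a ∈ P, ∃ s : List G, s ≠ [] ∧ (∀ x ∈ s, x ∈ Γ) ∧ a = s.sum
  hereditary : ∀ a b : G, a ∈ P → b - a ∈ P → b ∈ Γ → a ∈ Γ
  directed : ∀ a ∈ Γ, ∀ b ∈ Γ, ∃ c ∈ Γ, c - a ∈ P ∧ c - b ∈ P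

/-- Weak unperforation of `(G, P)`: if `n x > 0` for some `n ≥ 1`, then `x > 0`. -/
def WeaklyUnperforated {G : Type*} [AddCommGroup G] (P : Set G) : Prop :=
  ∀ (x : G) (n : ℕ), 0 < n → n • x ∈ P → n • x ≠ 0 → x ∈ P ∧ x ≠ 0

/-- `(G, P, Γ)` and `(G', P', Γ')` are isomorphic as scaled ordered groups: some group isomorphism
carries the positive cone onto the positive cone and the scale onto the scale. -/
def ScaledOrderedIso {G G' : Type*} [AddCommGroup G] [AddCommGroup G']
    (P Γ : Set G) (P' Γ' : Set G') : Prop :=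
  ∃ α : G ≃+ G', α '' P = P' ∧ α '' Γ = Γ'

end OrderedGroups

section Classes

/-- Simplicity of a (nonzero) C*-algebra: no closed two-sided ideals besides `0` and `A`. -/
def IsSimpleCStar (A : Type*) [CStarAlgebra A] : Prop :=
  Nontrivial A ∧ ∀ I : TwoSidedIdeal A, IsClosed (I : Set A) → I = ⊥ ∨ I = ⊤

/-- Real rank zero (unital case): the invertible self-adjoint elements are dense in the
self-adjoint elements. -/
def RealRankZero (A : Type*) [CStarAlgebra A] : Prop :=
  ∀ a : A, IsSelfAdjoint a → ∀ ε : ℝ, 0 < ε →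
    ∃ b : A, IsSelfAdjoint b ∧ IsUnit b ∧ ‖a - b‖ < ε

/-- Cancellation: the semigroup `V(A)` has the cancellation property. -/
def HasCancellation (A : Type*) [CStarAlgebra A] : Prop :=
  ∀ a b c : V A, a + c = b + c → a = b

/-- The class `F` of simple, unital, separable C*-algebras of real rank zero with cancellation. -/
structure ClassF (A : Type*) [CStarAlgebra A] : Prop where
  simple : IsSimpleCStar A
  separable : TopologicalSpace.SeparableSpace A
  realRankZero : RealRankZero A
  cancellation : HasCancellation A

/-- The class `F₁` of those `A` in `F` with `K₀(A)` noncyclic and weakly unperforated. -/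
structure ClassF1 (A : Type*) [CStarAlgebra A] : Prop extends ClassF A where
  noncyclic : ¬ IsAddCyclic (K0 A)
  weaklyUnperforated : WeaklyUnperforated (K0.cone A)

end Classes

end CStarK

/-! ### Idempotents, projections and their equivalence in a C*-algebra. -/

namespace CStarK

section CStar

variable {D : Type*} [CStarAlgebra D] [PartialOrder D] [StarOrderedRing D]

/-! The unit group sees an idempotent `e` through the symmetry `1 - 2e`. An isomorphism `φ` of unit
groups therefore induces an injection `θ = idemMap φ` on idempotents that respects commutation and
conjugacy. It need not respect orthogonality: twisting `φ` by a character with values `±1` may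
replace `θ e` by `1 - θ e`. The core of the proof is that this sign is the only defect and that it
can be removed consistently.

For orthogonal `e` and `f`, the idempotent of `A` corresponding to `θ e * θ f` commutes with
everything that commutes with `e` and `f`. By simplicity it is a sum of some of `e`, `f`, `1 - e -
f`, and it follows that one of `θ e`, `1 - θ e` is orthogonal to one of `θ f`, `1 - θ f`
(`idemMap_four`). Now test `e` against idempotents `b` orthogonal to it with `b ≠ 0` and `e + b ≠
1`. Exactly one of `θ e`, `1 - θ e` is separated from `θ b`, meaning orthogonal to `θ b` or to its
complement, and which one it is does not depend on `b` (`separated_of_separated`). Choosing that one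
gives `untwist θ`, which is orthogonally additive and maps conjugate idempotents to conjugate ones.
Since `K₀(A)` is not cyclic, every nonzero idempotent splits, so test idempotents are always at hand
when `e ≠ 1`.

By cancellation, idempotents of `A` with the same class are conjugate. Hence `untwist θ` descends to
a partially additive map on the interval `[0, [1]]` of `V(A)`. Real rank zero passes to matrix
algebras and yields Riesz decomposition in `V(A)` (`RealRankZero.riesz`), and this extends the map
to a homomorphism `V(A) → V(B)` (`RieszDecomposition.exists_extension`). The same construction for
`φ.symm` is inverse to it (`ClassF1.untwist_untwist`). The isomorphism fixes `[1]`; since the cone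
is the image of `V` and the scale the image of `[0, [1]]`, it induces the required isomorphism of
`K₀`.

Idempotents are used instead of projections throughout, because `θ` knows nothing of the involution;
the two give the same `V(A)`. -/

theorem isUnit_one_add_star_mul_self (x : D) : IsUnit (1 + star x * x) :=
  CStarAlgebra.isUnit_of_le 1 (le_add_of_nonneg_right (star_mul_self_nonneg x))

theorem star_units_inv {D : Type*} [Ring D] [StarRing D] (u : Dˣ)
    (hu : star (u : D) = u) : star (↑u⁻¹ : D) = ↑u⁻¹ := by
  have h1 : (↑u⁻¹ : D) * u = 1 := u.inv_mul
  have h2 : (u : D) * star (↑u⁻¹ : D) = 1 := by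
    have := congrArg star h1
    rwa [star_mul, hu, star_one] at this
  exact (left_inv_eq_right_inv h1 h2).symm

/-- Every idempotent has the same range as some projection. -/
theorem exists_isStarProjection_of_isIdempotentElem {e : D} (he : IsIdempotentElem e) :
    ∃ p : D, IsStarProjection p ∧ e * p = p ∧ p * e = e := by
  have he : e * e = e := he
  have hs : star e * star e = star e := by rw [← star_mul, he]
  have he' : ∀ x, e * (e * x) = e * x := fun x => by rw [← mul_assoc, he]
  -- This `z` commutes with `e` and `star e` and satisfies `e * z = e * star e * e`; the projection
  -- is `e * star e * z⁻¹`.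
  obtain ⟨z, hz⟩ := isUnit_one_add_star_mul_self (e - star e)
  have hez : e * z = e * (star e * e) := by
    rw [hz]; simp only [star_sub, star_star, mul_add, mul_sub, sub_mul, mul_one, he, hs, he']
    abel
  have hze : z * e = e * (star e * e) := by
    rw [hz]; simp only [star_sub, star_star, add_mul, mul_sub, sub_mul, one_mul, he, hs,
      mul_assoc]
    abel
  have hzz : star (z : D) = z := by
    rw [hz]; simp only [star_add, star_mul, star_one, star_star]
  have hww := star_units_inv z hzz
  have c1 : Commute e (z : D) := hez.trans hze.symm
  have c2 : Commute (star e) (z : D) := by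
    have := c1.star_star
    rwa [hzz] at this
  have d1 : Commute e (↑z⁻¹ : D) := c1.units_inv_right
  have d2 : Commute (star e) (↑z⁻¹ : D) := c2.units_inv_right
  have d : Commute (e * star e) (↑z⁻¹ : D) := d1.mul_left d2
  refine ⟨e * star e * ↑z⁻¹, ⟨?_, ?_⟩, ?_, ?_⟩
  · change e * star e * ↑z⁻¹ * (e * star e * ↑z⁻¹) = _
    calc e * star e * ↑z⁻¹ * (e * star e * ↑z⁻¹)
        = (e * star e) * (↑z⁻¹ * (e * star e)) * ↑z⁻¹ := by simp only [mul_assoc]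
      _ = (e * (star e * e)) * star e * ↑z⁻¹ * ↑z⁻¹ := by
          rw [← d.eq]; simp only [mul_assoc]
      _ = e * (star e * z) * ↑z⁻¹ * ↑z⁻¹ := by
          rw [← hez, c2.eq]; simp only [mul_assoc]
      _ = e * star e * ↑z⁻¹ := by
          rw [← mul_assoc e, Units.mul_inv_cancel_right]
  · change star (e * star e * ↑z⁻¹) = _
    rw [star_mul, hww, star_mul, star_star, ← d.eq]
  · simp only [mul_assoc, he']
  · rw [mul_assoc, ← d1.eq, ← mul_assoc, mul_assoc e, ← hez, Units.mul_inv_cancel_right]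

/-- Algebraically equivalent projections are Murray-von Neumann equivalent. -/
theorem exists_partialIsometry {p q x y : D} (hp : IsStarProjection p)
    (hq : IsStarProjection q) (hxy : x * y = p) (hyx : y * x = q) :
    ∃ v : D, star v * v = p ∧ v * star v = q := by
  have hpp : p * p = p := hp.isIdempotentElem
  have hqq : q * q = q := hq.isIdempotentElem
  have hps : star p = p := hp.isSelfAdjoint
  have hqs : star q = q := hq.isSelfAdjoint
  -- Cut `x` and `y` down to the corners, so that they become mutually inverse between the ranges of
  -- `p` and `q`.
  obtain ⟨X, Y, hXY, hYX, hYp, hqY, hpX, hXq⟩ : ∃ X Y : D, X * Y = p ∧ Y * X = q ∧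
      Y * p = Y ∧ q * Y = Y ∧ p * X = X ∧ X * q = X := by
    refine ⟨p * x * q, q * y * p, ?_, ?_, ?_, ?_, ?_, ?_⟩
    · calc p * x * q * (q * y * p) = p * x * (q * q) * y * p := by simp only [mul_assoc]
        _ = p * (x * y) * (x * y) * p := by rw [hqq, ← hyx]; simp only [mul_assoc]
        _ = p := by rw [hxy, hpp, hpp, hpp]
    · calc q * y * p * (p * x * q) = q * y * (p * p) * x * q := by simp only [mul_assoc]
        _ = q * (y * x) * (y * x) * q := by rw [hpp, ← hxy]; simp only [mul_assoc]
        _ = q := by rw [hyx, hqq, hqq, hqq]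
    · rw [mul_assoc, hpp]
    · simp only [← mul_assoc, hqq]
    · simp only [← mul_assoc, hpp]
    · rw [mul_assoc, hqq]
  have hsYp : p * star Y = star Y := by rw [← hps, ← star_mul, hYp]
  have hsXq : q * star X = star X := by rw [← hqs, ← star_mul, hXq]
  have hsXp : star X * p = star X := by rw [← hps, ← star_mul, hpX]
  have hpos : 0 ≤ star Y * Y + (1 - p) :=
    add_nonneg (star_mul_self_nonneg Y) hp.one_sub.nonneg
  have e1 : star Y * Y * (X * star X) = p := by
    calc star Y * Y * (X * star X) = star Y * ((Y * X) * star X) := by simp only [mul_assoc]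
      _ = p := by rw [hYX, hsXq, ← star_mul, hXY, hps]
  have e2 : X * star X * (star Y * Y) = p := by
    have := congrArg star e1
    simpa [hps] using this
  -- Inside `pDp` the elements `star Y * Y` and `X * star X` are inverse to each other; adding `1 -
  -- p` makes them units of `D`.
  have u1 : (star Y * Y + (1 - p)) * (X * star X + (1 - p)) = 1 := by
    have a1 : star Y * Y * p = star Y * Y := by rw [mul_assoc, hYp]
    have a2 : p * (X * star X) = X * star X := by rw [← mul_assoc, hpX]
    simp only [add_mul, mul_add, mul_sub, sub_mul, mul_one, one_mul, e1, a1, a2, hpp]; abel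
  have u2 : (X * star X + (1 - p)) * (star Y * Y + (1 - p)) = 1 := by
    have a1 : p * (star Y * Y) = star Y * Y := by rw [← mul_assoc, hsYp]
    have a2 : X * star X * p = X * star X := by rw [mul_assoc, hsXp]
    simp only [add_mul, mul_add, mul_sub, sub_mul, mul_one, one_mul, e2, a1, a2, hpp]; abel
  have hunit : IsUnit (star Y * Y + (1 - p)) := ⟨⟨_, _, u1, u2⟩, rfl⟩
  have hsp : IsStrictlyPositive (star Y * Y + (1 - p)) := ⟨hpos, hunit⟩
  -- Polar decomposition: `k` is the square root of `star Y * Y + (1 - p)`, it commutes with `p`,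
  -- and `Y * k⁻¹` is the partial isometry.
  obtain ⟨k, hk⟩ := hsp.isUnit_cfcSqrt
  have hkk : (k : D) * k = star Y * Y + (1 - p) := by
    rw [hk]; exact CFC.sqrt_mul_sqrt_self _ hpos
  have hks : star (k : D) = k := by
    rw [hk]; exact (CFC.sqrt_nonneg _).isSelfAdjoint
  have hws := star_units_inv k hks
  have hcomm : Commute p (star Y * Y + (1 - p)) := by
    change p * _ = _ * p
    rw [mul_add, add_mul, ← mul_assoc, hsYp, mul_assoc, hYp, mul_sub, sub_mul, mul_one, one_mul]
  have hck : Commute p (k : D) := by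
    rw [hk, CFC.sqrt_eq_cfc]
    exact (hcomm.symm.cfc_nnreal _).symm
  have hcw : Commute p (↑k⁻¹ : D) := hck.units_inv_right
  have hkkw : (↑k⁻¹ : D) * (k * k) * ↑k⁻¹ = 1 := by
    rw [← mul_assoc, Units.inv_mul, one_mul, Units.mul_inv]
  have hYY : star Y * Y = p * (k * k) := by
    rw [hkk, mul_add, ← mul_assoc, hsYp, mul_sub, mul_one, hpp, sub_self, add_zero]
  refine ⟨Y * ↑k⁻¹, ?_, ?_⟩
  · calc star (Y * ↑k⁻¹) * (Y * ↑k⁻¹) = ↑k⁻¹ * (star Y * Y) * ↑k⁻¹ := by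
          rw [star_mul, hws]; simp only [mul_assoc]
      _ = p * (↑k⁻¹ * (k * k) * ↑k⁻¹) := by
          rw [hYY, ← mul_assoc _ p, ← hcw.eq]; simp only [mul_assoc]
      _ = p := by rw [hkkw, mul_one]
  · have hv : Y * ↑k⁻¹ * star (Y * ↑k⁻¹) = Y * (↑k⁻¹ * ↑k⁻¹) * star Y := by
      rw [star_mul, hws]; simp only [mul_assoc]
    have h1 : Y * (↑k⁻¹ * ↑k⁻¹) * star Y * q = Y * (↑k⁻¹ * ↑k⁻¹) * star Y := by
      rw [mul_assoc, ← hqs, ← star_mul, hqY]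
    have h2 : Y * (↑k⁻¹ * ↑k⁻¹) * star Y * q = q := by
      calc Y * (↑k⁻¹ * ↑k⁻¹) * star Y * q
          = Y * (↑k⁻¹ * ↑k⁻¹) * (star Y * Y) * X := by rw [← hYX]; simp only [mul_assoc]
        _ = Y * (p * (↑k⁻¹ * (↑k⁻¹ * k) * k)) * X := by
            rw [hYY, mul_assoc Y, ← mul_assoc (_ * _) p, ← (hcw.mul_right hcw).eq]
            simp only [mul_assoc]
        _ = q := by rw [Units.inv_mul, mul_one, Units.inv_mul, mul_one, hYp, hYX]
    rw [hv, ← h1, h2]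

end CStar

end CStarK

/-! ### Real rank zero and corners. -/

namespace CStarK

section Corners

variable {D : Type*} [CStarAlgebra D]

/-- The corner `eDe` has real rank zero. -/
def RealRankZeroCorner (e : D) : Prop :=
  ∀ a : D, IsSelfAdjoint a → e * a = a → ∀ ε : ℝ, 0 < ε →
    ∃ b : D, IsSelfAdjoint b ∧ e * b = b ∧ IsUnit (b + (1 - e)) ∧ ‖a - b‖ < ε

theorem realRankZeroCorner_one : RealRankZeroCorner (1 : D) ↔ RealRankZero D := by
  simp [RealRankZeroCorner, RealRankZero]

theorem RealRankZeroCorner.zero : RealRankZeroCorner (0 : D) := by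
  intro a _ h ε hε
  refine ⟨0, .zero _, by simp, by simp, ?_⟩
  rw [← h]; simpa using hε

theorem mul_right_of_isSelfAdjoint {D : Type*} [Ring D] [StarRing D] {e a : D}
    (he : star e = e) (ha : star a = a) (h : e * a = a) : a * e = a := by
  have := congrArg star h
  rwa [star_mul, he, ha] at this

theorem isUnit_one_add_of_mul_self {D : Type*} [Ring D] {x : D} (h : x * x = 0) :
    IsUnit (1 + x) :=
  ⟨⟨1 + x, 1 - x, by simp [mul_sub, add_mul, h], by simp [mul_add, sub_mul, h]⟩, rfl⟩

/-- Schur complements: write `a` as a two-by-two block matrix, perturb the `e`-block to an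
invertible `b` with corner inverse `k`, then perturb the Schur complement `f a f - f a k a f` to an
invertible `t`. Off-diagonal blocks are left alone. -/
theorem RealRankZeroCorner.add {e f : D} (he : IsStarProjection e) (hf : IsStarProjection f)
    (hef : e * f = 0) (h1 : RealRankZeroCorner e) (h2 : RealRankZeroCorner f) :
    RealRankZeroCorner (e + f) := by
  have hee : e * e = e := he.isIdempotentElem
  have hff : f * f = f := hf.isIdempotentElem
  have hes : star e = e := he.isSelfAdjoint
  have hfs : star f = f := hf.isSelfAdjoint
  have hfe : f * e = 0 := by
    have := congrArg star hef
    rwa [star_mul, hes, hfs, star_zero] at this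
  intro a ha hea ε hε
  have has : star a = a := ha
  have hae : a * (e + f) = a :=
    mul_right_of_isSelfAdjoint (by rw [star_add, hes, hfs]) has hea
  have hes' : ∀ x, e * (e * x) = e * x := fun x => by rw [← mul_assoc, hee]
  have hfs' : ∀ x, f * (f * x) = f * x := fun x => by rw [← mul_assoc, hff]
  have hef' : ∀ x, e * (f * x) = 0 := fun x => by rw [← mul_assoc, hef, zero_mul]
  have hfe' : ∀ x, f * (e * x) = 0 := fun x => by rw [← mul_assoc, hfe, zero_mul]
  obtain ⟨b, hb, heb, ⟨u, hu⟩, hbε⟩ := h1 (e * a * e)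
    (by change star _ = _; simp only [star_mul, hes, has, mul_assoc])
    (by simp only [mul_assoc, hes']) (ε / 2) (by positivity)
  have hbs : star b = b := hb
  have hbe : b * e = b := mul_right_of_isSelfAdjoint hes hbs heb
  have hfb : f * b = 0 := by rw [← heb, hfe']
  have hbf : b * f = 0 := by rw [← hbe, mul_assoc, hef, mul_zero]
  have hus : star (u : D) = u := by rw [hu]; simp [hbs, hes]
  have hue : e * (u : D) = b := by rw [hu, mul_add, heb, mul_sub, mul_one, hee, sub_self, add_zero]
  have hue' : (u : D) * e = b := by
    rw [hu, add_mul, hbe, sub_mul, one_mul, hee, sub_self, add_zero]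
  have hws := star_units_inv u hus
  set k : D := e * ↑u⁻¹ with hk
  have hcomm : Commute e (↑u⁻¹ : D) := Commute.units_inv_right (hue.trans hue'.symm)
  have hke : k = ↑u⁻¹ * e := hcomm.eq
  have hks : star k = k := by rw [hk, star_mul, hws, hes, ← hke]
  have hkb : k * b = e := by rw [hke, mul_assoc, heb, ← hue', Units.inv_mul_cancel_left]
  have hbk : b * k = e := by rw [hk, ← mul_assoc, hbe, ← hue, Units.mul_inv_cancel_right]
  have hek : e * k = k := by rw [hk, hes']
  have hke' : k * e = k := by rw [hke, mul_assoc, hee]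
  obtain ⟨t, ht, hft, hunit, htε⟩ := h2 (f * a * f - f * a * k * a * f)
    (by change star _ = _; simp only [star_sub, star_mul, hks, hfs, has, mul_assoc])
    (by simp only [mul_assoc, mul_sub, hfs']) (ε / 2) (by positivity)
  have hts : star t = t := ht
  have htf : t * f = t := mul_right_of_isSelfAdjoint hfs hts hft
  have het : e * t = 0 := by rw [← hft, hef']
  have hbt : b * t = 0 := by rw [← hft, ← mul_assoc, hbf, zero_mul]
  refine ⟨b + e * a * f + f * a * e + (t + f * a * k * a * f), ?_, ?_, ?_, ?_⟩
  · change star _ = _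
    simp only [star_add, star_mul, hks, hfs, hes, has, hts, hbs, mul_assoc]
    abel
  · simp only [mul_assoc, mul_add, add_mul, heb, hfb, hes', hfs', hef', hfe', hft, het,
      zero_add, add_zero]
  · have hkf : k * f = 0 := by rw [← hke', mul_assoc, hef, mul_zero]
    have hfk : f * k = 0 := by rw [← hek, hfe']
    -- Block LDU factorization: unipotent, block diagonal, unipotent, each of them a unit.
    have e1 : b + e * a * f + f * a * e + (t + f * a * k * a * f) + (1 - (e + f))
        = (1 + f * a * k) * ((b + (1 - e)) * (t + (1 - f))) * (1 + k * a * f) := by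
      have hkb' : ∀ x, k * (b * x) = e * x := fun x => by rw [← mul_assoc, hkb]
      have hbk' : ∀ x, b * (k * x) = e * x := fun x => by rw [← mul_assoc, hbk]
      have hkt : k * t = 0 := by rw [← hke', mul_assoc, het, mul_zero]
      have htk : t * k = 0 := by rw [← htf, mul_assoc, ← hek, hfe', mul_zero]
      have htk' : ∀ x, t * (k * x) = 0 := fun x => by rw [← mul_assoc, htk, zero_mul]
      have hfk' : ∀ x, f * (k * x) = 0 := fun x => by rw [← mul_assoc, hfk, zero_mul]
      have hek' : ∀ x, e * (k * x) = k * x := fun x => by rw [← mul_assoc, hek]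
      have m1 : (b + (1 - e)) * (t + (1 - f)) = b + t + (1 - e - f) := by
        simp only [add_mul, mul_add, mul_sub, sub_mul, mul_one, one_mul, hbt, hbf, het, hef]
        abel
      rw [m1]
      simp only [add_mul, mul_add, mul_sub, sub_mul, mul_one, one_mul, mul_assoc, hkb, hbk',
        hkt, hkf, htk', hfk', hek', hke', mul_zero]
      abel
    rw [e1]
    refine ((isUnit_one_add_of_mul_self ?_).mul ((hu ▸ u.isUnit).mul hunit)).mul
      (isUnit_one_add_of_mul_self ?_)
    · rw [mul_assoc, mul_assoc f a k, ← mul_assoc k f, hkf, zero_mul, mul_zero]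
    · simp only [mul_assoc]; rw [← mul_assoc f k, hfk, zero_mul, mul_zero, mul_zero]
  · have ea : a = e * a * e + e * a * f + f * a * e + f * a * f := by
      conv_lhs => rw [← hea, ← hae]
      simp only [add_mul, mul_add, mul_assoc]; abel
    have e2 : a - (b + e * a * f + f * a * e + (t + f * a * k * a * f))
        = (e * a * e - b) + (f * a * f - f * a * k * a * f - t) := by
      have : ∀ x, a - x = e * a * e + e * a * f + f * a * e + f * a * f - x := fun x => by
        rw [← ea]
      rw [this]
      abel
    rw [e2]
    calc _ ≤ ‖e * a * e - b‖ + ‖f * a * f - f * a * k * a * f - t‖ := norm_add_le _ _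
      _ < ε / 2 + ε / 2 := by gcongr
      _ = ε := by ring

/-- Real rank zero passes to corners. -/
theorem RealRankZeroCorner.of_one {e : D} (he : IsStarProjection e) (h : RealRankZero D) :
    RealRankZeroCorner e := by
  have hee : e * e = e := he.isIdempotentElem
  have hes : star e = e := he.isSelfAdjoint
  have he1 : ‖e‖ ≤ 1 := he.norm_le
  have hf1 : ‖1 - e‖ ≤ 1 := he.one_sub.norm_le
  obtain ⟨f, hf⟩ : ∃ f, f = 1 - e := ⟨_, rfl⟩
  have hff : f * f = f := hf ▸ he.one_sub.isIdempotentElem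
  have hfs : star f = f := hf ▸ he.one_sub.isSelfAdjoint
  have hef : e * f = 0 := by rw [hf, mul_sub, mul_one, hee, sub_self]
  have hfe : f * e = 0 := by rw [hf, sub_mul, one_mul, hee, sub_self]
  have hsum : e + f = 1 := by rw [hf]; abel
  rw [← hf] at hf1
  have hee' : ∀ x, e * (e * x) = e * x := fun x => by rw [← mul_assoc, hee]
  have hff' : ∀ x, f * (f * x) = f * x := fun x => by rw [← mul_assoc, hff]
  have hef' : ∀ x, e * (f * x) = 0 := fun x => by rw [← mul_assoc, hef, zero_mul]
  have hfe' : ∀ x, f * (e * x) = 0 := fun x => by rw [← mul_assoc, hfe, zero_mul]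
  intro a ha hea ε hε
  have has : star a = a := ha
  have hae : a * e = a := mul_right_of_isSelfAdjoint hes has hea
  have hfa : f * a = 0 := by rw [← hea, hfe']
  have haf : a * f = 0 := by rw [← hae, mul_assoc, hef, mul_zero]
  -- The bound `δ ≤ 1/2` gives `‖k‖ ≤ 2` for the inverse of the `f`-block; then the error `δ + δ * 2
  -- * δ` is at most `2 * δ`.
  obtain ⟨δ, hδ0, hδ1, hδ2⟩ : ∃ δ : ℝ, 0 < δ ∧ δ ≤ 1 / 2 ∧ 2 * δ < ε :=
    ⟨min (1 / 2) (ε / 3), by positivity, min_le_left _ _,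
      by linarith [min_le_right (1 / 2) (ε / 3)]⟩
  -- Approximating `a + f` rather than `a` keeps the `f`-block of `b` close to `f`, so it can serve
  -- as the pivot of a Schur complement in the `e`-corner.
  obtain ⟨b, hb, hbu, hbδ⟩ := h (a + f) (ha.add hfs) δ hδ0
  have hbs : star b = b := hb
  have key : ∀ x y : D, ‖x‖ ≤ 1 → ‖y‖ ≤ 1 → ‖x * (b - (a + f)) * y‖ ≤ δ := by
    intro x y hx hy
    rw [norm_sub_rev] at hbδ
    calc _ ≤ ‖x‖ * ‖b - (a + f)‖ * ‖y‖ := norm_mul₃_le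
      _ ≤ 1 * δ * 1 := by gcongr
      _ = δ := by ring
  have n11 : ‖e * b * e - a‖ ≤ δ := by
    convert key e e he1 he1 using 2
    simp only [mul_sub, sub_mul, mul_add, add_mul, hea, hae, mul_assoc, hfe, mul_zero, add_zero]
  have n12 : ‖e * b * f‖ ≤ δ := by
    convert key e f he1 hf1 using 2
    simp only [mul_sub, sub_mul, mul_add, add_mul, haf, mul_assoc, hff, hef, mul_zero, add_zero,
      sub_zero]
  have n21 : ‖f * b * e‖ ≤ δ := by
    convert key f e hf1 he1 using 2
    simp only [mul_sub, sub_mul, mul_add, add_mul, hfa, mul_assoc, hfe, mul_zero, add_zero,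
      zero_mul, sub_zero]
  have n22 : ‖f * b * f - f‖ ≤ δ := by
    convert key f f hf1 hf1 using 2
    simp only [mul_sub, sub_mul, mul_add, add_mul, haf, mul_assoc, hff, mul_zero, zero_add]
  obtain ⟨u, hu⟩ : IsUnit (f * b * f + e) := by
    have : f * b * f + e = 1 - (f - f * b * f) := by rw [← hsum]; abel
    rw [this]
    refine isUnit_one_sub_of_norm_lt_one ?_
    rw [norm_sub_rev]; linarith
  have hus : star (u : D) = u := by
    rw [hu]; simp only [star_add, star_mul, hfs, hbs, hes, mul_assoc]
  have hws := star_units_inv u hus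
  have hfu : f * (u : D) = f * b * f := by
    rw [hu]; simp only [mul_add, mul_assoc, hff', hfe, add_zero]
  have huf : (u : D) * f = f * b * f := by
    rw [hu]; simp only [add_mul, mul_assoc, hff, hef, add_zero]
  have hcomm : Commute f (↑u⁻¹ : D) := Commute.units_inv_right (hfu.trans huf.symm)
  obtain ⟨k, hk⟩ : ∃ k : D, k = f * ↑u⁻¹ := ⟨_, rfl⟩
  have hke : k = ↑u⁻¹ * f := hk.trans hcomm.eq
  have hks : star k = k := by rw [hk, star_mul, hws, hfs, ← hcomm.eq]
  have hfk : f * k = k := by rw [hk, hff']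
  have hkf : k * f = k := by rw [hke, mul_assoc, hff]
  have hkb : k * (f * b * f) = f := by rw [hke, mul_assoc, ← mul_assoc f, ← mul_assoc f, hff,
    ← huf, Units.inv_mul_cancel_left]
  have hbk : (f * b * f) * k = f := by
    rw [hk, ← mul_assoc, mul_assoc _ f f, hff, ← hfu, Units.mul_inv_cancel_right]
  have hek : e * k = 0 := by rw [← hfk, hef']
  have hk2 : ‖k‖ ≤ 2 := by
    have e1 : k = f + (f - f * b * f) * k := by
      rw [sub_mul, hbk, hfk]; abel
    have e2 : ‖k‖ ≤ 1 + δ * ‖k‖ := by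
      calc ‖k‖ = ‖f + (f - f * b * f) * k‖ := by rw [← e1]
        _ ≤ ‖f‖ + ‖f - f * b * f‖ * ‖k‖ := (norm_add_le _ _).trans (by gcongr; exact norm_mul_le _ _)
        _ ≤ 1 + δ * ‖k‖ := by rw [norm_sub_rev f]; gcongr
    nlinarith [norm_nonneg k]
  have hek' : ∀ x, e * (k * x) = 0 := fun x => by rw [← mul_assoc, hek, zero_mul]
  have hke0 : k * e = 0 := by rw [← hkf, mul_assoc, hfe, mul_zero]
  have hkee' : ∀ x, k * (e * x) = 0 := fun x => by rw [← mul_assoc, hke0, zero_mul]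
  have hfk' : ∀ x, f * (k * x) = k * x := fun x => by rw [← mul_assoc, hfk]
  have hkf' : ∀ x, k * (f * x) = k * x := fun x => by rw [← mul_assoc, hkf]
  have hfbk : f * (b * k) = f := by simpa only [mul_assoc, hfk] using hbk
  have hfbk' : ∀ x, f * (b * (k * x)) = f * x := fun x => by
    rw [← mul_assoc b, ← mul_assoc f, hfbk]
  have hkbf : k * (b * f) = f := by simpa only [mul_assoc, hkf'] using hkb
  refine ⟨e * b * e - e * b * k * b * e, ?_, ?_, ?_, ?_⟩
  · change star _ = _
    simp only [star_sub, star_mul, hks, hes, hbs, mul_assoc]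
  · simp only [mul_sub, mul_assoc, hee']
  · rw [← hf]
    obtain ⟨x, hx⟩ : IsUnit (1 + e * b * k) := isUnit_one_add_of_mul_self (by
      simp only [mul_assoc, hkee', mul_zero])
    obtain ⟨y, hy⟩ : IsUnit (1 + k * b * e) := isUnit_one_add_of_mul_self (by
      simp only [mul_assoc, hek', mul_zero])
    -- The block factorization of `b` read backwards: since `b` is invertible, so is the Schur
    -- complement of its `f`-block.
    have e1 : (x : D) * ((e * b * e - e * b * k * b * e + f) * u) * y = b := by
      have hb4 : b = e * (b * e) + e * (b * f) + f * (b * e) + f * (b * f) := by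
        calc b = (e + f) * b * (e + f) := by rw [hsum, one_mul, mul_one]
          _ = _ := by simp only [mul_add, add_mul, mul_assoc]; abel
      conv_rhs => rw [hb4]
      rw [hu, hx, hy]
      simp only [mul_add, add_mul, mul_sub, sub_mul, mul_assoc, mul_one, one_mul, hee, hff, hef,
        hfe, hee', hff', hef', hfe', hfbk', hkbf, hkf', hkee', hfk', hek', mul_zero, zero_mul]
      abel
    have e2 : e * b * e - e * b * k * b * e + f = ↑x⁻¹ * b * ↑y⁻¹ * ↑u⁻¹ := by
      rw [Units.eq_mul_inv_iff_mul_eq, Units.eq_mul_inv_iff_mul_eq, Units.eq_inv_mul_iff_mul_eq,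
        ← mul_assoc, e1]
    rw [e2]
    exact ((x⁻¹.isUnit.mul hbu).mul y⁻¹.isUnit).mul u⁻¹.isUnit
  · have e1 : a - (e * b * e - e * b * k * b * e)
        = -(e * b * e - a) + (e * b * f) * k * (f * b * e) := by
      simp only [mul_assoc, hfk', hkf']; abel
    rw [e1]
    calc _ ≤ ‖-(e * b * e - a)‖ + ‖(e * b * f) * k * (f * b * e)‖ := norm_add_le _ _
      _ ≤ ‖e * b * e - a‖ + ‖e * b * f‖ * ‖k‖ * ‖f * b * e‖ := by
          rw [norm_neg]; gcongr; exact norm_mul₃_le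
      _ ≤ δ + δ * 2 * δ := by gcongr
      _ ≤ 2 * δ := by nlinarith
      _ < ε := hδ2

end Corners

end CStarK

/-! ### Splitting a projection that lies below a sum of two projections. -/

namespace CStarK

section Splitting

variable {D : Type*} [CStarAlgebra D] [PartialOrder D] [StarOrderedRing D]

/-- The spectral projection of an invertible self-adjoint element for the positive reals. -/
theorem exists_positive_spectral_projection {c : D} (hc : IsSelfAdjoint c) (hu : IsUnit c) :
    ∃ q : D, IsStarProjection q ∧ (∀ x, Commute c x → Commute q x) ∧
      0 ≤ c * q ∧ c * (1 - q) ≤ 0 := by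
  obtain ⟨i, hi⟩ : ∃ i : ℝ → ℝ, i = fun x => if 0 < x then 1 else 0 := ⟨_, rfl⟩
  have h0 : ∀ x ∈ spectrum ℝ c, x ≠ 0 := by
    rintro x hx rfl
    exact (spectrum.zero_notMem_iff ℝ).2 hu hx
  -- The indicator of the positive reals jumps only at `0`, which the spectrum of an invertible
  -- element avoids.
  have hcont : ContinuousOn i (spectrum ℝ c) := by
    intro x hx
    apply ContinuousAt.continuousWithinAt
    rcases lt_or_gt_of_ne (h0 x hx) with h | h
    · refine (continuousAt_const (y := (0 : ℝ))).congr ?_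
      filter_upwards [Iio_mem_nhds h] with y hy
      rw [hi]; simp [not_lt.2 (le_of_lt (Set.mem_Iio.1 hy))]
    · refine (continuousAt_const (y := (1 : ℝ))).congr ?_
      filter_upwards [Ioi_mem_nhds h] with y hy
      rw [hi]; simp [Set.mem_Ioi.1 hy]
  have hcq : c * cfc i c = cfc (fun x => x * i x) c := by
    rw [cfc_mul (fun x => x) i c, cfc_id' ℝ c]
  refine ⟨cfc i c, ⟨?_, cfc_predicate i c⟩, fun x hx => hx.cfc_real i, ?_, ?_⟩
  · change cfc i c * cfc i c = _
    rw [← cfc_mul i i c]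
    congr 1
    funext x
    rw [hi]; by_cases h : 0 < x <;> simp [h]
  · rw [hcq]
    refine cfc_nonneg fun x _ => ?_
    rw [hi]; by_cases h : 0 < x <;> simp [h, le_of_lt]
  · rw [mul_sub, mul_one, hcq, sub_nonpos]
    conv_lhs => rw [← cfc_id' ℝ c]
    refine cfc_mono fun x _ => ?_
    rw [hi]; by_cases h : 0 < x
    · simp [h]
    · simpa [h] using not_lt.1 h

/-- If the compression of `f` to `r` is invertible there, `r` factors through `f` as `(u⁻¹ r f)(f
r)`, which makes it equivalent to a subidempotent of `f`. -/
theorem exists_mul_eq_of_isUnit {D : Type*} [Ring D] {r f : D} (hr : r * r = r) (hf : f * f = f)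
    (hu : IsUnit (r * f * r + (1 - r))) : ∃ x y : D, x * y = r ∧ f * y = y ∧ x * f = x := by
  obtain ⟨u, hu⟩ := hu
  have hur : (u : D) * r = r * f * r := by
    rw [hu, add_mul, sub_mul, one_mul, mul_assoc, hr, sub_self, add_zero]
  refine ⟨↑u⁻¹ * r * f, f * r, ?_, ?_, ?_⟩
  · calc ↑u⁻¹ * r * f * (f * r) = ↑u⁻¹ * (r * (f * f) * r) := by simp only [mul_assoc]
      _ = r := by rw [hf, ← hur, Units.inv_mul_cancel_left]
  · rw [← mul_assoc, hf]
  · rw [mul_assoc, hf]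

/-- On the range of `r`, `c` is nonnegative and `a` differs from it by at most `1/4`, so `r f r ≥
r/2 - r/4 = r/4`. -/
theorem isUnit_of_compression {r f a c : D} (hr : IsStarProjection r)
    (hac : ‖a - c‖ ≤ 1 / 4) (ha : IsSelfAdjoint (a - c))
    (hf : r * f * r = (1 / 2 : ℝ) • r + r * a * r) (hc : 0 ≤ r * c * r) :
    IsUnit (r * f * r + (1 - r)) := by
  have hrr : r * r = r := hr.isIdempotentElem
  have hrs : star r = r := hr.isSelfAdjoint
  have h1 : 0 ≤ r * (a - c) * r + (1 / 4 : ℝ) • r := by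
    have h2 : 0 ≤ (a - c) + algebraMap ℝ D (1 / 4) := by
      have h3 := ha.neg_algebraMap_norm_le_self
      have h4 : algebraMap ℝ D ‖a - c‖ ≤ algebraMap ℝ D (1 / 4) := algebraMap_mono D hac
      calc (0 : D) ≤ (a - c) + algebraMap ℝ D ‖a - c‖ := by
            rw [← neg_le_iff_add_nonneg]; exact h3
        _ ≤ _ := by gcongr
    have h5 := hr.isSelfAdjoint.conjugate_nonneg h2
    have h6 : r * (a - c + algebraMap ℝ D (1 / 4)) * r = r * (a - c) * r + (1 / 4 : ℝ) • r := by
      rw [mul_add, add_mul, Algebra.algebraMap_eq_smul_one, mul_smul_comm, mul_one, smul_mul_assoc,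
        hrr]
    rwa [h6] at h5
  have h7 : (1 / 4 : ℝ) • (1 : D) ≤ r * f * r + (1 - r) := by
    have h8 : r * f * r + (1 - r) - (1 / 4 : ℝ) • (1 : D)
        = (r * (a - c) * r + (1 / 4 : ℝ) • r) + r * c * r + (3 / 4 : ℝ) • (1 - r) := by
      rw [hf, mul_sub, sub_mul]; module
    rw [← sub_nonneg, h8]
    exact add_nonneg (add_nonneg h1 hc) (smul_nonneg (by norm_num) hr.one_sub.nonneg)
  refine CStarAlgebra.isUnit_of_le _ h7 ⟨smul_nonneg (by norm_num) zero_le_one, ?_⟩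
  rw [← Algebra.algebraMap_eq_smul_one]
  exact (IsUnit.mk0 (1 / 4 : ℝ) (by norm_num)).map (algebraMap ℝ D)

/-- Riesz decomposition in real rank zero: a projection below `f + g` splits into a piece
equivalent to a subprojection of `f` and one equivalent to a subprojection of `g`. -/
theorem exists_riesz_split (h : RealRankZero D) {p f g : D} (hp : IsStarProjection p)
    (hf : IsStarProjection f) (hg : IsStarProjection g) (hsub : p * (f + g) = p) :
    ∃ r s : D, IsStarProjection r ∧ IsStarProjection s ∧ r * s = 0 ∧ r + s = p ∧
      (∃ x y : D, x * y = r ∧ f * y = y ∧ x * f = x) ∧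
      (∃ x y : D, x * y = s ∧ g * y = y ∧ x * g = x) := by
  have hpp : p * p = p := hp.isIdempotentElem
  have hps : star p = p := hp.isSelfAdjoint
  have hff : f * f = f := hf.isIdempotentElem
  have hgg : g * g = g := hg.isIdempotentElem
  -- Below `p` the compressions of `f` and `g` add up to `p`, so where one is small the other
  -- exceeds one half. The sign of an invertible approximation `c` of `a` decides which part of `p`
  -- goes to `f` and which to `g`.
  obtain ⟨a, ha⟩ : ∃ a, a = p * f * p - (1 / 2 : ℝ) • p := ⟨_, rfl⟩
  have has : IsSelfAdjoint a := by
    rw [ha]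
    exact (IsSelfAdjoint.conjugate_self hf.isSelfAdjoint hps).sub
      (IsSelfAdjoint.smul (IsSelfAdjoint.all _) hps)
  obtain ⟨c, hc, hpc, hcu, hac⟩ := RealRankZeroCorner.of_one hp h a has (by
    rw [ha, mul_sub, mul_smul_comm, ← mul_assoc, ← mul_assoc, hpp]) (1 / 4) (by norm_num)
  have hcp : c * p = c := mul_right_of_isSelfAdjoint hps hc hpc
  obtain ⟨q, hq, hqc, hpos, hneg⟩ := exists_positive_spectral_projection
    (hc.add hp.one_sub.isSelfAdjoint) hcu
  have hqq : q * q = q := hq.isIdempotentElem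
  have hqs : star q = q := hq.isSelfAdjoint
  have hqp : q * p = p * q := hqc p (by
    change _ * p = p * _
    rw [add_mul, mul_add, hpc, hcp, mul_sub, sub_mul, mul_one, one_mul])
  have hqcc : q * (c + (1 - p)) = (c + (1 - p)) * q := hqc _ (Commute.refl _)
  have hqc' : q * c = c * q := by
    rw [add_comm] at hqcc
    simp only [mul_add, add_mul, mul_sub, sub_mul, mul_one, one_mul, hqp] at hqcc
    exact add_left_cancel hqcc
  have hr : IsStarProjection (p * q) := hp.mul hq hqp.symm
  have hs : IsStarProjection (p * (1 - q)) :=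
    hp.mul hq.one_sub (by change p * _ = _ * p; rw [mul_sub, sub_mul, hqp, mul_one, one_mul])
  have hrp : p * q * p = p * q := by rw [mul_assoc, hqp, ← mul_assoc, hpp]
  have hsp : p * (1 - q) * p = p * (1 - q) := by
    rw [mul_sub, mul_one, sub_mul, hpp, hrp]
  have hprp : p * (p * q) = p * q := by rw [← mul_assoc, hpp]
  have hpsp : p * (p * (1 - q)) = p * (1 - q) := by rw [← mul_assoc, hpp]
  have hpgp : p * g * p = p - p * f * p := by
    have := congrArg (· * p) hsub
    simp only [mul_add, add_mul, hpp] at this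
    rw [eq_sub_iff_add_eq, add_comm]; exact this
  have cond : ∀ t : D, t * t = t → t * p = t → p * t = t → ∀ x y,
      p * x * p = (1 / 2 : ℝ) • p + y → t * x * t = (1 / 2 : ℝ) • t + t * y * t := by
    intro t htt h1 h2 x y hxy
    calc t * x * t = (t * p) * x * (p * t) := by rw [h1, h2]
      _ = t * (p * x * p) * t := by simp only [mul_assoc]
      _ = _ := by rw [hxy, mul_add, add_mul, mul_smul_comm, smul_mul_assoc, h1, htt]
  have compr : ∀ t : D, t * t = t → t * p = p * t → t * c = c * t →
      p * t * c * (p * t) = p * ((c + (1 - p)) * t) * p := by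
    intro t htt htp htc
    calc p * t * c * (p * t) = p * t * (c * p) * t := by simp only [mul_assoc]
      _ = p * c * t * t := by rw [hcp, mul_assoc p, htc, ← mul_assoc]
      _ = p * (c * p) * t := by rw [mul_assoc (p * c), htt, hcp]
      _ = p * ((c + (1 - p)) * p) * t := by
          rw [add_mul, sub_mul, one_mul, hpp, sub_self, add_zero]
      _ = _ := by simp only [mul_assoc, htp]
  refine ⟨p * q, p * (1 - q), hr, hs, ?_, ?_, ?_, ?_⟩
  · rw [← mul_assoc, hrp, mul_assoc, mul_sub, mul_one, hqq, sub_self, mul_zero]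
  · rw [← mul_add, add_sub_cancel, mul_one]
  · refine exists_mul_eq_of_isUnit hr.isIdempotentElem hff
      (isUnit_of_compression (a := a) (c := c) hr hac.le (has.sub hc) ?_ ?_)
    · exact cond _ hr.isIdempotentElem hrp hprp f a (by rw [ha]; abel)
    · rw [compr q hqq hqp hqc']
      exact hp.isSelfAdjoint.conjugate_nonneg hpos
  · refine exists_mul_eq_of_isUnit hs.isIdempotentElem hgg
      (isUnit_of_compression (a := -a) (c := -c) hs ?_ ?_ ?_ ?_)
    · rw [← norm_neg, neg_sub_neg, neg_sub]; exact hac.le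
    · exact has.neg.sub hc.neg
    · exact cond _ hs.isIdempotentElem hsp hpsp g (-a) (by rw [hpgp, ha]; module)
    · rw [mul_neg, neg_mul, compr (1 - q) hq.one_sub.isIdempotentElem
        (by rw [sub_mul, mul_sub, hqp, one_mul, mul_one])
        (by rw [sub_mul, mul_sub, hqc', one_mul, mul_one]), ← neg_mul, ← mul_neg]
      exact hp.isSelfAdjoint.conjugate_nonneg (neg_nonneg.2 hneg)

end Splitting

end CStarK

/-! ### Real rank zero passes to matrix algebras. -/

namespace CStarK

section MatrixRealRank

/-- Lift an element of the corner to `A`, average the lift with its adjoint, approximate there and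
push forward; `φ` is contractive. -/
theorem RealRankZero.corner_of_hom {A D : Type*} [CStarAlgebra A] [CStarAlgebra D]
    (h : RealRankZero A) (φ : A →⋆ₙₐ[ℂ] D) (hφ : ∀ x, ∃ a, φ a = φ 1 * x * φ 1) :
    RealRankZeroCorner (φ 1) := by
  have h11 : φ 1 * φ 1 = φ 1 := by rw [← map_mul, one_mul]
  have h1s : star (φ 1) = φ 1 := by rw [← map_star, star_one]
  intro a ha hea ε hε
  have hae := mul_right_of_isSelfAdjoint h1s ha hea
  obtain ⟨a₀, ha₀⟩ := hφ a
  rw [hea, hae] at ha₀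
  have ha₁ : φ ((1 / 2 : ℂ) • (a₀ + star a₀)) = a := by
    rw [map_smul, map_add, map_star, ha₀, ha.star_eq, ← two_smul ℂ a, smul_smul]; norm_num
  obtain ⟨b, hb, ⟨u, rfl⟩, hbε⟩ := h ((1 / 2 : ℂ) • (a₀ + star a₀))
    (by simp [isSelfAdjoint_iff, add_comm]) ε hε
  refine ⟨φ u, hb.map φ, by rw [← map_mul, one_mul], ?_, ?_⟩
  · refine ⟨⟨φ u + (1 - φ 1), φ ↑u⁻¹ + (1 - φ 1), ?_, ?_⟩, rfl⟩ <;>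
    · simp only [mul_add, add_mul, mul_sub, sub_mul, ← map_mul, mul_one, one_mul,
        Units.mul_inv, Units.inv_mul]
      abel
  · rw [← ha₁, ← map_sub]
    exact (NonUnitalStarAlgHom.norm_apply_le φ _).trans_lt hbε

variable {A : Type*} [CStarAlgebra A] [PartialOrder A] [StarOrderedRing A]
  {n : Type*} [Fintype n] [DecidableEq n]

/-- The inclusion of `A` in a matrix algebra at a diagonal entry. -/
noncomputable def diagEntryHom (i : n) : A →⋆ₙₐ[ℂ] CStarMatrix n n A where
  toFun a := CStarMatrix.ofMatrix (Matrix.single i i a)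
  map_smul' c a := by
    change Matrix.single i i (c • a) = c • Matrix.single i i a
    rw [Matrix.smul_single]
  map_zero' := Matrix.single_zero i i
  map_add' a b := Matrix.single_add i i a b
  map_mul' a b := (Matrix.single_mul_single_same _ i i i b).symm
  map_star' a := (Matrix.conjTranspose_single i i a).symm

/-- The diagonal matrix units cut out corners that are images of `A`, and `RealRankZeroCorner.add`
assembles them one at a time into the identity. -/
theorem RealRankZero.cstarMatrix (h : RealRankZero A) : RealRankZero (CStarMatrix n n A) := by
  have hmul : ∀ i j : n, i ≠ j → (diagEntryHom i (1 : A)) * diagEntryHom j 1 = 0 := fun i j hij =>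
    Matrix.single_mul_single_of_ne _ i i j hij 1
  have hproj : ∀ i : n, IsStarProjection (diagEntryHom i (1 : A)) := fun i =>
    (IsStarProjection.one A).map (diagEntryHom i)
  have hcorner : ∀ i : n, RealRankZeroCorner (diagEntryHom i (1 : A)) := fun i => by
    refine h.corner_of_hom _ fun x => ⟨x i i, ?_⟩
    have := Matrix.single_mul_mul_single i i i i (1 : A) (CStarMatrix.ofMatrix.symm x) 1
    rw [one_mul, mul_one] at this
    exact this.symm
  have hsum : ∀ s : Finset n, IsStarProjection (∑ i ∈ s, diagEntryHom i (1 : A)) ∧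
      RealRankZeroCorner (∑ i ∈ s, diagEntryHom i (1 : A)) := by
    intro s
    induction s using Finset.induction_on with
    | empty => exact ⟨by simp, by simpa using RealRankZeroCorner.zero⟩
    | insert j s hj ih =>
      have h0 : diagEntryHom j (1 : A) * ∑ i ∈ s, diagEntryHom i (1 : A) = 0 := by
        rw [Finset.mul_sum]
        exact Finset.sum_eq_zero fun i hi => hmul j i (by rintro rfl; exact hj hi)
      rw [Finset.sum_insert hj]
      exact ⟨(hproj j).add ih.1 h0, RealRankZeroCorner.add (hproj j) ih.1 h0 (hcorner j) ih.2⟩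
  have h1 : ∑ i, diagEntryHom i (1 : A) = (1 : CStarMatrix n n A) := by
    exact Matrix.sum_single_one
  rw [← realRankZeroCorner_one, ← h1]
  exact (hsum Finset.univ).2

end MatrixRealRank

end CStarK

/-! ### Algebraic equivalence of idempotent matrices. -/

namespace CStarK

open Matrix

section AlgebraicEquivalence

variable {A : Type*} [Ring A]
variable {l m n : Type*} [Fintype l] [Fintype m] [Fintype n]

/-- Algebraic equivalence of idempotent matrices. -/
def AlgEq (e : Matrix m m A) (f : Matrix n n A) : Prop :=
  ∃ (x : Matrix m n A) (y : Matrix n m A), x * y = e ∧ y * x = f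

theorem AlgEq.symm {e : Matrix m m A} {f : Matrix n n A} (h : AlgEq e f) : AlgEq f e := by
  obtain ⟨x, y, h1, h2⟩ := h
  exact ⟨y, x, h2, h1⟩

theorem AlgEq.refl {e : Matrix m m A} (he : IsIdempotentElem e) : AlgEq e e := ⟨e, e, he, he⟩

theorem AlgEq.trans {e : Matrix l l A} {f : Matrix m m A} {g : Matrix n n A}
    (he : IsIdempotentElem e) (hg : IsIdempotentElem g) (h : AlgEq e f) (h' : AlgEq f g) :
    AlgEq e g := by
  obtain ⟨x, y, h1, h2⟩ := h
  obtain ⟨z, w, h3, h4⟩ := h'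
  refine ⟨x * z, w * y, ?_, ?_⟩
  · calc x * z * (w * y) = x * (z * w) * y := by simp only [Matrix.mul_assoc]
      _ = (x * y) * (x * y) := by rw [h3, ← h2]; simp only [Matrix.mul_assoc]
      _ = e := by rw [h1, he.eq]
  · calc w * y * (x * z) = w * (y * x) * z := by simp only [Matrix.mul_assoc]
      _ = (w * z) * (w * z) := by rw [h2, ← h3]; simp only [Matrix.mul_assoc]
      _ = g := by rw [h4, hg.eq]

/-- Compressed in this way, equivalences between orthogonal idempotents compose without cross terms.
-/
theorem AlgEq.exists_normalized {e : Matrix m m A} {f : Matrix n n A} (he : IsIdempotentElem e)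
    (hf : IsIdempotentElem f) (h : AlgEq e f) :
    ∃ (x : Matrix m n A) (y : Matrix n m A), x * y = e ∧ y * x = f ∧
      e * x = x ∧ x * f = x ∧ y * e = y ∧ f * y = y := by
  obtain ⟨x, y, h1, h2⟩ := h
  have he : e * e = e := he
  have hf : f * f = f := hf
  have hx : e * x = x * f := by rw [← h1, ← h2, Matrix.mul_assoc]
  have hy : y * e = f * y := by rw [← h1, ← h2, Matrix.mul_assoc]
  refine ⟨e * x, y * e, ?_, ?_, ?_, ?_, ?_, ?_⟩
  · rw [Matrix.mul_assoc, ← Matrix.mul_assoc x, h1, he, he]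
  · rw [hx, hy, Matrix.mul_assoc, ← Matrix.mul_assoc y, h2, hf, hf]
  · rw [← Matrix.mul_assoc, he]
  · rw [hx, Matrix.mul_assoc, hf]
  · rw [Matrix.mul_assoc, he]
  · rw [hy, ← Matrix.mul_assoc, hf]

theorem AlgEq.eq_zero {e : Matrix m m A} (he : IsIdempotentElem e)
    (h : AlgEq e (0 : Matrix n n A)) : e = 0 := by
  obtain ⟨x, y, h1, h2⟩ := h
  rw [← he.eq, ← h1, Matrix.mul_assoc, ← Matrix.mul_assoc y, h2, Matrix.zero_mul, Matrix.mul_zero]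

theorem isIdempotentElem_fromBlocks {e : Matrix m m A} {f : Matrix n n A}
    (he : IsIdempotentElem e) (hf : IsIdempotentElem f) :
    IsIdempotentElem (fromBlocks e 0 0 f) := by
  change fromBlocks e 0 0 f * fromBlocks e 0 0 f = _
  have he : e * e = e := he
  have hf : f * f = f := hf
  simp [fromBlocks_multiply, he, hf]

theorem AlgEq.fromBlocks_congr {m' n' : Type*} [Fintype m'] [Fintype n'] {e : Matrix m m A}
    {f : Matrix n n A} {e' : Matrix m' m' A} {f' : Matrix n' n' A}
    (h : AlgEq e e') (h' : AlgEq f f') :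
    AlgEq (fromBlocks e 0 0 f) (fromBlocks e' 0 0 f') := by
  obtain ⟨x, y, h1, h2⟩ := h
  obtain ⟨z, w, h3, h4⟩ := h'
  exact ⟨fromBlocks x 0 0 z, fromBlocks y 0 0 w, by simp [fromBlocks_multiply, h1, h3],
    by simp [fromBlocks_multiply, h2, h4]⟩

theorem AlgEq.add_orthogonal {e f : Matrix m m A} (he : IsIdempotentElem e)
    (hf : IsIdempotentElem f) (hef : e * f = 0) (hfe : f * e = 0) :
    AlgEq (e + f) (fromBlocks e 0 0 f) := by
  have he : e * e = e := he
  have hf : f * f = f := hf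
  exact ⟨fromCols e f, fromRows e f, by rw [fromCols_mul_fromRows, he, hf],
    by rw [fromRows_mul_fromCols, he, hf, hef, hfe]⟩

theorem AlgEq.fromBlocks_zero (e : Matrix m m A) (he : IsIdempotentElem e) :
    AlgEq (fromBlocks e 0 0 (0 : Matrix n n A)) e := by
  have he : e * e = e := he
  exact ⟨fromRows e 0, fromCols e 0, by rw [fromRows_mul_fromCols]; simp [he],
    by rw [fromCols_mul_fromRows]; simp [he]⟩

theorem AlgEq.zero_fromBlocks (e : Matrix m m A) (he : IsIdempotentElem e) :
    AlgEq (fromBlocks (0 : Matrix n n A) 0 0 e) e := by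
  have he : e * e = e := he
  exact ⟨fromRows 0 e, fromCols 0 e, by rw [fromRows_mul_fromCols]; simp [he],
    by rw [fromCols_mul_fromRows]; simp [he]⟩

end AlgebraicEquivalence

/-! ### Classes of idempotent matrices in `V(A)`. -/

section Classes

variable {A : Type*} [CStarAlgebra A]
variable {l m n : Type*} [Fintype l] [Fintype m] [Fintype n]

theorem MvN.algEq {p : Matrix m m A} {q : Matrix n n A} (h : MvN p q) : AlgEq p q := by
  obtain ⟨v, h1, h2⟩ := h
  exact ⟨vᴴ, v, h1, h2⟩

/-- Padding with zeros to `diag(p, 0)` and `diag(0, q)` puts both projections in one square matrix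
C*-algebra, where `exists_partialIsometry` applies. -/
theorem AlgEq.mvN {p : Matrix m m A} {q : Matrix n n A} (hp : IsStarProjection p)
    (hq : IsStarProjection q) (h : AlgEq p q) : MvN p q := by
  classical
  let _ := CStarAlgebra.spectralOrder A
  have := CStarAlgebra.spectralOrderedRing A
  have hp' := isStarProjection_fromBlocks hp (IsStarProjection.zero (Matrix n n A))
  have hq' := isStarProjection_fromBlocks (IsStarProjection.zero (Matrix m m A)) hq
  have h0 : MvN p (fromBlocks p 0 0 (0 : Matrix n n A)) := by
    have h1 : pᴴ = p := hp.isSelfAdjoint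
    have h2 : p * p = p := hp.isIdempotentElem
    refine ⟨fromRows p 0, ?_, ?_⟩
    · rw [conjTranspose_fromRows_eq_fromCols_conjTranspose, fromCols_mul_fromRows]
      simp [h1, h2]
    · rw [conjTranspose_fromRows_eq_fromCols_conjTranspose, fromRows_mul_fromCols]
      simp [h1, h2]
  have h1 : MvN q (fromBlocks (0 : Matrix m m A) 0 0 q) := by
    have h1 : qᴴ = q := hq.isSelfAdjoint
    have h2 : q * q = q := hq.isIdempotentElem
    refine ⟨fromRows 0 q, ?_, ?_⟩
    · rw [conjTranspose_fromRows_eq_fromCols_conjTranspose, fromCols_mul_fromRows]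
      simp [h1, h2]
    · rw [conjTranspose_fromRows_eq_fromCols_conjTranspose, fromRows_mul_fromCols]
      simp [h1, h2]
  have h2 : AlgEq (fromBlocks p 0 0 (0 : Matrix n n A)) (fromBlocks (0 : Matrix m m A) 0 0 q) :=
    AlgEq.trans hp'.isIdempotentElem hq'.isIdempotentElem
      (AlgEq.fromBlocks_zero p hp.isIdempotentElem)
      (AlgEq.trans hp.isIdempotentElem hq'.isIdempotentElem h
        (AlgEq.zero_fromBlocks q hq.isIdempotentElem).symm)
  obtain ⟨x, y, hxy, hyx⟩ := h2
  have h3 : MvN (fromBlocks p 0 0 (0 : Matrix n n A)) (fromBlocks (0 : Matrix m m A) 0 0 q) := by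
    obtain ⟨v, hv1, hv2⟩ := exists_partialIsometry (D := CStarMatrix (m ⊕ n) (m ⊕ n) A)
      hp' hq' hxy hyx
    exact ⟨v, hv1, hv2⟩
  exact h0.trans hp hq (h3.trans hp' hq h1.symm)

theorem exists_matProj {e : Matrix m m A} (he : IsIdempotentElem e) :
    ∃ P : MatProj A, AlgEq e P.mat := by
  classical
  let _ := CStarAlgebra.spectralOrder A
  have := CStarAlgebra.spectralOrderedRing A
  obtain ⟨p, hp, h1, h2⟩ := exists_isStarProjection_of_isIdempotentElem
    (D := CStarMatrix m m A) (e := e) he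
  have hp : IsStarProjection (R := Matrix m m A) p := hp
  refine ⟨⟨Fintype.card m, _, isStarProjection_submatrix hp (Fintype.equivFin m).symm⟩, ?_⟩
  refine AlgEq.trans (f := (p : Matrix m m A)) he
    (isStarProjection_submatrix hp _).isIdempotentElem ⟨p, e, ?_, ?_⟩
    (MvN.reindex hp (Fintype.equivFin m).symm).algEq
  · exact h2
  · exact h1

open Classical in
/-- The class in `V(A)` of an idempotent matrix. -/
noncomputable def V.cl (e : Matrix m m A) : V A :=
  if h : ∃ P : MatProj A, AlgEq e P.mat then V.mk h.choose else 0

theorem V.cl_eq_mk {e : Matrix m m A} {P : MatProj A}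
    (h : AlgEq e P.mat) : V.cl e = V.mk P := by
  have h' : ∃ P : MatProj A, AlgEq e P.mat := ⟨P, h⟩
  rw [V.cl, dif_pos h', V.mk_eq_mk]
  exact AlgEq.mvN h'.choose.isProj P.isProj
    (AlgEq.trans h'.choose.isProj.isIdempotentElem P.isProj.isIdempotentElem
      h'.choose_spec.symm h)

theorem V.cl_mat (P : MatProj A) : V.cl P.mat = V.mk P :=
  V.cl_eq_mk (AlgEq.refl P.isProj.isIdempotentElem)

theorem V.exists_eq_cl (x : V A) : ∃ P : MatProj A, x = V.cl P.mat := by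
  induction x using Quotient.inductionOn with
  | h P => exact ⟨P, (V.cl_mat P).symm⟩

theorem V.cl_eq_cl {e : Matrix m m A} {f : Matrix n n A} (he : IsIdempotentElem e)
    (hf : IsIdempotentElem f) : V.cl e = V.cl f ↔ AlgEq e f := by
  obtain ⟨P, hP⟩ := exists_matProj he
  obtain ⟨Q, hQ⟩ := exists_matProj hf
  rw [V.cl_eq_mk hP, V.cl_eq_mk hQ, V.mk_eq_mk]
  constructor
  · intro h
    exact hP.trans he hf (h.algEq.trans P.isProj.isIdempotentElem hf hQ.symm)
  · intro h
    exact AlgEq.mvN P.isProj Q.isProj (hP.symm.trans P.isProj.isIdempotentElem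
      Q.isProj.isIdempotentElem (h.trans he Q.isProj.isIdempotentElem hQ))

theorem V.cl_fromBlocks {e : Matrix m m A} {f : Matrix n n A} (he : IsIdempotentElem e)
    (hf : IsIdempotentElem f) : V.cl (fromBlocks e 0 0 f) = V.cl e + V.cl f := by
  obtain ⟨P, hP⟩ := exists_matProj he
  obtain ⟨Q, hQ⟩ := exists_matProj hf
  rw [V.cl_eq_mk hP, V.cl_eq_mk hQ, V.mk_add_mk]
  refine V.cl_eq_mk ?_
  exact (hP.fromBlocks_congr hQ).trans (isIdempotentElem_fromBlocks he hf)
    (P.sum Q).isProj.isIdempotentElem (P.sum_mvN Q).algEq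

theorem V.cl_add {e f : Matrix m m A} (he : IsIdempotentElem e) (hf : IsIdempotentElem f)
    (hef : e * f = 0) (hfe : f * e = 0) : V.cl (e + f) = V.cl e + V.cl f := by
  have h : IsIdempotentElem (e + f) := by
    change (e + f) * (e + f) = _
    rw [mul_add, add_mul, add_mul, he.eq, hf.eq, hef, hfe]; abel
  rw [← V.cl_fromBlocks he hf, V.cl_eq_cl h (isIdempotentElem_fromBlocks he hf)]
  exact AlgEq.add_orthogonal he hf hef hfe

theorem V.cl_eq_zero {e : Matrix m m A} (he : IsIdempotentElem e) : V.cl e = 0 ↔ e = 0 := by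
  have h0 : (0 : V A) = V.cl (MatProj.zero (A := A)).mat := (V.cl_mat _).symm
  have hz := (MatProj.zero (A := A)).isProj.isIdempotentElem
  rw [h0, V.cl_eq_cl he hz]
  constructor
  · intro h; exact AlgEq.eq_zero he h
  · rintro rfl; exact ⟨0, 0, Matrix.zero_mul 0, Matrix.zero_mul 0⟩

theorem V.eq_zero_of_add_eq_zero {x y : V A} (h : x + y = 0) : x = 0 := by
  obtain ⟨P, rfl⟩ := x.exists_eq_cl
  obtain ⟨Q, rfl⟩ := y.exists_eq_cl
  have hP := P.isProj.isIdempotentElem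
  have hQ := Q.isProj.isIdempotentElem
  rw [← V.cl_fromBlocks hP hQ, V.cl_eq_zero (isIdempotentElem_fromBlocks hP hQ)] at h
  rw [V.cl_eq_zero hP]
  have := congrArg toBlocks₁₁ h
  rw [toBlocks_fromBlocks₁₁] at this
  rw [this]; rfl

/-- The element `y * e * x` is a subidempotent of `f` equivalent to `e`, and the difference `w` is
the class of its complement in `f`. -/
theorem V.cl_le {e : Matrix m m A} {f : Matrix n n A} (he : IsIdempotentElem e)
    (hf : IsIdempotentElem f) {x : Matrix m n A} {y : Matrix n m A} (hxy : x * y = e)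
    (hx : x * f = x) (hy : f * y = y) : ∃ w : V A, V.cl f = V.cl e + w := by
  have he' : e * e = e := he
  have hf' : f * f = f := hf
  obtain ⟨g, hg⟩ : ∃ g : Matrix n n A, g = y * e * x := ⟨_, rfl⟩
  have hgg : g * g = g := by
    calc g * g = y * e * (x * y) * e * x := by rw [hg]; simp only [Matrix.mul_assoc]
      _ = y * (e * e * e) * x := by rw [hxy]; simp only [Matrix.mul_assoc]
      _ = g := by rw [he', he', hg]
  have hfg : f * g = g := by rw [hg]; simp only [← Matrix.mul_assoc, hy]
  have hgf : g * f = g := by rw [hg, Matrix.mul_assoc, hx]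
  have hfg' : IsIdempotentElem (f - g) := by
    change (f - g) * (f - g) = _
    rw [mul_sub, sub_mul, sub_mul, hf', hfg, hgf, hgg]; abel
  have hal : AlgEq e g := by
    refine ⟨e * x, y * e, ?_, ?_⟩
    · rw [Matrix.mul_assoc, ← Matrix.mul_assoc x, hxy, he', he']
    · rw [Matrix.mul_assoc, ← Matrix.mul_assoc e, he', hg, Matrix.mul_assoc]
  refine ⟨V.cl (f - g), ?_⟩
  rw [(V.cl_eq_cl he hgg).2 hal, ← V.cl_add hgg hfg' (by rw [mul_sub, hgf, hgg, sub_self])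
    (by rw [sub_mul, hfg, hgg, sub_self]), add_sub_cancel]

/-- Carry `diag(P, 0)` and `diag(0, Q)` back along an equivalence between `e` and `diag(P, Q)`. -/
theorem V.cl_split {e : Matrix m m A} (he : IsIdempotentElem e) {x y : V A}
    (h : V.cl e = x + y) : ∃ e₁ e₂ : Matrix m m A, IsIdempotentElem e₁ ∧ IsIdempotentElem e₂ ∧
      e₁ * e₂ = 0 ∧ e₂ * e₁ = 0 ∧ e₁ + e₂ = e ∧ V.cl e₁ = x ∧ V.cl e₂ = y := by
  obtain ⟨P, rfl⟩ := x.exists_eq_cl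
  obtain ⟨Q, rfl⟩ := y.exists_eq_cl
  have hP : P.mat * P.mat = P.mat := P.isProj.isIdempotentElem
  have hQ : Q.mat * Q.mat = Q.mat := Q.isProj.isIdempotentElem
  have hPQ := isIdempotentElem_fromBlocks (A := A) hP hQ
  rw [← V.cl_fromBlocks hP hQ, V.cl_eq_cl he hPQ] at h
  obtain ⟨a, b, hab, hba, -, had, -, hdb⟩ := h.exists_normalized he hPQ
  obtain ⟨p, hp⟩ : ∃ p, p = fromBlocks P.mat 0 0 (0 : Matrix (Fin Q.size) (Fin Q.size) A) :=
    ⟨_, rfl⟩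
  obtain ⟨q, hq⟩ : ∃ q, q = fromBlocks (0 : Matrix (Fin P.size) (Fin P.size) A) 0 0 Q.mat :=
    ⟨_, rfl⟩
  have hsum : p + q = fromBlocks P.mat 0 0 Q.mat := by rw [hp, hq, fromBlocks_add]; simp
  have hpp : p * p = p := by rw [hp, fromBlocks_multiply]; simp [hP]
  have hqq : q * q = q := by rw [hq, fromBlocks_multiply]; simp [hQ]
  have hpq : p * q = 0 := by rw [hp, hq, fromBlocks_multiply]; simp
  have hqp : q * p = 0 := by rw [hp, hq, fromBlocks_multiply]; simp
  rw [← hsum] at hba had hdb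
  have hmul : ∀ s t : Matrix (Fin P.size ⊕ Fin Q.size) (Fin P.size ⊕ Fin Q.size) A,
      (p + q) * t = t → a * s * b * (a * t * b) = a * (s * t) * b := by
    intro s t hst
    calc a * s * b * (a * t * b) = a * s * ((b * a) * t) * b := by simp only [Matrix.mul_assoc]
      _ = a * (s * t) * b := by rw [hba, hst]; simp only [Matrix.mul_assoc]
  have hp' : (p + q) * p = p := by rw [add_mul, hpp, hqp, add_zero]
  have hq' : (p + q) * q = q := by rw [add_mul, hqq, hpq, zero_add]
  have hcl : ∀ s, s * s = s → (p + q) * s = s → s * (p + q) = s → AlgEq (a * s * b) s := by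
    intro s hs h1 h2
    refine ⟨a * s, s * b, ?_, ?_⟩
    · rw [Matrix.mul_assoc, ← Matrix.mul_assoc s, hs, Matrix.mul_assoc]
    · rw [Matrix.mul_assoc, ← Matrix.mul_assoc b, hba, h1, hs]
  have i1 : IsIdempotentElem (a * p * b) := by
    change _ * _ = _
    rw [hmul p p hp', hpp]
  have i2 : IsIdempotentElem (a * q * b) := by
    change _ * _ = _
    rw [hmul q q hq', hqq]
  refine ⟨a * p * b, a * q * b, i1, i2, ?_, ?_, ?_, ?_, ?_⟩
  · rw [hmul p q hq', hpq, Matrix.mul_zero, Matrix.zero_mul]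
  · rw [hmul q p hp', hqp, Matrix.mul_zero, Matrix.zero_mul]
  · rw [← Matrix.add_mul, ← Matrix.mul_add, had, hab]
  · refine (V.cl_eq_cl i1 hP).2 ((hcl p hpp hp' (by rw [mul_add, hpp, hpq, add_zero])).trans i1 hP ?_)
    rw [hp]; exact AlgEq.fromBlocks_zero _ hP
  · refine (V.cl_eq_cl i2 hQ).2 ((hcl q hqq hq' (by rw [mul_add, hqq, hqp, zero_add])).trans i2 hQ ?_)
    rw [hq]; exact AlgEq.zero_fromBlocks _ hQ

end Classes

end CStarK

/-! ### Idempotents of `A` itself and their classes. -/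

namespace CStarK

open Matrix

section OneByOne

/-- An element of `A` as a one-by-one matrix. -/
def oneByOne {A : Type*} (a : A) : Matrix (Fin 1) (Fin 1) A := of fun _ _ => a

theorem oneByOne_apply {A : Type*} (M : Matrix (Fin 1) (Fin 1) A) : oneByOne (M 0 0) = M := by
  ext i j; rw [Subsingleton.elim i 0, Subsingleton.elim j 0]; rfl

theorem oneByOne_injective {A : Type*} : Function.Injective (oneByOne (A := A)) := fun a b h => by
  have := congrFun (congrFun h 0) 0
  exact this

variable {A : Type*} [Ring A]

theorem oneByOne_mul (a b : A) : oneByOne a * oneByOne b = oneByOne (a * b) := by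
  ext i j; simp [oneByOne, Matrix.mul_apply]

theorem oneByOne_add (a b : A) : oneByOne a + oneByOne b = oneByOne (a + b) := by
  ext i j; simp [oneByOne]

theorem oneByOne_zero : oneByOne (0 : A) = 0 := rfl

theorem isIdempotentElem_oneByOne {e : A} :
    IsIdempotentElem (oneByOne e) ↔ IsIdempotentElem e := by
  change oneByOne e * oneByOne e = _ ↔ e * e = e
  rw [oneByOne_mul, oneByOne_injective.eq_iff]

end OneByOne

section Elements

variable {A : Type*} [CStarAlgebra A]

/-- The class in `V(A)` of an idempotent of `A`. -/
noncomputable def V.cls (e : A) : V A := V.cl (oneByOne e)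

theorem V.cls_eq_cls {e f : A} (he : IsIdempotentElem e) (hf : IsIdempotentElem f) :
    V.cls e = V.cls f ↔ ∃ x y : A, x * y = e ∧ y * x = f ∧
      e * x = x ∧ x * f = x ∧ y * e = y ∧ f * y = y := by
  have he' := isIdempotentElem_oneByOne.2 he
  have hf' := isIdempotentElem_oneByOne.2 hf
  rw [V.cls, V.cls, V.cl_eq_cl he' hf']
  constructor
  · intro h
    obtain ⟨x, y, h⟩ := h.exists_normalized he' hf'
    rw [← oneByOne_apply x, ← oneByOne_apply y] at h
    simp only [oneByOne_mul, oneByOne_injective.eq_iff] at h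
    exact ⟨_, _, h⟩
  · rintro ⟨x, y, h1, h2, -⟩
    exact ⟨oneByOne x, oneByOne y, by rw [oneByOne_mul, h1], by rw [oneByOne_mul, h2]⟩

theorem V.cls_add {e f : A} (he : IsIdempotentElem e) (hf : IsIdempotentElem f)
    (hef : e * f = 0) (hfe : f * e = 0) : V.cls (e + f) = V.cls e + V.cls f := by
  rw [V.cls, ← oneByOne_add, V.cl_add (isIdempotentElem_oneByOne.2 he)
    (isIdempotentElem_oneByOne.2 hf) (by rw [oneByOne_mul, hef, oneByOne_zero])
    (by rw [oneByOne_mul, hfe, oneByOne_zero])]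
  rfl

theorem V.cls_eq_zero {e : A} (he : IsIdempotentElem e) : V.cls e = 0 ↔ e = 0 := by
  rw [V.cls, V.cl_eq_zero (isIdempotentElem_oneByOne.2 he), ← oneByOne_zero,
    oneByOne_injective.eq_iff]

theorem V.cls_zero : V.cls (0 : A) = 0 := (V.cls_eq_zero .zero).2 rfl

theorem V.cls_add_cls_one_sub {e : A} (he : IsIdempotentElem e) :
    V.cls e + V.cls (1 - e) = V.cls (1 : A) := by
  rw [← V.cls_add he he.one_sub he.mul_one_sub_self he.one_sub_mul_self, add_sub_cancel]

theorem V.cls_split {e : A} (he : IsIdempotentElem e) {x y : V A} (h : V.cls e = x + y) :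
    ∃ e₁ e₂ : A, IsIdempotentElem e₁ ∧ IsIdempotentElem e₂ ∧ e₁ * e₂ = 0 ∧ e₂ * e₁ = 0 ∧
      e₁ + e₂ = e ∧ V.cls e₁ = x ∧ V.cls e₂ = y := by
  obtain ⟨a, b, ha, hb, h1, h2, h3, h4, h5⟩ := V.cl_split (isIdempotentElem_oneByOne.2 he) h
  rw [← oneByOne_apply a] at ha h1 h2 h3 h4
  rw [← oneByOne_apply b] at hb h1 h2 h3 h5
  rw [← oneByOne_zero] at h1 h2
  simp only [oneByOne_mul, oneByOne_add, oneByOne_injective.eq_iff,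
    isIdempotentElem_oneByOne] at ha hb h1 h2 h3
  exact ⟨_, _, ha, hb, h1, h2, h3, h4, h5⟩

theorem V.mk_ofProj {p : A} (hp : IsStarProjection p) : V.mk (MatProj.ofProj p hp) = V.cls p :=
  (V.cl_mat _).symm

theorem V.exists_ofProj {e : A} (he : IsIdempotentElem e) :
    ∃ (p : A) (hp : IsStarProjection p), V.mk (MatProj.ofProj p hp) = V.cls e := by
  let _ := CStarAlgebra.spectralOrder A
  have := CStarAlgebra.spectralOrderedRing A
  obtain ⟨p, hp, h1, h2⟩ := exists_isStarProjection_of_isIdempotentElem he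
  have hpp : p * p = p := hp.isIdempotentElem
  refine ⟨p, hp, ?_⟩
  rw [V.mk_ofProj, V.cls_eq_cls hp.isIdempotentElem he]
  exact ⟨e, p, h1, h2, h2, he, hpp, h1⟩

/-- With cancellation, a pair of orthogonal idempotents is determined up to simultaneous
conjugation by the classes. -/
theorem HasCancellation.exists_unit (hc : HasCancellation A) {e f e' f' : A}
    (he : IsIdempotentElem e) (hf : IsIdempotentElem f) (hef : e * f = 0) (hfe : f * e = 0)
    (he' : IsIdempotentElem e') (hf' : IsIdempotentElem f') (hef' : e' * f' = 0)
    (hfe' : f' * e' = 0) (h1 : V.cls e = V.cls e') (h2 : V.cls f = V.cls f') :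
    ∃ u : Aˣ, u * e = e' * u ∧ u * f = f' * u := by
  have key : ∀ {e f : A}, IsIdempotentElem e → IsIdempotentElem f → e * f = 0 → f * e = 0 →
      IsIdempotentElem (1 - (e + f)) ∧ e * (1 - (e + f)) = 0 ∧ f * (1 - (e + f)) = 0 ∧
      (1 - (e + f)) * e = 0 ∧ (1 - (e + f)) * f = 0 ∧
      V.cls (1 - (e + f)) + (V.cls e + V.cls f) = V.cls 1 := by
    intro e f he hf hef hfe
    have hs : IsIdempotentElem (e + f) := by
      change (e + f) * (e + f) = _
      rw [mul_add, add_mul, add_mul, he.eq, hf.eq, hef, hfe]; abel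
    refine ⟨hs.one_sub, ?_, ?_, ?_, ?_, ?_⟩
    · rw [mul_sub, mul_add, he.eq, hef]; simp
    · rw [mul_sub, mul_add, hf.eq, hfe]; simp
    · rw [sub_mul, add_mul, he.eq, hfe]; simp
    · rw [sub_mul, add_mul, hf.eq, hef]; simp
    · rw [← V.cls_add he hf hef hfe, add_comm, V.cls_add_cls_one_sub hs]
  obtain ⟨hg, eg, fg, ge, gf, hsum⟩ := key he hf hef hfe
  obtain ⟨hg', eg', fg', ge', gf', hsum'⟩ := key he' hf' hef' hfe'
  -- Cancelling against `[1]` makes the complements equivalent too.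
  have h3 : V.cls (1 - (e + f)) = V.cls (1 - (e' + f')) :=
    hc _ _ (V.cls e + V.cls f) (by rw [hsum, h1, h2, hsum'])
  obtain ⟨g, rfl⟩ : ∃ g, g = 1 - (e + f) := ⟨_, rfl⟩
  have hone : e + f + (1 - (e + f)) = 1 := by abel
  have hone' : e' + f' + (1 - (e' + f')) = 1 := by abel
  generalize 1 - (e + f) = g at *
  generalize 1 - (e' + f') = g' at *
  obtain ⟨x, y, xy, yx, ex, xe, ye, ey⟩ := (V.cls_eq_cls he he').1 h1
  obtain ⟨z, w, zw, wz, fz, zf, wf, fw⟩ := (V.cls_eq_cls hf hf').1 h2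
  obtain ⟨s, t, st, ts, gs, sg, tg, gt⟩ := (V.cls_eq_cls hg hg').1 h3
  have z1 : ∀ {a b c d : A}, a * c = a → d * b = b → c * d = 0 → a * b = 0 := by
    intro a b c d h1 h2 h3
    rw [← h1, ← h2, mul_assoc, ← mul_assoc c, h3, zero_mul, mul_zero]
  -- The three normalized equivalences act between complementary blocks, so their sum is a unit; all
  -- cross terms vanish by `z1`.
  refine ⟨⟨y + w + t, x + z + s, ?_, ?_⟩, ?_, ?_⟩
  · simp only [mul_add, add_mul, yx, wz, ts, z1 ye fz hef, z1 ye gs eg, z1 wf ex hfe,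
      z1 wf gs fg, z1 tg ex ge, z1 tg fz gf]
    simpa using hone'
  · simp only [mul_add, add_mul, xy, zw, st, z1 xe fw hef', z1 xe gt eg', z1 zf ey hfe',
      z1 zf gt fg', z1 sg ey ge', z1 sg fw gf']
    simpa using hone
  · change (y + w + t) * e = e' * (y + w + t)
    simp only [mul_add, add_mul, ye, ey, z1 wf he.eq hfe, z1 tg he.eq ge, z1 he'.eq fw hef',
      z1 he'.eq gt eg']
  · change (y + w + t) * f = f' * (y + w + t)
    simp only [mul_add, add_mul, wf, fw, z1 ye hf.eq hef, z1 tg hf.eq gf, z1 hf'.eq ey hfe',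
      z1 hf'.eq gt fg']

theorem V.cls_conj {e : A} (he : IsIdempotentElem e) (u : Aˣ) :
    V.cls (u * e * ↑u⁻¹) = V.cls e := by
  have : IsIdempotentElem (u * e * ↑u⁻¹) := by
    change _ * _ = _
    calc (u * e * ↑u⁻¹) * (u * e * ↑u⁻¹) = u * e * (↑u⁻¹ * u) * e * ↑u⁻¹ := by
          simp only [mul_assoc]
      _ = _ := by rw [Units.inv_mul, mul_one, mul_assoc (u : A), he.eq]
  rw [V.cls_eq_cls this he]
  have he' : ∀ x, e * (e * x) = e * x := fun x => by rw [← mul_assoc, he.eq]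
  exact ⟨u * e, e * ↑u⁻¹, by simp only [mul_assoc, he'],
    by simp [mul_assoc, he.eq], by simp [mul_assoc, he.eq], by simp [mul_assoc, he.eq],
    by simp [mul_assoc, he'], by simp [he']⟩

end Elements

/-! ### Riesz decomposition in `V(A)`. -/

section Riesz

variable {A : Type*} [CStarAlgebra A]

/-- Riesz decomposition in `V(A)` for real rank zero. -/
theorem RealRankZero.riesz (h : RealRankZero A) {x w y z : V A} (hxw : x + w = y + z) :
    ∃ x₁ x₂ y' z' : V A, x = x₁ + x₂ ∧ y = x₁ + y' ∧ z = x₂ + z' := by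
  let _ := CStarAlgebra.spectralOrder A
  have := CStarAlgebra.spectralOrderedRing A
  obtain ⟨P, rfl⟩ := x.exists_eq_cl
  obtain ⟨W, rfl⟩ := w.exists_eq_cl
  obtain ⟨Y, rfl⟩ := y.exists_eq_cl
  obtain ⟨Z, rfl⟩ := z.exists_eq_cl
  have hP : P.mat * P.mat = P.mat := P.isProj.isIdempotentElem
  have hPs : P.matᴴ = P.mat := P.isProj.isSelfAdjoint
  have hPW := isStarProjection_fromBlocks P.isProj W.isProj
  have hYZ := isStarProjection_fromBlocks Y.isProj Z.isProj
  rw [← V.cl_fromBlocks P.isProj.isIdempotentElem W.isProj.isIdempotentElem,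
    ← V.cl_fromBlocks Y.isProj.isIdempotentElem Z.isProj.isIdempotentElem,
    V.cl_eq_cl hPW.isIdempotentElem hYZ.isIdempotentElem] at hxw
  obtain ⟨v, hv1, hv2⟩ := hxw.mvN hPW hYZ
  obtain ⟨d, hd⟩ : ∃ d, d = fromBlocks P.mat 0 0 (0 : Matrix (Fin W.size) (Fin W.size) A) :=
    ⟨_, rfl⟩
  have hdd : d * d = d := by rw [hd, fromBlocks_multiply]; simp [hP]
  have hds : dᴴ = d := by rw [hd, fromBlocks_conjTranspose]; simp [hPs]
  have hvd : vᴴ * v * d = d := by rw [hv1, hd, fromBlocks_multiply]; simp [hP]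
  have hdv : d * (vᴴ * v) = d := by rw [hv1, hd, fromBlocks_multiply]; simp [hP]
  -- The copy of `P` inside `diag(Y, Z)`, transported by the partial isometry `v`. It lies below `f
  -- + g`, so `exists_riesz_split` applies to it.
  obtain ⟨p, hp⟩ : ∃ p, p = v * d * vᴴ := ⟨_, rfl⟩
  have hpp : p * p = p := by
    calc p * p = v * d * (vᴴ * v * d) * vᴴ := by rw [hp]; simp only [Matrix.mul_assoc]
      _ = p := by rw [hvd, Matrix.mul_assoc v, hdd, hp]
  have hps : pᴴ = p := by
    rw [hp, conjTranspose_mul, conjTranspose_mul, hds, conjTranspose_conjTranspose,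
      Matrix.mul_assoc]
  have hclp : V.cl p = V.cl P.mat := by
    rw [V.cl_eq_cl hpp hP]
    refine AlgEq.trans (f := d) hpp hP ⟨v * d, d * vᴴ, ?_, ?_⟩ ?_
    · rw [Matrix.mul_assoc, ← Matrix.mul_assoc d, hdd, hp, Matrix.mul_assoc]
    · rw [Matrix.mul_assoc, ← Matrix.mul_assoc vᴴ, hvd, hdd]
    · rw [hd]; exact AlgEq.fromBlocks_zero _ hP
  obtain ⟨f, hf⟩ : ∃ f, f = fromBlocks Y.mat 0 0 (0 : Matrix (Fin Z.size) (Fin Z.size) A) :=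
    ⟨_, rfl⟩
  obtain ⟨g, hg⟩ : ∃ g, g = fromBlocks (0 : Matrix (Fin Y.size) (Fin Y.size) A) 0 0 Z.mat :=
    ⟨_, rfl⟩
  have hfproj : IsStarProjection f := hf ▸ isStarProjection_fromBlocks Y.isProj (.zero _)
  have hgproj : IsStarProjection g := hg ▸ isStarProjection_fromBlocks (.zero _) Z.isProj
  have hclf : V.cl f = V.cl Y.mat := by
    rw [V.cl_eq_cl hfproj.isIdempotentElem Y.isProj.isIdempotentElem, hf]
    exact AlgEq.fromBlocks_zero _ Y.isProj.isIdempotentElem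
  have hclg : V.cl g = V.cl Z.mat := by
    rw [V.cl_eq_cl hgproj.isIdempotentElem Z.isProj.isIdempotentElem, hg]
    exact AlgEq.zero_fromBlocks _ Z.isProj.isIdempotentElem
  have hpfg : p * (f + g) = p := by
    have : f + g = v * vᴴ := by rw [hv2, hf, hg, fromBlocks_add]; simp
    rw [this, hp]
    calc v * d * vᴴ * (v * vᴴ) = v * (d * (vᴴ * v)) * vᴴ := by simp only [Matrix.mul_assoc]
      _ = _ := by rw [hdv]
  obtain ⟨r, s, hr, hs, hrs, hrsp, ⟨a, b, hab, hfb, haf⟩, ⟨a', b', hab', hfb', haf'⟩⟩ :=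
    exists_riesz_split (D := CStarMatrix (Fin Y.size ⊕ Fin Z.size) (Fin Y.size ⊕ Fin Z.size) A)
      h.cstarMatrix (p := p) (f := f) (g := g) ⟨hpp, hps⟩ hfproj hgproj hpfg
  have hsr : s * r = 0 := by
    have := congrArg star hrs
    rwa [star_mul, hr.isSelfAdjoint.star_eq, hs.isSelfAdjoint.star_eq, star_zero] at this
  obtain ⟨y', hy'⟩ := V.cl_le (A := A) (m := Fin Y.size ⊕ Fin Z.size)
    (n := Fin Y.size ⊕ Fin Z.size) hr.isIdempotentElem hfproj.isIdempotentElem hab haf hfb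
  obtain ⟨z', hz'⟩ := V.cl_le (A := A) (m := Fin Y.size ⊕ Fin Z.size)
    (n := Fin Y.size ⊕ Fin Z.size) hs.isIdempotentElem hgproj.isIdempotentElem hab' haf' hfb'
  refine ⟨_, _, y', z', ?_, hclf.symm.trans hy', hclg.symm.trans hz'⟩
  rw [← hclp, ← hrsp]
  exact V.cl_add (A := A) (m := Fin Y.size ⊕ Fin Z.size) hr.isIdempotentElem
    hs.isIdempotentElem hrs hsr

end Riesz

end CStarK

/-! ### Monoids with Riesz decomposition and extension of partially additive maps. -/

namespace CStarK

open Matrix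

section RieszMonoids

/-- Riesz decomposition for the algebraic preorder of a commutative monoid. -/
def RieszDecomposition (M : Type*) [AddCommMonoid M] : Prop :=
  ∀ x w y z : M, x + w = y + z → ∃ x₁ x₂ y' z' : M, x = x₁ + x₂ ∧ y = x₁ + y' ∧ z = x₂ + z'

variable {M N : Type*} [AddCommMonoid M] [AddCommMonoid N]

/-- Decompose `x` along the `n` copies of `f`; as `x ≠ 0`, some piece is nonzero, and it lies below
both. -/
theorem RieszDecomposition.exists_common (hR : RieszDecomposition M)
    (h0 : ∀ x y : M, x + y = 0 → x = 0) {x f : M} (hx : x ≠ 0) (n : ℕ) :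
    ∀ w : M, x + w = n • f → ∃ y a b : M, y ≠ 0 ∧ x = y + a ∧ f = y + b := by
  induction n generalizing x with
  | zero => intro w h; rw [zero_nsmul] at h; exact absurd (h0 _ _ h) hx
  | succ n ih =>
    intro w h
    rw [succ_nsmul'] at h
    obtain ⟨x₁, x₂, y', z', rfl, h1, h2⟩ := hR _ _ _ _ h
    by_cases h3 : x₁ = 0
    · rw [h3, zero_add] at hx ⊢
      exact ih hx z' h2.symm
    · exact ⟨x₁, x₂, y', h3, rfl, h1⟩

/-- Each piece of `x` below a copy of the minimal element `e` is `0` or `e`. -/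
theorem RieszDecomposition.eq_nsmul_of_minimal (hR : RieszDecomposition M)
    (h0 : ∀ x y : M, x + y = 0 → x = 0) {e : M} (he : ∀ a b, e = a + b → a = 0 ∨ b = 0) (n : ℕ) :
    ∀ x w : M, x + w = n • e → ∃ k : ℕ, x = k • e := by
  induction n with
  | zero => intro x w h; rw [zero_nsmul] at h; exact ⟨0, by rw [h0 _ _ h, zero_nsmul]⟩
  | succ n ih =>
    intro x w h
    rw [succ_nsmul'] at h
    obtain ⟨x₁, x₂, y', z', rfl, h1, h2⟩ := hR _ _ _ _ h
    obtain ⟨k, rfl⟩ := ih x₂ z' h2.symm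
    rcases he _ _ h1 with rfl | rfl
    · exact ⟨k, zero_add _⟩
    · exact ⟨k + 1, by rw [succ_nsmul', h1, add_zero]⟩

theorem RieszDecomposition.exists_list [IsCancelAdd M] (hR : RieszDecomposition M)
    (h0 : ∀ x y : M, x + y = 0 → x = 0) (L : List M) :
    ∀ x w : M, x + w = L.sum → ∃ P : List (M × M), L = P.map (fun p => p.1 + p.2) ∧
      x = (P.map Prod.fst).sum ∧ w = (P.map Prod.snd).sum := by
  induction L with
  | nil =>
    intro x w h
    exact ⟨[], rfl, h0 _ _ h, h0 _ _ ((add_comm _ _).trans h)⟩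
  | cons a L ih =>
    intro x w h
    rw [List.sum_cons] at h
    obtain ⟨x₁, x₂, y', z', rfl, rfl, h2⟩ := hR _ _ _ _ h
    obtain ⟨P, rfl, hx, hz⟩ := ih x₂ z' h2.symm
    refine ⟨(x₁, y') :: P, rfl, by simp [hx], ?_⟩
    rw [List.map_cons, List.sum_cons, ← hz]
    rw [h2] at h
    exact add_left_cancel (a := x₁ + x₂) (h.trans (by abel))

variable {u : M} {f : M → N}

theorem sum_map_of_partial_additive (hf0 : f 0 = 0)
    (hf : ∀ x y w, x + y + w = u → f (x + y) = f x + f y) (L : List M) :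
    ∀ w, L.sum + w = u → f L.sum = (L.map f).sum := by
  induction L with
  | nil => intro w _; simpa using hf0
  | cons a L ih =>
    intro w h
    rw [List.sum_cons] at h ⊢
    rw [hf _ _ _ h, List.map_cons, List.sum_cons, ih (a + w) (by rw [← h]; abel)]

/-- This is well-definedness of the extension. Peel off the head of `L` and refine `L'` into parts
summing to the head and parts summing to the tail; `f` is additive on each entry of `L'` and on the
decomposition of the head, because these lie below `u`. -/
theorem RieszDecomposition.sum_map_eq [IsCancelAdd M] (hR : RieszDecomposition M)
    (h0 : ∀ x y : M, x + y = 0 → x = 0) (hf0 : f 0 = 0)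
    (hf : ∀ x y w, x + y + w = u → f (x + y) = f x + f y) (L : List M) :
    ∀ L' : List M, (∀ x ∈ L, ∃ w, x + w = u) → (∀ x ∈ L', ∃ w, x + w = u) →
      L.sum = L'.sum → (L.map f).sum = (L'.map f).sum := by
  induction L with
  | nil =>
    intro L' _ _ h
    have : ∀ K : List M, K.sum = 0 → (K.map f).sum = 0 := by
      intro K
      induction K with
      | nil => simp
      | cons a K ih =>
        intro hK
        rw [List.sum_cons] at hK
        rw [List.map_cons, List.sum_cons, h0 _ _ hK, hf0, zero_add,
          ih (h0 _ _ ((add_comm _ _).trans hK))]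
    rw [this L' h.symm]; rfl
  | cons a L ih =>
    intro L' hL hL' h
    rw [List.sum_cons] at h
    obtain ⟨P, rfl, ha, hw⟩ := hR.exists_list h0 L' _ _ h
    obtain ⟨b, hb⟩ := hL a List.mem_cons_self
    have hP : ∀ p ∈ P, ∃ w, p.1 + p.2 + w = u := fun p hp =>
      hL' _ (List.mem_map.2 ⟨p, hp, rfl⟩)
    rw [List.map_cons, List.sum_cons, ih (P.map Prod.snd) (fun x hx => hL x (List.mem_cons_of_mem _ hx))
      ?_ hw]
    · rw [ha, sum_map_of_partial_additive hf0 hf _ b (by rw [← ha, hb])]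
      clear ha hw h hL hL' ih hb
      induction P with
      | nil => simp
      | cons p P ihP =>
        obtain ⟨w, hw⟩ := hP p List.mem_cons_self
        have := ihP fun q hq => hP q (List.mem_cons_of_mem _ hq)
        simp only [List.map_cons, List.sum_cons] at this ⊢
        rw [hf _ _ _ hw, ← this]; abel
    · intro x hx
      obtain ⟨p, hp, rfl⟩ := List.mem_map.1 hx
      obtain ⟨w, hw⟩ := hP p hp
      exact ⟨p.1 + w, by rw [← hw]; abel⟩

/-- A partially additive map on the interval `[0, u]` of a cancellative conical monoid with Riesz
decomposition extends to the monoid, if the interval generates. -/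
theorem RieszDecomposition.exists_extension [IsCancelAdd M] (hR : RieszDecomposition M)
    (h0 : ∀ x y : M, x + y = 0 → x = 0) (hf0 : f 0 = 0)
    (hf : ∀ x y w, x + y + w = u → f (x + y) = f x + f y)
    (hgen : ∀ x : M, ∃ L : List M, (∀ y ∈ L, ∃ w, y + w = u) ∧ x = L.sum) :
    ∃ g : M →+ N, ∀ x w, x + w = u → g x = f x := by
  -- The extension sums the values of `f` over a chosen decomposition into elements below `u`;
  -- `sum_map_eq` shows that the choice does not matter.
  choose L hL hsum using hgen
  have key := fun K K' => hR.sum_map_eq h0 hf0 hf K K'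
  refine ⟨⟨⟨fun x => ((L x).map f).sum, ?_⟩, ?_⟩, ?_⟩
  · exact key (L 0) [] (hL 0) (by simp) (hsum 0).symm
  · intro x y
    change _ = ((L x).map f).sum + ((L y).map f).sum
    rw [← List.sum_append, ← List.map_append]
    refine key _ _ (hL _) ?_ ?_
    · intro z hz
      rcases List.mem_append.1 hz with hz | hz
      · exact hL _ _ hz
      · exact hL _ _ hz
    · rw [← hsum, List.sum_append, ← hsum, ← hsum]
  · intro x w h
    have := key (L x) [x] (hL x) (by simpa using ⟨w, h⟩) (by rw [← hsum]; simp)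
    change ((L x).map f).sum = f x
    simpa using this

end RieszMonoids

/-! ### Generation of `V(A)` and the use of simplicity. -/

section Generation

variable {A : Type*} [CStarAlgebra A]

theorem HasCancellation.isCancelAdd (h : HasCancellation A) : IsCancelAdd (V A) where
  add_left_cancel a b c hbc := h b c a (by rw [add_comm b, add_comm c]; exact hbc)
  add_right_cancel a b c hbc := h b c a hbc

theorem RealRankZero.rieszDecomposition (h : RealRankZero A) : RieszDecomposition (V A) :=
  fun _ _ _ _ hxw => h.riesz hxw

theorem V.cl_sum {ι m : Type*} [Fintype m] {E : ι → Matrix m m A}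
    (hE : ∀ i, IsIdempotentElem (E i)) (horth : ∀ i j, i ≠ j → E i * E j = 0) (s : Finset ι) :
    IsIdempotentElem (∑ i ∈ s, E i) ∧ V.cl (∑ i ∈ s, E i) = ∑ i ∈ s, V.cl (E i) := by
  classical
  induction s using Finset.induction_on with
  | empty => exact ⟨by simp [IsIdempotentElem.zero], by simpa using (V.cl_eq_zero .zero).2 rfl⟩
  | insert j s hj ih =>
    have h1 : E j * ∑ i ∈ s, E i = 0 := by
      rw [Finset.mul_sum]
      exact Finset.sum_eq_zero fun i hi => horth j i (by rintro rfl; exact hj hi)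
    have h2 : (∑ i ∈ s, E i) * E j = 0 := by
      rw [Finset.sum_mul]
      exact Finset.sum_eq_zero fun i hi => horth i j (by rintro rfl; exact hj hi)
    rw [Finset.sum_insert hj, Finset.sum_insert hj, V.cl_add (hE j) ih.1 h1 h2, ih.2]
    refine ⟨?_, rfl⟩
    change (_ + _) * (_ + _) = _
    rw [mul_add, add_mul, add_mul, (hE j).eq, ih.1.eq, h1, h2]; abel

theorem V.cl_diagonal {ι : Type*} [Fintype ι] [DecidableEq ι] {e : A} (he : IsIdempotentElem e) :
    IsIdempotentElem (diagonal fun _ : ι => e) ∧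
      V.cl (diagonal fun _ : ι => e) = Fintype.card ι • V.cls e := by
  have hi : ∀ i : ι, IsIdempotentElem (single i i e) := fun i => by
    change _ * _ = _
    rw [single_mul_single_same, he.eq]
  have hc : ∀ i : ι, V.cl (single i i e) = V.cls e := fun i => by
    rw [V.cls, V.cl_eq_cl (hi i) (isIdempotentElem_oneByOne.2 he)]
    refine ⟨single i 0 e, single 0 i e, ?_, ?_⟩
    · rw [single_mul_single_same, he.eq]
    · rw [single_mul_single_same, he.eq]
      ext a b
      rw [Subsingleton.elim a 0, Subsingleton.elim b 0, single_apply_same]; rfl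
  have := V.cl_sum hi (fun i j hij => single_mul_single_of_ne _ _ _ _ hij _) Finset.univ
  rw [sum_single_eq_diagonal] at this
  refine ⟨this.1, this.2.trans ?_⟩
  simp [hc]

theorem V.exists_le_nsmul_one (x : V A) : ∃ (n : ℕ) (w : V A), x + w = n • V.cls 1 := by
  obtain ⟨P, rfl⟩ := x.exists_eq_cl
  have hP := P.isProj.isIdempotentElem
  refine ⟨P.size, V.cl (1 - P.mat), ?_⟩
  have h := (V.cl_diagonal (ι := Fin P.size) (e := (1 : A)) .one).2
  rw [Fintype.card_fin, diagonal_one] at h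
  rw [← h, ← V.cl_add hP hP.one_sub hP.mul_one_sub_self hP.one_sub_mul_self, add_sub_cancel]

/-- The row `(a i * e)` times the column `(e * b i)` factors `1` through `diag(e, …, e)`. -/
theorem V.exists_nsmul_of_sum {ι : Type*} [Fintype ι] {e : A} (he : IsIdempotentElem e)
    (a b : ι → A) (h : ∑ i, a i * e * b i = 1) :
    ∃ (n : ℕ) (w : V A), V.cls 1 + w = n • V.cls e := by
  classical
  obtain ⟨hd, hcl⟩ := V.cl_diagonal (ι := ι) he
  have hx : (of fun (_ : Fin 1) i => a i * e) * (of fun i (_ : Fin 1) => e * b i)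
      = oneByOne (1 : A) := by
    ext i j
    rw [Matrix.mul_apply]
    simp only [of_apply, oneByOne, ← h]
    refine Finset.sum_congr rfl fun k _ => ?_
    rw [mul_assoc, ← mul_assoc e, he.eq, mul_assoc]
  obtain ⟨w, hw⟩ := V.cl_le (isIdempotentElem_oneByOne.2 .one) hd hx
    (by ext i j; simp [mul_diagonal, mul_assoc, he.eq])
    (by ext i j; simp [diagonal_mul, ← mul_assoc, he.eq])
  exact ⟨_, w, by rw [← hcl, hw]; rfl⟩

/-- The closed ideal generated by `e` contains `1`, so the algebraic ideal `S` has an element at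
distance less than `1` from `1`. Such an element is invertible, and multiplying by its inverse stays
in `S`. -/
theorem IsSimpleCStar.exists_sum (hs : IsSimpleCStar A) {e : A} (he : e ≠ 0) :
    ∃ (ι : Type) (_ : Fintype ι) (a b : ι → A), ∑ i, a i * e * b i = 1 := by
  let S : AddSubgroup A :=
    { carrier := {z | ∃ (ι : Type) (_ : Fintype ι) (a b : ι → A), ∑ i, a i * e * b i = z}
      zero_mem' := ⟨Empty, inferInstance, Empty.elim, Empty.elim, by simp⟩
      add_mem' := by
        rintro x y ⟨ι, _, a, b, rfl⟩ ⟨κ, _, c, d, rfl⟩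
        exact ⟨ι ⊕ κ, inferInstance, Sum.elim a c, Sum.elim b d, by simp⟩
      neg_mem' := by
        rintro x ⟨ι, _, a, b, rfl⟩
        exact ⟨ι, inferInstance, fun i => - a i, b, by simp⟩ }
  have hl : ∀ x, ∀ y ∈ S, x * y ∈ S := by
    rintro x y ⟨ι, _, a, b, rfl⟩
    exact ⟨ι, inferInstance, fun i => x * a i, b, by simp [Finset.mul_sum, mul_assoc]⟩
  have hr : ∀ x, ∀ y ∈ S, y * x ∈ S := by
    rintro x y ⟨ι, _, a, b, rfl⟩
    exact ⟨ι, inferInstance, a, fun i => b i * x, by simp [Finset.sum_mul, mul_assoc]⟩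
  let I : TwoSidedIdeal A := TwoSidedIdeal.mk' (S.topologicalClosure : Set A)
    (zero_mem _) (fun h h' => add_mem h h') (fun h => neg_mem h)
    (fun {x y} h => map_mem_closure (continuous_const_mul x) h (hl x))
    (fun {x y} h => map_mem_closure (f := (· * y)) (continuous_mul_const y) h (hr y))
  have hI : (I : Set A) = closure (S : Set A) := TwoSidedIdeal.coe_mk' _ _ _ _ _ _
  have heI : e ∈ (I : Set A) := by
    rw [hI]
    exact subset_closure ⟨Unit, inferInstance, fun _ => 1, fun _ => 1, by simp⟩
  have h1 : (1 : A) ∈ closure (S : Set A) := by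
    rw [← hI]
    rcases hs.2 I (by rw [hI]; exact isClosed_closure) with h | h
    · rw [h] at heI
      exact absurd ((TwoSidedIdeal.mem_bot A).1 heI) he
    · rw [h]; exact TwoSidedIdeal.mem_top A
  obtain ⟨y, hy, hy1⟩ := Metric.mem_closure_iff.1 h1 1 one_pos
  rw [dist_eq_norm] at hy1
  obtain ⟨v, hv⟩ : IsUnit y := by
    have := isUnit_one_sub_of_norm_lt_one hy1
    rwa [sub_sub_cancel] at this
  have := hr ↑v⁻¹ y hy
  rw [← hv, Units.mul_inv] at this
  exact this

theorem IsSimpleCStar.eq_zero_of_mul (hs : IsSimpleCStar A) {e f : A}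
    (h : ∀ x, e * x * f = 0) : e = 0 ∨ f = 0 := by
  by_contra hne
  rw [not_or] at hne
  obtain ⟨ι, _, a, b, hab⟩ := hs.exists_sum hne.1
  apply hne.2
  rw [← one_mul f, ← hab, Finset.sum_mul]
  refine Finset.sum_eq_zero fun i _ => ?_
  rw [mul_assoc, mul_assoc, ← mul_assoc e, h, mul_zero]

end Generation

/-! ### Order structure of `V(A)` and `K₀(A)` for algebras in the class. -/

section ClassF

variable {A : Type*} [CStarAlgebra A]

theorem ClassF.exists_le_nsmul (h : ClassF A) {e : A} (he : IsIdempotentElem e) (h0 : e ≠ 0)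
    (x : V A) : ∃ (n : ℕ) (w : V A), x + w = n • V.cls e := by
  obtain ⟨n, w, hn⟩ := x.exists_le_nsmul_one
  obtain ⟨ι, _, a, b, hab⟩ := h.simple.exists_sum h0
  obtain ⟨m, v, hm⟩ := V.exists_nsmul_of_sum he a b hab
  refine ⟨n * m, w + n • v, ?_⟩
  rw [← add_assoc, hn, ← nsmul_add, hm, mul_comm, mul_nsmul]

/-- Two nonzero idempotents have a common nonzero lower bound in `V(A)`. -/
theorem ClassF.exists_common (h : ClassF A) {e f : A} (he : IsIdempotentElem e)
    (hf : IsIdempotentElem f) (he0 : e ≠ 0) (hf0 : f ≠ 0) :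
    ∃ y a b : V A, y ≠ 0 ∧ V.cls e = y + a ∧ V.cls f = y + b := by
  obtain ⟨n, w, hn⟩ := h.exists_le_nsmul hf hf0 (V.cls e)
  exact h.realRankZero.rieszDecomposition.exists_common (fun _ _ => V.eq_zero_of_add_eq_zero)
    (by rwa [Ne, V.cls_eq_zero he]) n w hn

theorem K0.exists_sub (z : K0 A) : ∃ a b : V A,
    z = Algebra.GrothendieckAddGroup.of a - Algebra.GrothendieckAddGroup.of b := by
  obtain ⟨⟨a, b⟩, h⟩ := (AddLocalization.addMonoidOf (⊤ : AddSubmonoid (V A))).surj z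
  exact ⟨a, b, eq_sub_of_add_eq h⟩

/-- In the noncyclic case every nonzero idempotent is a sum of two nonzero ones. -/
theorem ClassF.exists_split (h : ClassF A) (hK : ¬ IsAddCyclic (K0 A)) {e : A}
    (he : IsIdempotentElem e) (h0 : e ≠ 0) : ∃ e₁ e₂ : A, IsIdempotentElem e₁ ∧
      IsIdempotentElem e₂ ∧ e₁ * e₂ = 0 ∧ e₂ * e₁ = 0 ∧ e₁ + e₂ = e ∧ e₁ ≠ 0 ∧ e₂ ≠ 0 := by
  by_contra hno
  -- An unsplittable `e` has a minimal class. Every class lies below a multiple of it, so `V(A)`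
  -- consists of its multiples and `K₀(A)` would be cyclic.
  have hmin : ∀ a b, V.cls e = a + b → a = 0 ∨ b = 0 := by
    intro a b hab
    obtain ⟨e₁, e₂, h1, h2, h12, h21, hs, rfl, rfl⟩ := V.cls_split he hab
    rw [V.cls_eq_zero h1, V.cls_eq_zero h2]
    by_contra hne
    rw [not_or] at hne
    exact hno ⟨e₁, e₂, h1, h2, h12, h21, hs, hne.1, hne.2⟩
  have hmul : ∀ x : V A, ∃ k : ℕ, x = k • V.cls e := fun x => by
    obtain ⟨n, w, hn⟩ := h.exists_le_nsmul he h0 x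
    exact h.realRankZero.rieszDecomposition.eq_nsmul_of_minimal
      (fun _ _ => V.eq_zero_of_add_eq_zero) hmin n x w hn
  refine hK ⟨Algebra.GrothendieckAddGroup.of (V.cls e), fun z => ?_⟩
  obtain ⟨a, b, rfl⟩ := K0.exists_sub z
  obtain ⟨k, rfl⟩ := hmul a
  obtain ⟨l, rfl⟩ := hmul b
  exact ⟨(k : ℤ) - l, by simp [sub_smul]⟩

theorem ClassF.exists_list (h : ClassF A) (x : V A) :
    ∃ L : List (V A), (∀ y ∈ L, ∃ w, y + w = V.cls 1) ∧ x = L.sum := by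
  have := h.cancellation.isCancelAdd
  obtain ⟨n, w, hn⟩ := x.exists_le_nsmul_one
  rw [← List.sum_replicate] at hn
  obtain ⟨P, hP, hx, -⟩ := h.realRankZero.rieszDecomposition.exists_list
    (fun _ _ => V.eq_zero_of_add_eq_zero) _ _ _ hn
  refine ⟨P.map Prod.fst, fun y hy => ?_, hx⟩
  obtain ⟨p, hp, rfl⟩ := List.mem_map.1 hy
  refine ⟨p.2, ?_⟩
  have : p.1 + p.2 ∈ List.replicate n (V.cls (1 : A)) := by
    rw [hP]; exact List.mem_map.2 ⟨p, hp, rfl⟩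
  exact List.eq_of_mem_replicate this

theorem V.exists_idempotent_of_le_one {x w : V A} (h : x + w = V.cls 1) :
    ∃ e : A, IsIdempotentElem e ∧ V.cls e = x := by
  obtain ⟨e, -, he, -, -, -, -, hx, -⟩ := V.cls_split .one h.symm
  exact ⟨e, he, hx⟩

theorem K0.cone_eq : K0.cone A = Set.range (Algebra.GrothendieckAddGroup.of (M := V A)) := by
  ext z
  constructor
  · rintro ⟨P, rfl⟩; exact ⟨V.mk P, rfl⟩
  · rintro ⟨x, rfl⟩
    induction x using Quotient.inductionOn with
    | h P => exact ⟨P, rfl⟩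

/-- Replaces the scale by the interval `[0, [1]]` of `V(A)`, which any isomorphism fixing `[1]`
preserves. -/
theorem K0.scale_eq : K0.scale A =
    Algebra.GrothendieckAddGroup.of '' {x : V A | ∃ w, x + w = V.cls 1} := by
  ext z
  constructor
  · rintro ⟨p, hp, rfl⟩
    refine ⟨_, ⟨V.cls (1 - p), ?_⟩, rfl⟩
    rw [V.mk_ofProj, V.cls_add_cls_one_sub hp.isIdempotentElem]
  · rintro ⟨x, ⟨w, hw⟩, rfl⟩
    obtain ⟨e, he, rfl⟩ := V.exists_idempotent_of_le_one hw
    obtain ⟨p, hp, hpe⟩ := V.exists_ofProj he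
    exact ⟨p, hp, by rw [← hpe]; rfl⟩

theorem ClassF.isScaledOrderedGroup (h : ClassF A) :
    IsScaledOrderedGroup (K0.cone A) (K0.scale A) := by
  have := h.cancellation.isCancelAdd
  have hinj := Algebra.GrothendieckAddGroup.of_injective (M := V A)
  rw [K0.cone_eq, K0.scale_eq]
  refine ⟨⟨?_, ?_, ?_⟩, ?_, ?_, ?_, ?_⟩
  · rintro _ ⟨a, rfl⟩ _ ⟨b, rfl⟩
    exact ⟨a + b, map_add _ _ _⟩
  · ext z
    constructor
    · rintro ⟨⟨a, rfl⟩, b, hb⟩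
      rw [← add_eq_zero_iff_eq_neg, ← map_add, ← map_zero Algebra.GrothendieckAddGroup.of,
        hinj.eq_iff] at hb
      have : a = 0 := V.eq_zero_of_add_eq_zero ((add_comm a b).trans hb)
      rw [this, map_zero]; rfl
    · rintro rfl
      exact ⟨⟨0, map_zero _⟩, 0, by rw [map_zero, neg_zero]⟩
  · intro z
    obtain ⟨a, b, rfl⟩ := K0.exists_sub z
    exact ⟨_, ⟨a, rfl⟩, _, ⟨b, rfl⟩, rfl⟩
  · rintro _ ⟨a, -, rfl⟩
    exact ⟨a, rfl⟩
  · rintro _ ⟨a, rfl⟩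
    obtain ⟨L, hL, rfl⟩ := h.exists_list a
    -- The extra `0`, itself in the scale, keeps the list nonempty when `L` is empty.
    refine ⟨0 :: L.map Algebra.GrothendieckAddGroup.of, by simp, ?_, ?_⟩
    · intro x hx
      rcases List.mem_cons.1 hx with rfl | hx
      · exact ⟨0, ⟨_, zero_add _⟩, map_zero _⟩
      · obtain ⟨y, hy, rfl⟩ := List.mem_map.1 hx
        exact ⟨y, hL y hy, rfl⟩
    · rw [List.sum_cons, zero_add, map_list_sum]
  · rintro _ _ ⟨a, rfl⟩ ⟨c, hc⟩ ⟨b, ⟨w, hw⟩, rfl⟩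
    rw [eq_sub_iff_add_eq, ← map_add, hinj.eq_iff] at hc
    exact ⟨a, ⟨c + w, by rw [← hw, ← hc]; abel⟩, rfl⟩
  · rintro _ ⟨a, ⟨v, hv⟩, rfl⟩ _ ⟨b, ⟨w, hw⟩, rfl⟩
    refine ⟨_, ⟨V.cls 1, ⟨0, add_zero _⟩, rfl⟩, ⟨v, ?_⟩, w, ?_⟩
    · rw [← hv, map_add]; abel
    · rw [← hw, map_add]; abel

end ClassF

end CStarK

/-! ### The map on idempotents induced by an isomorphism of unit groups. -/

namespace CStarK

section InvolutionMap

/-- Orthogonality of two elements of a ring. -/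
def Orth {R : Type*} [Ring R] (e f : R) : Prop := e * f = 0 ∧ f * e = 0

/-- The properties of the map on idempotents induced by an isomorphism of general linear groups
through the symmetries `1 - 2e`. -/
structure IsInvolutionMap {A B : Type*} [Ring A] [Ring B] (θ : A → B) : Prop where
  idem : ∀ e, IsIdempotentElem e → IsIdempotentElem (θ e)
  inj : ∀ e f, IsIdempotentElem e → IsIdempotentElem f → θ e = θ f → e = f
  zero : θ 0 = 0
  one_sub : ∀ e, IsIdempotentElem e → θ (1 - e) = 1 - θ e
  comm : ∀ e f, IsIdempotentElem e → IsIdempotentElem f → e * f = f * e → θ e * θ f = θ f * θ e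
  add_orth : ∀ e f, IsIdempotentElem e → IsIdempotentElem f → Orth e f →
    θ (e + f) = θ e + θ f - 2 * (θ e * θ f)
  four : ∀ e f, IsIdempotentElem e → IsIdempotentElem f → Orth e f →
    θ e * θ f = 0 ∨ θ e * (1 - θ f) = 0 ∨ (1 - θ e) * θ f = 0 ∨ (1 - θ e) * (1 - θ f) = 0
  conj : ∀ u : Aˣ, ∃ v : Bˣ, ∀ e, IsIdempotentElem e → θ (u * e * ↑u⁻¹) = v * θ e * ↑v⁻¹

theorem isIdempotentElem_add {R : Type*} [Ring R] {e f : R} (he : IsIdempotentElem e)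
    (hf : IsIdempotentElem f) (h : Orth e f) : IsIdempotentElem (e + f) := by
  change (e + f) * (e + f) = _
  rw [mul_add, add_mul, add_mul, he.eq, hf.eq, h.1, h.2]; abel

theorem isIdempotentElem_conj {R : Type*} [Ring R] {e : R} (he : IsIdempotentElem e) (u : Rˣ) :
    IsIdempotentElem (u * e * ↑u⁻¹) := by
  change u * e * ↑u⁻¹ * (u * e * ↑u⁻¹) = _
  calc u * e * ↑u⁻¹ * (u * e * ↑u⁻¹) = u * e * (↑u⁻¹ * u) * e * ↑u⁻¹ := by
        simp only [mul_assoc]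
    _ = _ := by rw [Units.inv_mul, mul_one, mul_assoc (u : R), he.eq]

section Involution

variable {A : Type*} [Ring A]

theorem symmetry_mul_self {e : A} (he : IsIdempotentElem e) :
    (1 - 2 * e) * (1 - 2 * e) = 1 := by
  have : (1 - 2 * e) * (1 - 2 * e) = 1 - 4 * e + 4 * (e * e) := by noncomm_ring
  rw [this, he.eq]; abel

open Classical in
/-- The symmetry `1 - 2e` of an idempotent `e`, as a unit. -/
noncomputable def symmetry (e : A) : Aˣ :=
  if h : IsIdempotentElem e then ⟨1 - 2 * e, 1 - 2 * e, symmetry_mul_self h, symmetry_mul_self h⟩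
  else 1

theorem val_symmetry {e : A} (he : IsIdempotentElem e) : (symmetry e : A) = 1 - 2 * e := by
  rw [symmetry, dif_pos he]

theorem symmetry_mul_symmetry {e : A} (he : IsIdempotentElem e) : symmetry e * symmetry e = 1 := by
  ext; rw [Units.val_mul, val_symmetry he, symmetry_mul_self he, Units.val_one]

theorem symmetry_add {e f : A} (he : IsIdempotentElem e) (hf : IsIdempotentElem f)
    (h : Orth e f) : symmetry (e + f) = symmetry e * symmetry f := by
  ext
  rw [Units.val_mul, val_symmetry he, val_symmetry hf, val_symmetry (isIdempotentElem_add he hf h)]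
  have : (1 - 2 * e) * (1 - 2 * f) = 1 - 2 * (e + f) + 4 * (e * f) := by noncomm_ring
  rw [this, h.1, mul_zero, add_zero]

theorem symmetry_conj {e : A} (he : IsIdempotentElem e) (u : Aˣ) :
    symmetry (u * e * ↑u⁻¹) = u * symmetry e * u⁻¹ := by
  ext
  rw [Units.val_mul, Units.val_mul, val_symmetry he, val_symmetry (isIdempotentElem_conj he u)]
  have : (u : A) * (1 - 2 * e) * ↑u⁻¹ = u * ↑u⁻¹ - 2 * (u * e * ↑u⁻¹) := by noncomm_ring
  rw [this, Units.mul_inv]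

end Involution

variable {A : Type*} [CStarAlgebra A]

/-- The idempotent of a symmetry. -/
noncomputable def ofSymmetry (u : Aˣ) : A := (2⁻¹ : ℂ) • (1 - (u : A))

theorem two_mul_ofSymmetry (u : Aˣ) : 2 * ofSymmetry u = 1 - (u : A) := by
  rw [ofSymmetry, two_mul, ← add_smul]; norm_num

theorem two_mul_inj {x y : A} (h : 2 * x = 2 * y) : x = y := by
  have h2 : (2 : ℂ) • x = (2 : ℂ) • y := by rw [two_smul, two_smul, ← two_mul, ← two_mul, h]
  exact smul_right_injective A (two_ne_zero (α := ℂ)) h2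

theorem ofSymmetry_symmetry {e : A} (he : IsIdempotentElem e) : ofSymmetry (symmetry e) = e :=
  two_mul_inj (by rw [two_mul_ofSymmetry, val_symmetry he, sub_sub_cancel])

theorem isIdempotentElem_ofSymmetry {u : Aˣ} (hu : u * u = 1) :
    IsIdempotentElem (ofSymmetry u) := by
  have hu' : (u : A) * u = 1 := by rw [← Units.val_mul, hu, Units.val_one]
  refine two_mul_inj (two_mul_inj ?_)
  calc 2 * (2 * (ofSymmetry u * ofSymmetry u)) = (2 * ofSymmetry u) * (2 * ofSymmetry u) := by
        noncomm_ring
    _ = 2 * (2 * ofSymmetry u) := by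
        rw [two_mul_ofSymmetry, two_mul]
        simp only [mul_sub, sub_mul, hu', mul_one, one_mul]; abel

theorem symmetry_ofSymmetry {u : Aˣ} (hu : u * u = 1) : symmetry (ofSymmetry u) = u := by
  ext
  rw [val_symmetry (isIdempotentElem_ofSymmetry hu), two_mul_ofSymmetry, sub_sub_cancel]

theorem commute_ofSymmetry {x : A} {u : Aˣ} (h : Commute x (u : A)) :
    Commute x (ofSymmetry u) :=
  (Commute.sub_right (Commute.one_right x) h).smul_right _

theorem commute_symmetry {e : A} (he : IsIdempotentElem e) {u : Aˣ} (h : Commute (u : A) e) :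
    Commute u (symmetry e) := by
  ext
  rw [Units.val_mul, Units.val_mul, val_symmetry he]
  rw [mul_sub, sub_mul, mul_one, one_mul, two_mul, mul_add, add_mul, h.eq]

/-- If `e` commutes with every unit that commutes with the elements of `S`, then it commutes with
every such element. -/
theorem commute_of_units {S : Set A} {e : A}
    (h : ∀ u : Aˣ, (∀ s ∈ S, Commute (u : A) s) → Commute (u : A) e) {y : A}
    (hy : ∀ s ∈ S, Commute y s) : Commute y e := by
  -- Every `y` is a scalar multiple of `1 - u` for the unit `u = 1 - t • y`, which has the same
  -- commutation relations as `y`.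
  obtain ⟨t, ht0, ht⟩ : ∃ t : ℂ, t ≠ 0 ∧ ‖t • y‖ < 1 := by
    refine ⟨((‖y‖ + 1)⁻¹ : ℝ), ?_, ?_⟩
    · have : (‖y‖ + 1)⁻¹ ≠ 0 := by positivity
      exact_mod_cast this
    · rw [norm_smul, Complex.norm_real, Real.norm_of_nonneg (by positivity),
        inv_mul_lt_iff₀ (by positivity)]
      linarith
  obtain ⟨u, hu⟩ := isUnit_one_sub_of_norm_lt_one ht
  have h1 := h u fun s hs => by
    rw [hu]; exact (Commute.one_left s).sub_left ((hy s hs).smul_left t)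
  have h2 : y = t⁻¹ • (1 - (u : A)) := by
    rw [hu, sub_sub_cancel, smul_smul, inv_mul_cancel₀ ht0, one_smul]
  rw [h2]
  exact ((Commute.one_left e).sub_left h1).smul_left _

/-- The compression of `e` is a central idempotent of the corner `aAa`, so `e * a` and `a - e * a`
annihilate each other across all of `A`. Simplicity then kills one of them. -/
theorem IsSimpleCStar.mul_eq_zero_or (hs : IsSimpleCStar A) {a e : A} (ha : IsIdempotentElem a)
    (he : IsIdempotentElem e) (h : ∀ x, Commute (a * x * a) e) : e * a = 0 ∨ e * a = a := by
  have hae : Commute a e := by simpa [ha.eq] using h 1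
  have key : ∀ x, (e * a) * x * (a - e * a) = 0 := by
    intro x
    calc (e * a) * x * (a - e * a) = e * (a * x * a) - (e * (a * x * a)) * e := by
          rw [mul_sub, ← hae.eq]; simp only [mul_assoc]; rw [hae.eq]; simp only [← mul_assoc, hae.eq]
      _ = 0 := by
          rw [mul_assoc e _ e, (h x).eq, ← mul_assoc e e, he.eq, sub_self]
  rcases hs.eq_zero_of_mul key with h1 | h1
  · exact Or.inl h1
  · exact Or.inr (sub_eq_zero.1 h1).symm

variable {B : Type*} [CStarAlgebra B]

/-- The map on idempotents induced by an isomorphism of the groups of units. -/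
noncomputable def idemMap (φ : Aˣ ≃* Bˣ) (e : A) : B := ofSymmetry (φ (symmetry e))

section IdemMap

variable (φ : Aˣ ≃* Bˣ)

theorem map_symmetry_mul_self {e : A} (he : IsIdempotentElem e) :
    φ (symmetry e) * φ (symmetry e) = 1 := by
  rw [← map_mul, symmetry_mul_symmetry he, map_one]

theorem isIdempotentElem_idemMap {e : A} (he : IsIdempotentElem e) :
    IsIdempotentElem (idemMap φ e) :=
  isIdempotentElem_ofSymmetry (map_symmetry_mul_self φ he)

theorem symmetry_idemMap {e : A} (he : IsIdempotentElem e) :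
    symmetry (idemMap φ e) = φ (symmetry e) :=
  symmetry_ofSymmetry (map_symmetry_mul_self φ he)

theorem idemMap_symm_idemMap {e : A} (he : IsIdempotentElem e) :
    idemMap φ.symm (idemMap φ e) = e := by
  rw [idemMap, symmetry_idemMap φ he, φ.symm_apply_apply, ofSymmetry_symmetry he]

theorem idemMap_zero : idemMap φ (0 : A) = 0 := by
  have : symmetry (0 : A) = 1 := by ext; rw [val_symmetry .zero]; simp
  rw [idemMap, this, map_one, ofSymmetry]; simp

theorem commute_idemMap {e : A} (he : IsIdempotentElem e) {u : Aˣ} (h : Commute (u : A) e) :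
    Commute (φ u : B) (idemMap φ e) := by
  apply commute_ofSymmetry
  have h1 := (commute_symmetry he h).map φ
  exact congrArg Units.val h1.eq

theorem commute_of_commute_idemMap {e : A} (he : IsIdempotentElem e) {u : Aˣ}
    (h : Commute (φ u : B) (idemMap φ e)) : Commute (u : A) e := by
  have := commute_idemMap φ.symm (isIdempotentElem_idemMap φ he) h
  rwa [φ.symm_apply_apply, idemMap_symm_idemMap φ he] at this

theorem idemMap_add {e f : A} (he : IsIdempotentElem e) (hf : IsIdempotentElem f)
    (h : Orth e f) :
    idemMap φ (e + f) = idemMap φ e + idemMap φ f - 2 * (idemMap φ e * idemMap φ f) := by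
  apply two_mul_inj
  rw [idemMap, two_mul_ofSymmetry, symmetry_add he hf h, map_mul, Units.val_mul,
    ← symmetry_idemMap φ he, ← symmetry_idemMap φ hf,
    val_symmetry (isIdempotentElem_idemMap φ he), val_symmetry (isIdempotentElem_idemMap φ hf)]
  generalize idemMap φ e = x
  generalize idemMap φ f = y
  have : (1 - 2 * x) * (1 - 2 * y) = 1 - (2 * x + 2 * y - 2 * (2 * (x * y))) := by noncomm_ring
  rw [this]; noncomm_ring

/-- The image of `1` commutes with every unit, hence with all of `B`, so it is `0` or `1`;
injectivity excludes `0`. -/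
theorem idemMap_one (hA : Nontrivial A) (hB : IsSimpleCStar B) : idemMap φ (1 : A) = 1 := by
  have h1 := isIdempotentElem_idemMap φ (A := A) .one
  have hc : ∀ y : B, Commute y (idemMap φ 1) := fun y => by
    refine commute_of_units (S := ∅) (fun u _ => ?_) (by simp)
    have := commute_idemMap φ (A := A) .one (u := φ.symm u) (Commute.one_right _)
    rwa [φ.apply_symm_apply] at this
  rcases hB.mul_eq_zero_or (a := 1) .one h1 (fun x => hc _) with h | h
  · rw [mul_one] at h
    have h2 := idemMap_symm_idemMap φ (A := A) .one
    rw [h, idemMap_zero] at h2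
    exact absurd h2 zero_ne_one
  · rwa [mul_one] at h

theorem idemMap_one_sub (hA : Nontrivial A) (hB : IsSimpleCStar B) {e : A}
    (he : IsIdempotentElem e) : idemMap φ (1 - e) = 1 - idemMap φ e := by
  have h := idemMap_add φ he he.one_sub ⟨he.mul_one_sub_self, he.one_sub_mul_self⟩
  rw [add_sub_cancel, idemMap_one φ hA hB] at h
  have hF := isIdempotentElem_idemMap φ he
  have hG := isIdempotentElem_idemMap φ he.one_sub
  have h2 := congrArg (idemMap φ e * ·) h
  have h3 : idemMap φ e * idemMap φ (1 - e) = 0 := by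
    simp only [mul_sub, mul_add, add_mul, mul_one, two_mul, ← mul_assoc, hF.eq] at h2
    rw [← sub_eq_zero] at h2
    rw [← h2]; abel
  rw [h3, mul_zero, sub_zero] at h
  rw [h]; abel

theorem idemMap_comm {e f : A} (he : IsIdempotentElem e) (hf : IsIdempotentElem f)
    (h : e * f = f * e) : idemMap φ e * idemMap φ f = idemMap φ f * idemMap φ e := by
  have hF := isIdempotentElem_idemMap φ he
  have h1 : Commute (symmetry e : A) f := by
    rw [val_symmetry he]
    exact (Commute.one_left f).sub_left (by
      change 2 * e * f = f * (2 * e)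
      simp only [two_mul, add_mul, mul_add, h])
  have := commute_idemMap φ hf h1
  rw [← symmetry_idemMap φ he, val_symmetry hF] at this
  have h2 : Commute (1 - (1 - 2 * idemMap φ e)) (idemMap φ f) :=
    (Commute.one_left _).sub_left this
  rw [sub_sub_cancel] at h2
  refine two_mul_inj ?_
  rw [← mul_assoc, h2.eq]; noncomm_ring

/-- Commutation is all that `φ` transports directly. The preimage `d` of the product of the images
lies in the double commutant of `e` and `f`, so on each of the corners of `e`, `f`, `1 - (e + f)` it
is `0` or everything. The eight possible sums for `d` give the four alternatives. -/
theorem idemMap_four (hA : IsSimpleCStar A) (hB : IsSimpleCStar B) {e f : A}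
    (he : IsIdempotentElem e) (hf : IsIdempotentElem f) (h : Orth e f) :
    idemMap φ e * idemMap φ f = 0 ∨ idemMap φ e * (1 - idemMap φ f) = 0 ∨
      (1 - idemMap φ e) * idemMap φ f = 0 ∨ (1 - idemMap φ e) * (1 - idemMap φ f) = 0 := by
  have hF := isIdempotentElem_idemMap φ he
  have hG := isIdempotentElem_idemMap φ hf
  have hFG : Commute (idemMap φ e) (idemMap φ f) :=
    idemMap_comm φ he hf (h.1.trans h.2.symm)
  have hg : IsIdempotentElem (idemMap φ e * idemMap φ f) := hF.mul_of_commute hFG hG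
  obtain ⟨d, hd⟩ : ∃ d, d = idemMap φ.symm (idemMap φ e * idemMap φ f) := ⟨_, rfl⟩
  have hdi : IsIdempotentElem d := hd ▸ isIdempotentElem_idemMap φ.symm hg
  have hφd : idemMap φ d = idemMap φ e * idemMap φ f := by
    rw [hd]; exact idemMap_symm_idemMap φ.symm hg
  have hcent : ∀ y : A, Commute y e → Commute y f → Commute y d := by
    intro y hye hyf
    refine commute_of_units (S := {e, f}) (fun u hu => ?_) (by simp [hye, hyf])
    apply commute_of_commute_idemMap φ hdi
    rw [hφd]
    exact (commute_idemMap φ he (hu e (by simp))).mul_right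
      (commute_idemMap φ hf (hu f (by simp)))
  have hcomp : ∀ a : A, IsIdempotentElem a → (∀ x, Commute (a * x * a) e) →
      (∀ x, Commute (a * x * a) f) → d * a = 0 ∨ d * a = a := fun a ha h1 h2 =>
    hA.mul_eq_zero_or ha hdi fun x => hcent _ (h1 x) (h2 x)
  have hz : ∀ a b : A, a * b = 0 → b * a = 0 → ∀ x, Commute (a * x * a) b := by
    intro a b h1 h2 x
    change a * x * a * b = b * (a * x * a)
    rw [mul_assoc, h1, ← mul_assoc, ← mul_assoc, h2]; simp
  have hself : ∀ a : A, IsIdempotentElem a → ∀ x, Commute (a * x * a) a := by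
    intro a ha x
    change a * x * a * a = a * (a * x * a)
    rw [mul_assoc (a * x), ha.eq, ← mul_assoc, ← mul_assoc, ha.eq]
  have hs := isIdempotentElem_add he hf h
  have hc1 := hcomp e he (hself e he) (hz e f h.1 h.2)
  have hc2 := hcomp f hf (hz f e h.2 h.1) (hself f hf)
  have hc3 := hcomp (1 - (e + f)) hs.one_sub
    (hz _ _ (by rw [sub_mul, add_mul, he.eq, h.2]; simp) (by rw [mul_sub, mul_add, he.eq, h.1]; simp))
    (hz _ _ (by rw [sub_mul, add_mul, hf.eq, h.1]; simp) (by rw [mul_sub, mul_add, hf.eq, h.2]; simp))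
  have hsum : d = d * e + d * f + d * (1 - (e + f)) := by noncomm_ring
  have hFFG : idemMap φ e * (idemMap φ e * idemMap φ f) = idemMap φ e * idemMap φ f := by
    rw [← mul_assoc, hF.eq]
  have hFGG : idemMap φ e * idemMap φ f * idemMap φ f = idemMap φ e * idemMap φ f := by
    rw [mul_assoc, hG.eq]
  have hone := fun a : A => idemMap_one_sub φ hA.1 hB (e := a)
  have hadd := idemMap_add φ he hf h
  obtain ⟨F, hFd⟩ : ∃ F, F = idemMap φ e := ⟨_, rfl⟩
  obtain ⟨G, hGd⟩ : ∃ G, G = idemMap φ f := ⟨_, rfl⟩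
  have hone_e := hone e he
  have hone_f := hone f hf
  have hone_s := hone _ hs
  rw [hadd] at hone_s
  simp only [← hFd, ← hGd] at hφd hFFG hFGG hadd hone_e hone_f hone_s hF hG ⊢
  -- In each case `hφd` becomes an identity expressing `F * G` through `F` and `G`, and multiplying
  -- it by `F` or `G` where needed gives one of the four products.
  rcases hc1 with h1 | h1 <;> rcases hc2 with h2 | h2 <;> rcases hc3 with h3 | h3 <;>
    rw [h1, h2, h3] at hsum
  · left
    rw [← hφd, hsum]; simp [idemMap_zero]
  · right; right; right
    rw [hsum, zero_add, zero_add, hone_s] at hφd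
    have : (1 - F) * (1 - G) = 1 - (F + G - 2 * (F * G)) - F * G := by noncomm_ring
    rw [this, hφd, sub_self]
  · right; right; left
    rw [hsum, zero_add, add_zero, ← hGd] at hφd
    rw [sub_mul, one_mul, ← hφd, sub_self]
  · left
    rw [hsum, show 0 + f + (1 - (e + f)) = 1 - e by abel, hone_e] at hφd
    rw [← hFFG, ← hφd, mul_sub, mul_one, hF.eq, sub_self]
  · right; left
    rw [hsum, add_zero, add_zero, ← hFd] at hφd
    rw [mul_sub, mul_one, ← hφd, sub_self]
  · left
    rw [hsum, show e + 0 + (1 - (e + f)) = 1 - f by abel, hone_f] at hφd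
    rw [← hFGG, ← hφd, sub_mul, one_mul, hG.eq, sub_self]
  · left
    rw [hsum, add_zero, hadd, two_mul] at hφd
    -- For `d = e + f`: multiplying by `F` and by `G` gives `F = 2FG = G`, hence `F = 2F` and the
    -- product is zero.
    have e1 := congrArg (F * ·) hφd
    have e2 := congrArg (· * G) hφd
    simp only [mul_sub, mul_add, hF.eq, hFFG] at e1
    simp only [sub_mul, add_mul, hG.eq, hFGG] at e2
    have e3 : F = F * G + F * G := by
      rw [← sub_eq_zero] at e1 ⊢; rw [← e1]; abel
    have e4 : G = F * G + F * G := by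
      rw [← sub_eq_zero] at e2 ⊢; rw [← e2]; abel
    have e5 : F = G := e3.trans e4.symm
    rw [← e5, hF.eq] at e3 ⊢
    exact left_eq_add.1 e3
  · right; right; left
    rw [hsum, show e + f + (1 - (e + f)) = 1 by abel, idemMap_one φ hA.1 hB] at hφd
    rw [← hφd, mul_one] at hFFG
    rw [hFFG, sub_self, zero_mul]

/-- An isomorphism of unit groups induces an involution map. -/
theorem isInvolutionMap_idemMap (hA : IsSimpleCStar A) (hB : IsSimpleCStar B) :
    IsInvolutionMap (idemMap φ) where
  idem _ he := isIdempotentElem_idemMap φ he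
  inj e f he hf h := by
    rw [← idemMap_symm_idemMap φ he, h, idemMap_symm_idemMap φ hf]
  zero := idemMap_zero φ
  one_sub _ he := idemMap_one_sub φ hA.1 hB he
  comm e f he hf h := idemMap_comm φ he hf h
  add_orth _ _ he hf h := idemMap_add φ he hf h
  four _ _ he hf h := idemMap_four φ hA hB he hf h
  conj u := by
    refine ⟨φ u, fun e he => ?_⟩
    rw [idemMap, symmetry_conj he, map_mul, map_mul, map_inv, idemMap, ofSymmetry, ofSymmetry,
      mul_smul_comm, smul_mul_assoc]
    congr 1
    rw [mul_sub, sub_mul, mul_one, Units.mul_inv]; rfl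

end IdemMap

end InvolutionMap

end CStarK

/-! ### Orthogonal idempotents and the separation relation. -/

namespace CStarK

section Orthogonal

variable {R : Type*} [Ring R]

theorem Orth.symm {e f : R} (h : Orth e f) : Orth f e := ⟨h.2, h.1⟩

theorem Orth.add_right {e f g : R} (h : Orth e f) (h' : Orth e g) : Orth e (f + g) :=
  ⟨by rw [mul_add, h.1, h'.1, add_zero], by rw [add_mul, h.2, h'.2, add_zero]⟩

theorem Orth.add_left {e f g : R} (h : Orth e g) (h' : Orth f g) : Orth (e + f) g :=
  (h.symm.add_right h'.symm).symm

theorem IsIdempotentElem.orth_one_sub {e : R} (he : IsIdempotentElem e) : Orth e (1 - e) :=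
  ⟨he.mul_one_sub_self, he.one_sub_mul_self⟩

theorem Orth.one_sub_add {e f : R} (he : IsIdempotentElem e) (h : Orth e f) :
    Orth e (1 - (e + f)) :=
  ⟨by rw [mul_sub, mul_add, he.eq, h.1]; simp, by rw [sub_mul, add_mul, he.eq, h.2]; simp⟩

/-- Orthogonality passes to subidempotents. -/
theorem Orth.of_add {e b₁ b₂ : R} (h₁ : IsIdempotentElem b₁) (hb : Orth b₁ b₂)
    (h : Orth e (b₁ + b₂)) : Orth e b₁ := by
  have e1 : (b₁ + b₂) * b₁ = b₁ := by rw [add_mul, h₁.eq, hb.2, add_zero]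
  have e2 : b₁ * (b₁ + b₂) = b₁ := by rw [mul_add, h₁.eq, hb.1, add_zero]
  exact ⟨by rw [← e1, ← mul_assoc, h.1, zero_mul], by rw [← e2, mul_assoc, h.2, mul_zero]⟩

theorem Orth.eq_zero_of_add_eq_one {e f g : R} (h : e + f = 1) (h1 : Orth g e) (h2 : Orth g f) :
    g = 0 := by
  rw [← mul_one g, ← h, mul_add, h1.1, h2.1, add_zero]

theorem Orth.eq_zero_of_self {e : R} (he : IsIdempotentElem e) (h : Orth e e) : e = 0 := by
  rw [← he.eq, h.1]

theorem Orth.eq_zero_of_one {e : R} (h : Orth e 1) : e = 0 := by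
  rw [← mul_one e, h.1]

theorem Orth.conj {e f : R} (h : Orth e f) (u : Rˣ) : Orth (u * e * ↑u⁻¹) (u * f * ↑u⁻¹) := by
  have : ∀ a b : R, a * b = 0 → u * a * ↑u⁻¹ * (u * b * ↑u⁻¹) = 0 := fun a b hab => by
    calc u * a * ↑u⁻¹ * (u * b * ↑u⁻¹) = u * a * (↑u⁻¹ * u) * b * ↑u⁻¹ := by
          simp only [mul_assoc]
      _ = 0 := by rw [Units.inv_mul, mul_one, mul_assoc (u : R), hab, mul_zero, zero_mul]
  exact ⟨this _ _ h.1, this _ _ h.2⟩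

/-- `X` is orthogonal to `G` or to `1 - G`. -/
def Separated (X G : R) : Prop := X * G = 0 ∨ X * (1 - G) = 0

theorem Separated.conj {X G : R} (h : Separated X G) (u : Rˣ) :
    Separated (u * X * ↑u⁻¹) (u * G * ↑u⁻¹) := by
  have : ∀ a b : R, a * b = 0 → u * a * ↑u⁻¹ * (u * b * ↑u⁻¹) = 0 := fun a b hab => by
    calc u * a * ↑u⁻¹ * (u * b * ↑u⁻¹) = u * a * (↑u⁻¹ * u) * b * ↑u⁻¹ := by
          simp only [mul_assoc]
      _ = 0 := by rw [Units.inv_mul, mul_one, mul_assoc (u : R), hab, mul_zero, zero_mul]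
  have h1 : 1 - u * G * ↑u⁻¹ = u * (1 - G) * ↑u⁻¹ := by
    rw [mul_sub, sub_mul, mul_one, Units.mul_inv]
  rw [Separated, h1]
  exact h.imp (this _ _) (this _ _)

end Orthogonal

/-! ### Consistency of separation. -/

section Separation

variable {A B : Type*} [Ring A] [Ring B] {θ : A → B}

theorem IsInvolutionMap.eq_zero (hθ : IsInvolutionMap θ) {e : A} (he : IsIdempotentElem e)
    (h : θ e = 0) : e = 0 :=
  hθ.inj e 0 he .zero (h.trans hθ.zero.symm)

theorem IsInvolutionMap.exists_of_separated (hθ : IsInvolutionMap θ) {X : B} {b : A}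
    (hb : IsIdempotentElem b) (h : Separated X (θ b)) :
    ∃ c, IsIdempotentElem c ∧ (c = b ∨ c = 1 - b) ∧ X * θ c = 0 := by
  rcases h with h | h
  · exact ⟨b, hb, Or.inl rfl, h⟩
  · exact ⟨1 - b, hb.one_sub, Or.inr rfl, by rw [hθ.one_sub b hb, h]⟩

/-- If `c` asked for the opposite sign to `b`, then up to complements `θ b` would lie below `1 - θ
e` and `θ c` below `θ e`. The image of `b + c` is then their sum up to complement, and comparing it
with `θ e` by `four` contradicts injectivity in each case. -/
theorem IsInvolutionMap.separated_trans (hθ : IsInvolutionMap θ) {e b c : A}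
    (he : IsIdempotentElem e) (hb : IsIdempotentElem b) (hc : IsIdempotentElem c)
    (heb : Orth e b) (hec : Orth e c) (hbc : Orth b c) (e0 : e ≠ 0) (b0 : b ≠ 0) (c0 : c ≠ 0)
    (hne : e + b ≠ 1) (h : Separated (θ e) (θ b)) : Separated (θ e) (θ c) := by
  by_contra hno
  have b1 : b ≠ 1 := by rintro rfl; exact e0 heb.eq_zero_of_one
  have c1 : c ≠ 1 := by rintro rfl; exact e0 hec.eq_zero_of_one
  have hsep : Separated (1 - θ e) (θ c) := by
    rcases hθ.four e c he hc hec with h1 | h1 | h1 | h1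
    · exact absurd (Or.inl h1) hno
    · exact absurd (Or.inr h1) hno
    · exact Or.inl h1
    · exact Or.inr h1
  obtain ⟨b', hb', hbb, hF⟩ := hθ.exists_of_separated hb h
  obtain ⟨c', hc', hcc, hF'⟩ := hθ.exists_of_separated hc hsep
  have hFG : θ e * θ b' = θ b' * θ e := hθ.comm e b' he hb' (by
    rcases hbb with rfl | rfl
    · rw [heb.1, heb.2]
    · rw [mul_sub, sub_mul, heb.1, heb.2, mul_one, one_mul])
  have hH : θ e * θ c' = θ c' := by
    rw [sub_mul, one_mul, sub_eq_zero] at hF'; exact hF'.symm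
  have hGH : θ b' * θ c' = 0 := by rw [← hH, ← mul_assoc, ← hFG, hF, zero_mul]
  have hbci := isIdempotentElem_add hb hc hbc
  have hK : θ (b + c) = θ b' + θ c' ∨ θ (b + c) = 1 - (θ b' + θ c') := by
    have hadd := hθ.add_orth b c hb hc hbc
    rcases hbb with rfl | rfl <;> rcases hcc with rfl | rfl
    · left; rw [hadd, hGH]; simp
    · right
      rw [hθ.one_sub c hc] at hGH ⊢
      rw [hadd, mul_sub, mul_one, sub_eq_zero] at *
      rw [← hGH]; noncomm_ring
    · right
      rw [hθ.one_sub b hb] at hGH ⊢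
      rw [sub_mul, one_mul, sub_eq_zero] at hGH
      rw [hadd, ← hGH]; noncomm_ring
    · left
      rw [hθ.one_sub b hb, hθ.one_sub c hc] at hGH ⊢
      have e1 : θ b * θ c = θ b + θ c - 1 := by
        rw [← sub_eq_zero, ← hGH]; noncomm_ring
      rw [hadd, e1]; noncomm_ring
  have hfour : θ e * (θ b' + θ c') = 0 ∨ θ e * (1 - (θ b' + θ c')) = 0 ∨
      (1 - θ e) * (θ b' + θ c') = 0 ∨ (1 - θ e) * (1 - (θ b' + θ c')) = 0 := by
    have := hθ.four e (b + c) he hbci (heb.add_right hec)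
    rcases hK with hK | hK
    · rwa [hK] at this
    · rw [hK, sub_sub_cancel] at this; tauto
  rw [mul_add, mul_sub, mul_add, mul_add, mul_sub, mul_add, hF, hF', hH] at hfour
  -- The alternatives say in turn `θ c' = 0`, `θ e = θ c'`, `θ b' = 0` and `1 - θ e = θ b'`.
  rcases hfour with h1 | h1 | h1 | h1
  · rw [zero_add] at h1
    have := hθ.eq_zero hc' h1
    rcases hcc with rfl | rfl
    · exact c0 this
    · exact c1 (sub_eq_zero.1 this).symm
  · rw [mul_one, zero_add, sub_eq_zero] at h1
    have := hθ.inj _ _ he hc' h1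
    rcases hcc with rfl | rfl
    · rw [← this] at hec; exact e0 (hec.eq_zero_of_self he)
    · exact b0 (Orth.eq_zero_of_add_eq_one (by rw [this]; abel) heb.symm hbc)
  · rw [add_zero, sub_mul, one_mul, hF, sub_zero] at h1
    have := hθ.eq_zero hb' h1
    rcases hbb with rfl | rfl
    · exact b0 this
    · exact b1 (sub_eq_zero.1 this).symm
  · rw [add_zero, mul_one, sub_mul, one_mul, hF, sub_zero, ← hθ.one_sub e he, sub_eq_zero] at h1
    have := hθ.inj _ _ he.one_sub hb' h1
    rcases hbb with rfl | rfl
    · exact hne (by rw [← this]; abel)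
    · rw [sub_right_inj] at this
      subst this
      exact e0 (heb.eq_zero_of_self he)

/-- Both separations together force `θ b` to be `0`, `1`, `θ e` or `1 - θ e`; injectivity excludes
all of these. -/
theorem IsInvolutionMap.not_separated_both (hθ : IsInvolutionMap θ) {e b : A}
    (he : IsIdempotentElem e) (hb : IsIdempotentElem b) (heb : Orth e b) (e0 : e ≠ 0)
    (b0 : b ≠ 0) (hne : e + b ≠ 1) (h : Separated (θ e) (θ b))
    (h' : Separated (1 - θ e) (θ b)) : False := by
  have b1 : b ≠ 1 := by rintro rfl; exact e0 heb.eq_zero_of_one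
  obtain ⟨c, hc, hcb, h1⟩ := hθ.exists_of_separated hb h
  obtain ⟨d, hd, hdb, h2⟩ := hθ.exists_of_separated hb h'
  rw [sub_mul, one_mul, sub_eq_zero] at h2
  have hcd : d = c ∨ d = 1 - c := by
    rcases hcb with rfl | rfl <;> rcases hdb with rfl | rfl <;> simp
  rcases hcd with rfl | rfl
  · rw [h1] at h2
    have := hθ.eq_zero hd h2
    rcases hdb with rfl | rfl
    · exact b0 this
    · exact b1 (sub_eq_zero.1 this).symm
  · rw [hθ.one_sub c hc, mul_sub, h1, mul_one, sub_zero, ← hθ.one_sub c hc] at h2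
    have := hθ.inj _ _ hc.one_sub he h2
    rcases hdb with hdb | hdb
    · rw [← this, hdb] at heb
      exact b0 (heb.eq_zero_of_self hb)
    · exact hne (by rw [← this, hdb]; abel)

end Separation

/-! ### Correcting the sign: the orthogonally additive map `untwist θ`. -/

section Correction

variable {A B : Type*} [CStarAlgebra A] [Ring B] {θ : A → B}

/-- The separation of `θ e` from `θ b` does not depend on `b`. -/
theorem IsInvolutionMap.separated_of_separated (hθ : IsInvolutionMap θ) (hA : ClassF A)
    {e b c : A} (he : IsIdempotentElem e) (hb : IsIdempotentElem b) (hc : IsIdempotentElem c)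
    (heb : Orth e b) (hec : Orth e c) (e0 : e ≠ 0) (b0 : b ≠ 0) (c0 : c ≠ 0)
    (hne : e + b ≠ 1) (hne' : e + c ≠ 1) (h : Separated (θ e) (θ b)) :
    Separated (θ e) (θ c) := by
  -- As `b` and `c` need not be orthogonal, they are compared through equivalent nonzero
  -- subidempotents `b₁` and `c₁`.
  obtain ⟨y, v, w, hy, hyb, hyc⟩ := hA.exists_common hb hc b0 c0
  obtain ⟨b₁, b₂, hb₁, -, h12, h21, rfl, hby, -⟩ := V.cls_split hb hyb
  obtain ⟨c₁, c₂, hc₁, -, g12, g21, rfl, hcy, -⟩ := V.cls_split hc hyc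
  have b₁0 : b₁ ≠ 0 := by rwa [← hby, Ne, V.cls_eq_zero hb₁] at hy
  have c₁0 : c₁ ≠ 0 := by rwa [← hcy, Ne, V.cls_eq_zero hc₁] at hy
  have heb₁ : Orth e b₁ := Orth.of_add hb₁ ⟨h12, h21⟩ heb
  have hec₁ : Orth e c₁ := Orth.of_add hc₁ ⟨g12, g21⟩ hec
  -- An idempotent and its part `b₁` are not orthogonal either; the remainder `1 - (e + (b₁ + b₂))`
  -- is orthogonal to both and links them by two uses of `separated_trans`.
  have key : ∀ b₁ b₂ : A, IsIdempotentElem b₁ → b₁ ≠ 0 → IsIdempotentElem (b₁ + b₂) →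
      Orth b₁ b₂ → Orth e b₁ → Orth e (b₁ + b₂) → b₁ + b₂ ≠ 0 → e + (b₁ + b₂) ≠ 1 →
      (Separated (θ e) (θ (b₁ + b₂)) ↔ Separated (θ e) (θ b₁)) := by
    intro b₁ b₂ hb₁ b₁0 hb h12 heb₁ heb b0 hne
    have hr : IsIdempotentElem (1 - (e + (b₁ + b₂))) := (isIdempotentElem_add he hb heb).one_sub
    have hr0 : 1 - (e + (b₁ + b₂)) ≠ 0 := fun h => hne (sub_eq_zero.1 h).symm
    have her : Orth e (1 - (e + (b₁ + b₂))) := heb.one_sub_add he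
    have hbr : Orth (b₁ + b₂) (1 - (e + (b₁ + b₂))) := by
      rw [add_comm e]; exact heb.symm.one_sub_add hb
    have hb₁r : Orth b₁ (1 - (e + (b₁ + b₂))) := (Orth.of_add hb₁ h12 hbr.symm).symm
    have hne₁ : e + b₁ ≠ 1 := fun h => hr0 (Orth.eq_zero_of_add_eq_one h her.symm hb₁r.symm)
    have hner : e + (1 - (e + (b₁ + b₂))) ≠ 1 := fun h => b0 (by
      rw [← sub_eq_zero, ← neg_eq_zero] at h; rw [← h]; abel)
    constructor
    · intro h
      exact hθ.separated_trans he hr hb₁ her heb₁ hb₁r.symm e0 hr0 b₁0 hner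
        (hθ.separated_trans he hb hr heb her hbr e0 b0 hr0 hne h)
    · intro h
      exact hθ.separated_trans he hr hb her heb hbr.symm e0 hr0 b0 hner
        (hθ.separated_trans he hb₁ hr heb₁ her hb₁r e0 b₁0 hr0 hne₁ h)
  rw [key b₁ b₂ hb₁ b₁0 hb ⟨h12, h21⟩ heb₁ heb b0 hne] at h
  rw [key c₁ c₂ hc₁ c₁0 hc ⟨g12, g21⟩ hec₁ hec c0 hne']
  -- A unit fixing `e` and moving `b₁` to `c₁`; its counterpart `v` in `B` fixes `θ e` and moves `θ
  -- b₁` to `θ c₁`.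
  obtain ⟨u, hu1, hu2⟩ := hA.cancellation.exists_unit he hb₁ heb₁.1 heb₁.2 he hc₁ hec₁.1
    hec₁.2 rfl (hby.trans hcy.symm)
  obtain ⟨v, hv⟩ := hθ.conj u
  have := h.conj v
  rwa [← hv e he, ← hv b₁ hb₁, hu1, hu2, Units.mul_inv_cancel_right,
    Units.mul_inv_cancel_right] at this

/-- The idempotents `e` for which `θ e`, rather than `1 - θ e`, is the right image. -/
def Untwisted (θ : A → B) (e : A) : Prop :=
  e = 1 ∨ ∃ b, IsIdempotentElem b ∧ Orth e b ∧ b ≠ 0 ∧ e + b ≠ 1 ∧ Separated (θ e) (θ b)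

open Classical in
/-- The map `θ`, corrected so that it preserves orthogonality. -/
noncomputable def untwist (θ : A → B) (e : A) : B := if Untwisted θ e then θ e else 1 - θ e

theorem untwist_eq_or (θ : A → B) (e : A) : untwist θ e = θ e ∨ untwist θ e = 1 - θ e := by
  rw [untwist]; split_ifs <;> simp

variable (hθ : IsInvolutionMap θ) (hA : ClassF A)
include hθ

theorem IsInvolutionMap.map_one : θ 1 = 1 := by
  have := hθ.one_sub 0 .zero
  rwa [sub_zero, hθ.zero, sub_zero] at this

theorem IsInvolutionMap.untwist_one : untwist θ 1 = 1 := by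
  rw [untwist, if_pos (show Untwisted θ 1 from Or.inl rfl), hθ.map_one]

theorem IsInvolutionMap.isIdempotentElem_untwist {e : A} (he : IsIdempotentElem e) :
    IsIdempotentElem (untwist θ e) := by
  rcases untwist_eq_or θ e with h | h <;> rw [h]
  · exact hθ.idem e he
  · exact (hθ.idem e he).one_sub

theorem IsInvolutionMap.untwist_eq {e : A} (he : IsIdempotentElem e) :
    ∃ e', IsIdempotentElem e' ∧ (e' = e ∨ e' = 1 - e) ∧ untwist θ e = θ e' := by
  rcases untwist_eq_or θ e with h | h
  · exact ⟨e, he, Or.inl rfl, h⟩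
  · exact ⟨1 - e, he.one_sub, Or.inr rfl, by rw [h, hθ.one_sub e he]⟩

include hA

theorem IsInvolutionMap.separated_untwist {e b : A} (he : IsIdempotentElem e)
    (hb : IsIdempotentElem b) (heb : Orth e b) (e0 : e ≠ 0) (b0 : b ≠ 0) (hne : e + b ≠ 1) :
    Separated (untwist θ e) (θ b) := by
  rw [untwist]
  split_ifs with h
  · rcases h with rfl | ⟨c, hc, hec, c0, hec1, h⟩
    · exact absurd (heb.symm.eq_zero_of_one) b0
    · exact hθ.separated_of_separated hA he hc hb hec heb e0 c0 b0 hec1 hne h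
  · rcases hθ.four e b he hb heb with h1 | h1 | h1 | h1
    · exact absurd (Or.inr ⟨b, hb, heb, b0, hne, Or.inl h1⟩) h
    · exact absurd (Or.inr ⟨b, hb, heb, b0, hne, Or.inr h1⟩) h
    · exact Or.inl h1
    · exact Or.inr h1

/-- Any single test idempotent `b` identifies the corrected image; later identities for `untwist`
rest on this. -/
theorem IsInvolutionMap.eq_untwist {e b : A} (he : IsIdempotentElem e)
    (hb : IsIdempotentElem b) (heb : Orth e b) (e0 : e ≠ 0) (b0 : b ≠ 0) (hne : e + b ≠ 1)
    {X : B} (hX : X = θ e ∨ X = 1 - θ e) (h : Separated X (θ b)) : X = untwist θ e := by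
  have h' := hθ.separated_untwist hA he hb heb e0 b0 hne
  rcases hX with rfl | rfl <;> rcases untwist_eq_or θ e with h1 | h1
  · exact h1.symm
  · rw [h1] at h'
    exact (hθ.not_separated_both he hb heb e0 b0 hne h h').elim
  · rw [h1] at h'
    exact (hθ.not_separated_both he hb heb e0 b0 hne h' h).elim
  · exact h1.symm

omit hA in
theorem IsInvolutionMap.untwist_comm {a b : A} (ha : IsIdempotentElem a)
    (hb : IsIdempotentElem b) (hab : Orth a b) :
    untwist θ a * untwist θ b = untwist θ b * untwist θ a := by
  have h : θ a * θ b = θ b * θ a := hθ.comm a b ha hb (hab.1.trans hab.2.symm)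
  rcases untwist_eq_or θ a with h1 | h1 <;> rcases untwist_eq_or θ b with h2 | h2 <;>
    rw [h1, h2] <;> simp only [mul_sub, sub_mul, mul_one, one_mul, h]; abel

/-- Each corrected image is separated from the other. If neither separation is orthogonality, each
image lies below the other, so they coincide and injectivity gives `a = b` or `a = 1 - b`. -/
theorem IsInvolutionMap.untwist_mul_of_ne {a b : A} (ha : IsIdempotentElem a)
    (hb : IsIdempotentElem b) (hab : Orth a b) (a0 : a ≠ 0) (b0 : b ≠ 0) (hne : a + b ≠ 1) :
    untwist θ a * untwist θ b = 0 := by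
  have h1 := hθ.separated_untwist hA ha hb hab a0 b0 hne
  have h2 := hθ.separated_untwist hA hb ha hab.symm b0 a0 (by rwa [add_comm])
  have hc := hθ.untwist_comm ha hb hab
  have key : ∀ {X Y G : B}, Separated X G → (Y = G ∨ Y = 1 - G) → X * Y = 0 ∨ X * (1 - Y) = 0 := by
    rintro X Y G h (rfl | rfl)
    · exact h
    · rw [sub_sub_cancel]; exact h.symm
  rcases key h1 (untwist_eq_or θ b) with h3 | h3
  · exact h3
  rcases key h2 (untwist_eq_or θ a) with h4 | h4
  · rw [hc, h4]
  rw [mul_sub, mul_one, sub_eq_zero] at h3 h4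
  obtain ⟨a', ha', haa, ea⟩ := hθ.untwist_eq ha
  obtain ⟨b', hb', hbb, eb⟩ := hθ.untwist_eq hb
  have h5 : a' = b' := hθ.inj _ _ ha' hb' (by rw [← ea, ← eb, h3, hc, ← h4])
  exfalso
  rcases haa with rfl | rfl <;> rcases hbb with rfl | rfl
  · subst h5; exact a0 (hab.eq_zero_of_self ha)
  · exact hne (by rw [h5]; abel)
  · exact hne (by rw [← h5]; abel)
  · rw [sub_right_inj] at h5; subst h5; exact a0 (hab.eq_zero_of_self ha)

variable (hK : ¬ IsAddCyclic (K0 A))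
include hK

theorem IsInvolutionMap.untwist_zero : untwist θ 0 = 0 := by
  have := hA.simple.1
  obtain ⟨e, f, he, -, -, -, hef, e0, f0⟩ := hA.exists_split hK .one (one_ne_zero (α := A))
  rw [untwist, if_pos, hθ.zero]
  refine Or.inr ⟨e, he, ⟨zero_mul e, mul_zero e⟩, e0, ?_, Or.inl (by rw [hθ.zero, zero_mul])⟩
  rw [zero_add, ← hef]
  exact fun h => f0 (left_eq_add.1 h)

/-- The sum of the corrected images is `θ (a + b)` or its complement. A piece `c` of the remainder
decides which: it is orthogonal to both summands, and the other piece `d ≠ 0` makes `c` a legitimate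
test for `a + b`. -/
theorem IsInvolutionMap.untwist_add_of_ne {a b : A} (ha : IsIdempotentElem a)
    (hb : IsIdempotentElem b) (hab : Orth a b) (a0 : a ≠ 0) (b0 : b ≠ 0) (hne : a + b ≠ 1) :
    untwist θ (a + b) = untwist θ a + untwist θ b := by
  have hs := isIdempotentElem_add ha hb hab
  have hr0 : 1 - (a + b) ≠ 0 := fun h => hne (sub_eq_zero.1 h).symm
  obtain ⟨c, d, hc, hd, hcd, hdc, hsum, c0, d0⟩ := hA.exists_split hK hs.one_sub hr0
  have har : Orth a (c + d) := hsum ▸ hab.one_sub_add ha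
  have hbr : Orth b (c + d) := by
    rw [hsum, add_comm a]; exact hab.symm.one_sub_add hb
  have hac : Orth a c := Orth.of_add hc ⟨hcd, hdc⟩ har
  have hbc : Orth b c := Orth.of_add hc ⟨hcd, hdc⟩ hbr
  have had : Orth a d := Orth.of_add hd ⟨hdc, hcd⟩ (by rwa [add_comm])
  have hbd : Orth b d := Orth.of_add hd ⟨hdc, hcd⟩ (by rwa [add_comm])
  have hab0 := hθ.untwist_mul_of_ne hA ha hb hab a0 b0 hne
  have hac0 := hθ.untwist_mul_of_ne hA ha hc hac a0 c0
    (fun h => b0 (Orth.eq_zero_of_add_eq_one h hab.symm hbc))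
  have hbc0 := hθ.untwist_mul_of_ne hA hb hc hbc b0 c0
    (fun h => a0 (Orth.eq_zero_of_add_eq_one h hab hac))
  symm
  refine hθ.eq_untwist hA hs hc (hac.add_left hbc) ?_ c0 ?_ ?_ ?_
  · intro h
    apply a0
    have := congrArg (a * ·) h
    simpa only [mul_add, ha.eq, hab.1, add_zero, mul_zero] using this
  · exact fun h => d0 (Orth.eq_zero_of_add_eq_one h (had.add_left hbd).symm ⟨hdc, hcd⟩)
  · have hadd := hθ.add_orth a b ha hb hab
    rcases untwist_eq_or θ a with h1 | h1 <;> rcases untwist_eq_or θ b with h2 | h2 <;>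
      rw [h1, h2] at hab0 ⊢
    · left; rw [hadd, hab0]; simp
    · right
      rw [mul_sub, mul_one, sub_eq_zero] at hab0
      rw [hadd, ← hab0]; noncomm_ring
    · right
      rw [sub_mul, one_mul, sub_eq_zero] at hab0
      rw [hadd, ← hab0]; noncomm_ring
    · left
      have e1 : θ a * θ b = θ a + θ b - 1 := by
        rw [← sub_eq_zero, ← hab0]; noncomm_ring
      rw [hadd, e1]; noncomm_ring
  · have : (untwist θ a + untwist θ b) * untwist θ c = 0 := by rw [add_mul, hac0, hbc0, add_zero]
    rcases untwist_eq_or θ c with h | h <;> rw [h] at this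
    · exact Or.inl this
    · exact Or.inr this

/-- Here `1 - a` is no test for `a`, so both are split. The four pairs of pieces leave room for the
previous lemmas, and the orthogonality of the pieces adds up. -/
theorem IsInvolutionMap.untwist_add_one_sub {a : A} (ha : IsIdempotentElem a) :
    untwist θ a * untwist θ (1 - a) = 0 ∧ untwist θ a + untwist θ (1 - a) = 1 := by
  have h0 := hθ.untwist_zero hA hK
  have h1 := hθ.untwist_one
  by_cases a0 : a = 0
  · rw [a0, sub_zero, h0, h1]; simp
  by_cases a1 : 1 - a = 0
  · rw [a1, h0, ← sub_eq_zero.1 a1, h1]; simp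
  obtain ⟨a₁, a₂, ha₁, ha₂, h12, h21, hs, a₁0, a₂0⟩ := hA.exists_split hK ha a0
  obtain ⟨b₁, b₂, hb₁, hb₂, g12, g21, gs, b₁0, b₂0⟩ := hA.exists_split hK ha.one_sub a1
  have hab : Orth (a₁ + a₂) (b₁ + b₂) := by
    rw [hs, gs]; exact IsIdempotentElem.orth_one_sub ha
  have hab₁ : Orth (a₁ + a₂) b₁ := Orth.of_add hb₁ ⟨g12, g21⟩ hab
  have hab₂ : Orth (a₁ + a₂) b₂ := Orth.of_add hb₂ ⟨g21, g12⟩ (by rwa [add_comm b₂])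
  have p11 : Orth a₁ b₁ := (Orth.of_add ha₁ ⟨h12, h21⟩ hab₁.symm).symm
  have p12 : Orth a₁ b₂ := (Orth.of_add ha₁ ⟨h12, h21⟩ hab₂.symm).symm
  have p21 : Orth a₂ b₁ := (Orth.of_add ha₂ ⟨h21, h12⟩ (by rw [add_comm]; exact hab₁.symm)).symm
  have p22 : Orth a₂ b₂ := (Orth.of_add ha₂ ⟨h21, h12⟩ (by rw [add_comm]; exact hab₂.symm)).symm
  have q11 := hθ.untwist_mul_of_ne hA ha₁ hb₁ p11 a₁0 b₁0
    (fun h => a₂0 (Orth.eq_zero_of_add_eq_one h ⟨h21, h12⟩ p21))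
  have q12 := hθ.untwist_mul_of_ne hA ha₁ hb₂ p12 a₁0 b₂0
    (fun h => a₂0 (Orth.eq_zero_of_add_eq_one h ⟨h21, h12⟩ p22))
  have q21 := hθ.untwist_mul_of_ne hA ha₂ hb₁ p21 a₂0 b₁0
    (fun h => a₁0 (Orth.eq_zero_of_add_eq_one h ⟨h12, h21⟩ p11))
  have q22 := hθ.untwist_mul_of_ne hA ha₂ hb₂ p22 a₂0 b₂0
    (fun h => a₁0 (Orth.eq_zero_of_add_eq_one h ⟨h12, h21⟩ p12))
  have sa := hθ.untwist_add_of_ne hA hK ha₁ ha₂ ⟨h12, h21⟩ a₁0 a₂0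
    (fun h => a1 (by rw [← hs, h, sub_self]))
  have sb := hθ.untwist_add_of_ne hA hK hb₁ hb₂ ⟨g12, g21⟩ b₁0 b₂0
    (fun h => a0 (by rw [gs] at h; exact sub_eq_self.1 h))
  rw [hs] at sa
  rw [gs] at sb
  have hmul : untwist θ a * untwist θ (1 - a) = 0 := by
    rw [sa, sb, mul_add, add_mul, add_mul, q11, q12, q21, q22]; simp
  refine ⟨hmul, ?_⟩
  have hoth : untwist θ (1 - a) = untwist θ a ∨ untwist θ (1 - a) = 1 - untwist θ a := by
    rcases untwist_eq_or θ a with h1 | h1 <;> rcases untwist_eq_or θ (1 - a) with h2 | h2 <;>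
      rw [h1, h2, hθ.one_sub a ha] <;> simp
  rcases hoth with h | h
  · exfalso
    rw [h, (hθ.isIdempotentElem_untwist ha).eq] at hmul
    rcases untwist_eq_or θ a with h1 | h1
    · exact a0 (hθ.eq_zero ha (h1.symm.trans hmul))
    · refine a1 (hθ.eq_zero ha.one_sub ?_)
      rw [hθ.one_sub a ha, ← h1, hmul]
  · rw [h]; abel

/-- The corrected map is orthogonally additive. -/
theorem IsInvolutionMap.untwist_add {a b : A} (ha : IsIdempotentElem a)
    (hb : IsIdempotentElem b) (hab : Orth a b) :
    untwist θ a * untwist θ b = 0 ∧ untwist θ (a + b) = untwist θ a + untwist θ b := by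
  have h0 := hθ.untwist_zero hA hK
  by_cases a0 : a = 0
  · rw [a0, h0]; simp
  by_cases b0 : b = 0
  · rw [b0, h0]; simp
  by_cases hne : a + b = 1
  · obtain rfl : b = 1 - a := by rw [← hne]; abel
    have := hθ.untwist_add_one_sub hA hK ha
    exact ⟨this.1, by rw [this.2, add_sub_cancel, hθ.untwist_one]⟩
  · exact ⟨hθ.untwist_mul_of_ne hA ha hb hab a0 b0 hne,
      hθ.untwist_add_of_ne hA hK ha hb hab a0 b0 hne⟩

/-- Conjugating a test idempotent for `a` along with `a` gives a test for the conjugate, so the same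
`v` that works for `θ` works here. -/
theorem IsInvolutionMap.untwist_conj {a : A} (ha : IsIdempotentElem a) (u : Aˣ) :
    ∃ v : Bˣ, untwist θ (u * a * ↑u⁻¹) = v * untwist θ a * ↑v⁻¹ := by
  by_cases a0 : a = 0
  · exact ⟨1, by simp [a0, hθ.untwist_zero hA hK]⟩
  by_cases a1 : 1 - a = 0
  · rw [← sub_eq_zero.1 a1]
    exact ⟨1, by simp [hθ.untwist_one]⟩
  obtain ⟨b, c, hb, hc, hbc, hcb, hs, b0, c0⟩ := hA.exists_split hK ha.one_sub a1
  have har : Orth a (b + c) := by rw [hs]; exact IsIdempotentElem.orth_one_sub ha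
  have hab : Orth a b := Orth.of_add hb ⟨hbc, hcb⟩ har
  have hac : Orth a c := Orth.of_add hc ⟨hcb, hbc⟩ (by rwa [add_comm])
  have hne : a + b ≠ 1 := fun h => c0 (Orth.eq_zero_of_add_eq_one h hac.symm ⟨hcb, hbc⟩)
  obtain ⟨v, hv⟩ := hθ.conj u
  refine ⟨v, (hθ.eq_untwist hA (isIdempotentElem_conj ha u) (isIdempotentElem_conj hb u)
    (hab.conj u) ?_ ?_ ?_ ?_ ?_).symm⟩
  · intro h; rw [Units.mul_inv_eq_iff_eq_mul, zero_mul, Units.mul_right_eq_zero] at h; exact a0 h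
  · intro h; rw [Units.mul_inv_eq_iff_eq_mul, zero_mul, Units.mul_right_eq_zero] at h; exact b0 h
  · intro h
    rw [← add_mul, ← mul_add, Units.mul_inv_eq_iff_eq_mul, one_mul] at h
    exact hne (u.isUnit.mul_left_cancel (h.trans (mul_one _).symm))
  · rw [hv a ha]
    rcases untwist_eq_or θ a with h | h <;> rw [h]
    · exact Or.inl rfl
    · right; rw [mul_sub, sub_mul, mul_one, Units.mul_inv]
  · rw [hv b hb]
    exact (hθ.separated_untwist hA ha hb hab a0 b0 hne).conj v

end Correction

end CStarK

/-! ### The isomorphism of `V` and of `K₀`. -/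

namespace CStarK

section Main

variable {A B : Type*} [CStarAlgebra A] [CStarAlgebra B]

theorem IsInvolutionMap.cls_untwist_congr {θ : A → B} (hθ : IsInvolutionMap θ) (hA : ClassF A)
    (hK : ¬ IsAddCyclic (K0 A)) {e f : A} (he : IsIdempotentElem e) (hf : IsIdempotentElem f)
    (h : V.cls e = V.cls f) : V.cls (untwist θ e) = V.cls (untwist θ f) := by
  obtain ⟨u, hu, -⟩ := hA.cancellation.exists_unit he .zero (mul_zero e) (zero_mul e) hf .zero
    (mul_zero f) (zero_mul f) h rfl
  obtain ⟨v, hv⟩ := hθ.untwist_conj hA hK he u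
  rw [hu, Units.mul_inv_cancel_right] at hv
  rw [hv, V.cls_conj (hθ.isIdempotentElem_untwist he)]

/-- The homomorphism `V(A) → V(B)` extending the map of classes given by `untwist θ`. -/
theorem IsInvolutionMap.exists_hom {θ : A → B} (hθ : IsInvolutionMap θ) (hA : ClassF A)
    (hK : ¬ IsAddCyclic (K0 A)) :
    ∃ g : V A →+ V B, ∀ e, IsIdempotentElem e → g (V.cls e) = V.cls (untwist θ e) := by
  classical
  have := hA.cancellation.isCancelAdd
  -- Only the values of `f` on `[0, [1]]`, whose elements are classes of idempotents of `A`, are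
  -- ever used; the default `0` is immaterial.
  let f : V A → V B := fun x =>
    if h : ∃ e : A, IsIdempotentElem e ∧ V.cls e = x then V.cls (untwist θ h.choose) else 0
  have hf : ∀ e, IsIdempotentElem e → f (V.cls e) = V.cls (untwist θ e) := by
    intro e he
    have h : ∃ e' : A, IsIdempotentElem e' ∧ V.cls e' = V.cls e := ⟨e, he, rfl⟩
    change (if h : _ then _ else _) = _
    rw [dif_pos h]
    exact hθ.cls_untwist_congr hA hK h.choose_spec.1 he h.choose_spec.2
  have hf0 : f 0 = 0 := by
    rw [← V.cls_zero, hf 0 .zero, hθ.untwist_zero hA hK, V.cls_zero]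
  have hadd : ∀ x y w, x + y + w = V.cls (1 : A) → f (x + y) = f x + f y := by
    intro x y w h
    obtain ⟨e, he, hex⟩ := V.exists_idempotent_of_le_one h
    obtain ⟨a, b, ha, hb, h1, h2, rfl, rfl, rfl⟩ := V.cls_split he hex
    obtain ⟨h3, h4⟩ := hθ.untwist_add hA hK ha hb ⟨h1, h2⟩
    have h5 := hθ.untwist_comm ha hb ⟨h1, h2⟩
    rw [← V.cls_add ha hb h1 h2, hf _ he, hf _ ha, hf _ hb, h4,
      V.cls_add (hθ.isIdempotentElem_untwist ha) (hθ.isIdempotentElem_untwist hb) h3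
        (h5.symm.trans h3)]
  obtain ⟨g, hg⟩ := hA.realRankZero.rieszDecomposition.exists_extension
    (fun _ _ => V.eq_zero_of_add_eq_zero) hf0 hadd hA.exists_list
  refine ⟨g, fun e he => ?_⟩
  rw [hg _ _ (V.cls_add_cls_one_sub he), hf e he]

/-- The round trip returns an idempotent or its complement and preserves orthogonality. If `e` came
back as `1 - e`, it would have to be orthogonal to the return of a proper piece `b` of `1 - e`, yet
neither `b` nor `1 - b` is orthogonal to `1 - e`. -/
theorem ClassF1.untwist_untwist (hA : ClassF1 A) (hB : ClassF1 B) (φ : Aˣ ≃* Bˣ) {e : A}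
    (he : IsIdempotentElem e) :
    untwist (idemMap φ.symm) (untwist (idemMap φ) e) = e := by
  have hθ := isInvolutionMap_idemMap φ hA.simple hB.simple
  have hθ' := isInvolutionMap_idemMap φ.symm hB.simple hA.simple
  have hor : ∀ {a : A}, IsIdempotentElem a →
      untwist (idemMap φ.symm) (untwist (idemMap φ) a) = a ∨
      untwist (idemMap φ.symm) (untwist (idemMap φ) a) = 1 - a := by
    intro a ha
    obtain ⟨a', ha', haa, h⟩ := hθ.untwist_eq ha
    rw [h]
    rcases untwist_eq_or (idemMap φ.symm) (idemMap φ a') with h1 | h1 <;>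
      rw [h1, idemMap_symm_idemMap φ ha'] <;> rcases haa with rfl | rfl <;> simp
  by_cases e0 : e = 0
  · rw [e0, hθ.untwist_zero hA.toClassF hA.noncyclic, hθ'.untwist_zero hB.toClassF hB.noncyclic]
  by_cases e1 : 1 - e = 0
  · rw [← sub_eq_zero.1 e1, hθ.untwist_one, hθ'.untwist_one]
  obtain ⟨b, c, hb, hc, hbc, hcb, hs, b0, c0⟩ := hA.toClassF.exists_split hA.noncyclic he.one_sub e1
  have heb : Orth e b := Orth.of_add hb ⟨hbc, hcb⟩ (by
    rw [hs]; exact IsIdempotentElem.orth_one_sub he)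
  have h1 := (hθ.untwist_add hA.toClassF hA.noncyclic he hb heb).1
  have h2 := h1
  rw [hθ.untwist_comm he hb heb] at h2
  have h3 := (hθ'.untwist_add hB.toClassF hB.noncyclic (hθ.isIdempotentElem_untwist he)
    (hθ.isIdempotentElem_untwist hb) ⟨h1, h2⟩).1
  rcases hor he with h | h
  · exact h
  exfalso
  rw [h] at h3
  rcases hor hb with h4 | h4 <;> rw [h4] at h3
  · rw [sub_mul, one_mul, heb.1, sub_zero] at h3
    exact b0 h3
  · rw [sub_mul, one_mul, mul_sub, heb.1, mul_one, sub_zero] at h3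
    apply c0
    rw [← h3, sub_right_comm, ← hs]; abel

theorem ClassF.hom_ext (hA : ClassF A) {M : Type*} [AddCommMonoid M] {g g' : V A →+ M}
    (h : ∀ e, IsIdempotentElem e → g (V.cls e) = g' (V.cls e)) : g = g' := by
  ext x
  obtain ⟨L, hL, rfl⟩ := hA.exists_list x
  rw [map_list_sum, map_list_sum]
  congr 1
  refine List.map_congr_left fun y hy => ?_
  obtain ⟨w, hw⟩ := hL y hy
  obtain ⟨e, he, rfl⟩ := V.exists_idempotent_of_le_one hw
  exact h e he

theorem ClassF1.exists_addEquiv (hA : ClassF1 A) (hB : ClassF1 B) (φ : Aˣ ≃* Bˣ) :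
    ∃ Ψ : V A ≃+ V B, Ψ (V.cls 1) = V.cls 1 := by
  have hθ := isInvolutionMap_idemMap φ hA.simple hB.simple
  have hθ' := isInvolutionMap_idemMap φ.symm hB.simple hA.simple
  obtain ⟨g, hg⟩ := hθ.exists_hom hA.toClassF hA.noncyclic
  obtain ⟨g', hg'⟩ := hθ'.exists_hom hB.toClassF hB.noncyclic
  refine ⟨g.toAddEquiv g' (hA.hom_ext fun e he => ?_) (hB.hom_ext fun e he => ?_), ?_⟩
  · change g' (g (V.cls e)) = V.cls e
    rw [hg e he, hg' _ (hθ.isIdempotentElem_untwist he), hA.untwist_untwist hB φ he]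
  · change g (g' (V.cls e)) = V.cls e
    rw [hg' e he, hg _ (hθ'.isIdempotentElem_untwist he)]
    exact congrArg V.cls (hB.untwist_untwist hA φ.symm he)
  · change g (V.cls 1) = V.cls 1
    rw [hg 1 .one, hθ.untwist_one]

theorem scaledOrderedIso_of_addEquiv (Ψ : V A ≃+ V B) (h1 : Ψ (V.cls 1) = V.cls 1) :
    ScaledOrderedIso (K0.cone A) (K0.scale A) (K0.cone B) (K0.scale B) := by
  let i : V A →+ K0 A := Algebra.GrothendieckAddGroup.of
  let j : V B →+ K0 B := Algebra.GrothendieckAddGroup.of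
  let α : K0 A →+ K0 B := Algebra.GrothendieckAddGroup.lift (j.comp Ψ.toAddMonoidHom)
  let β : K0 B →+ K0 A := Algebra.GrothendieckAddGroup.lift (i.comp Ψ.symm.toAddMonoidHom)
  have hα : ∀ x, α (i x) = j (Ψ x) := fun x =>
    DFunLike.congr_fun (Algebra.GrothendieckAddGroup.lift.symm_apply_apply
      (j.comp Ψ.toAddMonoidHom)) x
  have hβ : ∀ x, β (j x) = i (Ψ.symm x) := fun x =>
    DFunLike.congr_fun (Algebra.GrothendieckAddGroup.lift.symm_apply_apply
      (i.comp Ψ.symm.toAddMonoidHom)) x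
  have hβα : ∀ z, β (α z) = z := fun z => by
    obtain ⟨a, b, rfl⟩ := K0.exists_sub z
    change β (α (i a - i b)) = i a - i b
    rw [map_sub, map_sub, hα, hα, hβ, hβ, Ψ.symm_apply_apply, Ψ.symm_apply_apply]
  have hαβ : ∀ z, α (β z) = z := fun z => by
    obtain ⟨a, b, rfl⟩ := K0.exists_sub z
    change α (β (j a - j b)) = j a - j b
    rw [map_sub, map_sub, hβ, hβ, hα, hα, Ψ.apply_symm_apply, Ψ.apply_symm_apply]
  refine ⟨{ α with invFun := β, left_inv := hβα, right_inv := hαβ }, ?_, ?_⟩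
  · change α '' _ = _
    rw [K0.cone_eq, K0.cone_eq]
    ext z
    constructor
    · rintro ⟨_, ⟨x, rfl⟩, rfl⟩; exact ⟨Ψ x, (hα x).symm⟩
    · rintro ⟨y, rfl⟩
      exact ⟨_, ⟨Ψ.symm y, rfl⟩, (hα _).trans (by rw [Ψ.apply_symm_apply])⟩
  · change α '' _ = _
    rw [K0.scale_eq, K0.scale_eq]
    ext z
    constructor
    · rintro ⟨_, ⟨x, ⟨w, hw⟩, rfl⟩, rfl⟩
      exact ⟨Ψ x, ⟨Ψ w, by rw [← map_add, hw, h1]⟩, (hα x).symm⟩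
    · rintro ⟨y, ⟨w, hw⟩, rfl⟩
      refine ⟨_, ⟨Ψ.symm y, ⟨Ψ.symm w, ?_⟩, rfl⟩, (hα _).trans (by rw [Ψ.apply_symm_apply])⟩
      rw [← map_add, hw, ← h1, Ψ.symm_apply_apply]

end Main

end CStarK

theorem theorem4p5 {A B : Type*} [CStarAlgebra A] [CStarAlgebra B]
    (hA : CStarK.ClassF1 A) (hB : CStarK.ClassF1 B) (h : Nonempty (Aˣ ≃* Bˣ)) :
    CStarK.IsScaledOrderedGroup (CStarK.K0.cone A) (CStarK.K0.scale A) ∧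
    CStarK.IsScaledOrderedGroup (CStarK.K0.cone B) (CStarK.K0.scale B) ∧
    CStarK.ScaledOrderedIso (CStarK.K0.cone A) (CStarK.K0.scale A)
      (CStarK.K0.cone B) (CStarK.K0.scale B) := by
  obtain ⟨φ⟩ := h
  obtain ⟨Ψ, hΨ⟩ := hA.exists_addEquiv hB φ
  exact ⟨hA.isScaledOrderedGroup, hB.isScaledOrderedGroup,
    CStarK.scaledOrderedIso_of_addEquiv Ψ hΨ⟩
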